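/- **Definitions.** A *parameterized problem* consists of a set of instances, encoded by strings over a finite alphabet, a parameter $k\in\mathbb{N}$ of each instance, and a set of YES-instances; the size $|I|$ of an instance is the length of its encoding. Let $\mathcal F$ be a class of functions $f:\mathbb{N}\to\mathbb{N}$, namely either the class of all functions or the class of all computable functions. FPT is the class of parameterized problems that some Turing machine decides in at most $f(k)\cdot(|I|+1)^{c}$ steps, for some $f\in\mathcal F$ and some constant $c$. An *FPT reduction* from $\Pi$ to $\Pi'$ is a map of instances $(I,k)\mapsto(I',k')$ such that $k'=h(k)$ for some computable function $h$, $(I,k)$ is a YES-instance of $\Pi$ if and only if $(I',k')$ is a YES-instance of $\Pi'$, and the map can be computed by a Turing machine in at most $f(k)\cdot(|I|+1)^{c}$ steps for some $f\in\mathcal F$ and some constant $c$. W[1] is the class of parameterized problems that are FPT-reducible to Independent Set parameterized by the solution size. A parameterized problem is *W[1]-hard* if every problem in W[1] is FPT-reducible to it. An instance of *$p$-Local Search on Rosenthal potential* consists of a finite directed graph $G=(V,E)$ with a rational cost $c_e\ge 0$ of every arc $e$, a root $r\in V$, terminals $t_1,\dots,t_\ell\in V$ (not necessarily distinct; one for each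 player), a strategy profile $s=(P_1,\dots,P_\ell)$, where $P_i$ is a (simple) directed path from $r$ to $t_i$, and an integer $k\ge 0$; numbers are encoded in binary. The parameter is $k$. If exactly $h\ge 1$ players use an arc $e$, each of them pays $c_e(h)=c_e/h$ for it, and the Rosenthal potential of a strategy profile $s$ is $$\Phi(s)=\sum_{e\in\bigcup_i E(P_i)}\ \sum_{h=1}^{n_e(s)}\frac{c_e}{h},$$ where $n_e(s)$ is the number of players whose path contains $e$. The question is whether there is a strategy profile $s'$ with $\Phi(s')<\Phi(s)$ such that at most $k$ players have different strategies in $s$ and $s'$. **Theorem.** $p$-Local Search on Rosenthal potential is W[1]-hard. Consequently, unless FPT $=$ W[1], for no function $f\in\mathcal F$ and no constant $c$ can it be decided in time $f(k)\cdot(|I|+1)^{c}$. Both statements hold under both readings of $\mathcal F$ (arbitrary functions throughout, or computable functions throughout). -/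

import Mathlib

open Turing Computability

noncomputable section

/-! ## Parameterized problems and the classes FPT and W[1] -/

namespace ParamComplexity

/-- A parameterized decision problem: a type of instances, an encoding of the instances by strings
over a finite alphabet, the parameter of each instance, and the set of YES-instances. -/
structure ParamProblem where
  /-- the instances -/
  Inst : Type
  /-- the input alphabet -/
  Alphabet : Type
  /-- the input alphabet is finite -/
  [alphabetFintype : Fintype Alphabet]
  /-- the encoding of instances as strings -/
  encoding : Encoding Inst Alphabet
  /-- the parameter -/
  param : Inst → ℕ
  /-- the YES-instances -/
  yes : Set Inst

/-- The size of an instance: the length of its encoding. -/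
def ParamProblem.size (P : ParamProblem) (x : P.Inst) : ℕ := (P.encoding.encode x).length

/-- The function `r` is computed, with respect to the string encodings `ea` and `eb`, by one
(multi-stack) Turing machine that on every input `a` halts after at most `T a` steps. -/
def ComputableInTime {α β Γ Γ' : Type} (ea : Encoding α Γ) (eb : Encoding β Γ') (r : α → β)
    (T : α → ℕ) : Prop :=
  ∃ M : TM2ComputableAux Γ Γ', ∀ a : α,
    Nonempty (TM2OutputsInTime M.tm
      ((ea.encode a).map M.inputAlphabet.symm)
      (some ((eb.encode (r a)).map M.outputAlphabet.symm))
      (T a))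

open Classical in
/-- `P` is decided by one Turing machine in at most `T x` steps on every instance `x`. -/
def ParamProblem.SolvableInTime (P : ParamProblem) (T : P.Inst → ℕ) : Prop :=
  ComputableInTime P.encoding encodingBoolBool (fun x => decide (x ∈ P.yes)) T

/-- Fixed-parameter tractability: solvability in time `f(k) · n ^ O(1)`, where `f` ranges over the
class `𝓕` of functions. -/
def FPT (𝓕 : Set (ℕ → ℕ)) : Set ParamProblem :=
  {P | ∃ f ∈ 𝓕, ∃ c : ℕ, P.SolvableInTime fun x => f (P.param x) * (P.size x + 1) ^ c}

/-- FPT reductions: maps `r` on instances such that `k' = h(k)` for a computable `h`, which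
preserve and reflect YES-instances, and which can be computed in time `f(k) · n ^ O(1)`. -/
def FPTReducible (𝓕 : Set (ℕ → ℕ)) (P Q : ParamProblem) : Prop :=
  ∃ r : P.Inst → Q.Inst,
    (∃ h : ℕ → ℕ, Computable h ∧ ∀ x, Q.param (r x) = h (P.param x)) ∧
    (∀ x, x ∈ P.yes ↔ r x ∈ Q.yes) ∧
    ∃ f ∈ 𝓕, ∃ c : ℕ,
      ComputableInTime P.encoding Q.encoding r fun x => f (P.param x) * (P.size x + 1) ^ c

/-! ### The string encoding of finite sequences of natural numbers -/

/-- A finite sequence of natural numbers, written in binary (least significant bit first), each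
number being followed by the separator `none`. -/
def encodeNats (l : List ℕ) : List (Option Bool) :=
  l.flatMap fun m => m.bits.map some ++ [none]

theorem bits_injective : Function.Injective Nat.bits := by
  intro a
  induction a using Nat.binaryRec' with
  | zero =>
    intro b h
    by_contra hb
    have h1 : b.size = 0 := by rw [← Nat.size_eq_bits_len, ← h]; simp
    exact hb (Nat.size_eq_zero.mp h1).symm
  | bit c n hn ih =>
    intro b h
    induction b using Nat.binaryRec' with
    | zero => rw [Nat.bits_append_bit _ _ hn] at h; simp at h
    | bit d m hm _ =>
      rw [Nat.bits_append_bit _ _ hn, Nat.bits_append_bit _ _ hm] at h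
      injection h with h1 h2
      rw [h1, ih h2]

theorem block_inj : ∀ {a b : List Bool} {x y : List (Option Bool)},
    a.map some ++ none :: x = b.map some ++ none :: y → a = b ∧ x = y
  | [], [], _, _, h => by simpa using h
  | [], _ :: _, _, _, h => by simp at h
  | _ :: _, [], _, _, h => by simp at h
  | c :: a, d :: b, x, y, h => by
    simp only [List.map_cons, List.cons_append, List.cons.injEq, Option.some.injEq] at h
    obtain ⟨h1, h2⟩ := block_inj h.2
    exact ⟨by rw [h.1, h1], h2⟩

theorem encodeNats_injective : Function.Injective encodeNats := by
  intro l
  induction l with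
  | nil =>
    intro l' h
    cases l' with
    | nil => rfl
    | cons a l' => simp [encodeNats] at h
  | cons a l ih =>
    intro l' h
    cases l' with
    | nil => simp [encodeNats] at h
    | cons b l' =>
      simp only [encodeNats, List.flatMap_cons, List.append_assoc, List.singleton_append] at h
      obtain ⟨h1, h2⟩ := block_inj h
      rw [bits_injective h1, ih h2]

/-- The encoding of a type of instances given by an injective description of the instances by
finite sequences of natural numbers. -/
def encodingOfNats {α : Type} (d : α → List ℕ) (hd : Function.Injective d) :
    Encoding α (Option Bool) where
  encode x := encodeNats (d x)
  decode := Function.partialInv fun x => encodeNats (d x)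
  decode_encode := Function.partialInv_left (encodeNats_injective.comp hd)

/-- Concatenations of self-delimiting blocks determine the blocks. -/
theorem flatMap_block_inj {ι : Type} {f g : ι → List ℕ}
    (hfg : ∀ i, ∀ x y : List ℕ, f i ++ x = g i ++ y → f i = g i) :
    ∀ (l : List ι) (x y : List ℕ), l.flatMap f ++ x = l.flatMap g ++ y →
      (∀ i ∈ l, f i = g i) ∧ x = y
  | [], x, y, h => by simpa using h
  | a :: l, x, y, h => by
    simp only [List.flatMap_cons, List.append_assoc] at h
    have h1 := hfg a _ _ h
    rw [h1] at h
    obtain ⟨h2, h3⟩ := flatMap_block_inj hfg l x y (List.append_cancel_left h)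
    refine ⟨?_, h3⟩
    intro i hi
    rcases List.mem_cons.mp hi with rfl | hi
    · exact h1
    · exact h2 i hi

/-! ### Independent Set and the class W[1] -/

/-- An instance of Independent Set: a finite simple graph and an integer `k ≥ 0`. -/
structure ISInstance where
  /-- the number of vertices -/
  n : ℕ
  /-- the graph -/
  graph : SimpleGraph (Fin n)
  /-- the size of the independent set asked for -/
  k : ℕ

open Classical in
/-- `n`, `k`, and the adjacency matrix row by row. -/
def ISInstance.toNats (I : ISInstance) : List ℕ :=
  I.n :: I.k :: (List.finRange I.n).flatMap fun u =>
    (List.finRange I.n).flatMap fun v => [if I.graph.Adj u v then 1 else 0]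

theorem ISInstance.toNats_injective : Function.Injective ISInstance.toNats := by
  classical
  rintro ⟨n, G, k⟩ ⟨n', G', k'⟩ h
  simp only [ISInstance.toNats, List.cons.injEq] at h
  obtain ⟨rfl, rfl, h⟩ := h
  have row (u : Fin n) (x y : List ℕ) := flatMap_block_inj (ι := Fin n)
    (f := fun v => [if G.Adj u v then 1 else 0]) (g := fun v => [if G'.Adj u v then 1 else 0])
    (by intro i x y hxy; simpa using (List.cons.inj hxy).1) (List.finRange n) x y
  have key := (flatMap_block_inj (ι := Fin n)
    (fun u x y hxy => List.flatMap_congr (row u x y hxy).1) (List.finRange n) [] []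
    (by simpa using h)).1
  congr 1
  ext u v
  have h2 := (row u [] [] (by simpa using key u (List.mem_finRange u))).1 v (List.mem_finRange v)
  by_cases a : G.Adj u v <;> by_cases b : G'.Adj u v <;> simp_all

/-- Independent Set, parameterized by the solution size `k`: is there a set of `k` pairwise
non-adjacent vertices? -/
def independentSet : ParamProblem where
  Inst := ISInstance
  Alphabet := Option Bool
  encoding := encodingOfNats ISInstance.toNats ISInstance.toNats_injective
  param I := I.k
  yes := {I | ∃ S : Finset (Fin I.n), S.card = I.k ∧ I.graph.IsIndepSet (S : Set (Fin I.n))}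

/-- W[1]: the parameterized problems that are FPT-reducible to Independent Set. -/
def W1 (𝓕 : Set (ℕ → ℕ)) : Set ParamProblem :=
  {P | FPTReducible 𝓕 P independentSet}

/-- W[1]-hardness: every problem of W[1] is FPT-reducible to `Q`. -/
def IsW1Hard (𝓕 : Set (ℕ → ℕ)) (Q : ParamProblem) : Prop :=
  ∀ P ∈ W1 𝓕, FPTReducible 𝓕 P Q

end ParamComplexity

/-! ## Multicast games -/

namespace Multicast

/-- A (simple) directed path from `u` to `v` in a digraph, as the sequence of its vertices. -/
@[ext]
structure DiPath {V : Type} (G : Digraph V) (u v : V) where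
  /-- the vertices in the order in which they are visited -/
  verts : List V
  /-- consecutive vertices are joined by arcs -/
  isChain : verts.IsChain G.Adj
  /-- no vertex is visited twice -/
  nodup : verts.Nodup
  /-- the path starts in `u` -/
  head_eq : verts.head? = some u
  /-- the path ends in `v` -/
  last_eq : verts.getLast? = some v

variable {V : Type} [DecidableEq V] {G : Digraph V}

/-- The arcs `E(P)` of a path. -/
def DiPath.arcs {u v : V} (P : DiPath G u v) : Finset (V × V) :=
  (P.verts.zip P.verts.tail).toFinset

/-- Strategy profiles: each player `i` has a path from the root `r` to his terminal `t i`. -/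
abbrev Profile (G : Digraph V) (r : V) {l : ℕ} (t : Fin l → V) : Type :=
  ∀ i : Fin l, DiPath G r (t i)

variable {r : V} {l : ℕ} {t : Fin l → V}

/-- `n_e(s)`: the number of players that use the arc `e` in `s`. -/
def Profile.usage (s : Profile G r t) (e : V × V) : ℕ :=
  (Finset.univ.filter fun i => e ∈ (s i).arcs).card

/-- The potential `Φ(s) = ∑_{e ∈ ⋃ E(P_i)} ∑_{h = 1}^{n_e(s)} c_e(h)`. -/
def Profile.potential (s : Profile G r t) (c : V × V → ℕ → ℝ) : ℝ :=
  ∑ e ∈ Finset.univ.biUnion fun i => (s i).arcs, ∑ h ∈ Finset.Icc 1 (s.usage e), c e h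

open Classical in
/-- `D(s, s')`: the number of players with different strategies in `s` and `s'`. -/
def Profile.dist (s s' : Profile G r t) : ℕ :=
  (Finset.univ.filter fun i => s i ≠ s' i).card

/-- The digraph of a matrix of arc costs; `none` means that there is no arc. -/
def digraphOfCost (cost : V → V → Option ℚ≥0) : Digraph V where
  Adj u v := cost u v ≠ none

/-- An instance of local search on the Rosenthal potential of a multicast game: a finite directed
graph with nonnegative arc costs, a root, the terminals of the players, a strategy profile, and an
integer `k ≥ 0`. The costs are rational, so that instances are finite objects. -/
structure LSInstance where
  /-- the number of vertices of the network -/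
  n : ℕ
  /-- `cost u v` is the cost of the arc from `u` to `v`, and `none` if there is no such arc -/
  cost : Fin n → Fin n → Option ℚ≥0
  /-- the root -/
  root : Fin n
  /-- the number of players -/
  players : ℕ
  /-- the terminals of the players -/
  terminal : Fin players → Fin n
  /-- the given strategy profile -/
  profile : Profile (digraphOfCost cost) root terminal
  /-- the number of players that may change their strategy -/
  k : ℕ

/-- The fair cost sharing functions `c_e(h) = c_e / h`. -/
def LSInstance.shareCost (I : LSInstance) (e : Fin I.n × Fin I.n) (h : ℕ) : ℝ :=
  (((I.cost e.1 e.2).getD 0 : ℚ≥0) : ℝ) / (h : ℝ)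

/-- The Rosenthal potential of a strategy profile of the game. -/
def LSInstance.rosenthal (I : LSInstance)
    (s : Profile (digraphOfCost I.cost) I.root I.terminal) : ℝ :=
  s.potential I.shareCost

/-- Numerator and denominator of an arc cost; `0, 0` if there is no arc. -/
def costToNats : Option ℚ≥0 → List ℕ
  | none => [0, 0]
  | some q => [q.num, q.den]

/-- The number of vertices, the root, the number of players, `k`, the matrix of arc costs row by
row, and for every player his terminal, the number of vertices of his path and these vertices in
order. -/
def LSInstance.toNats (I : LSInstance) : List ℕ :=
  I.n :: (I.root : ℕ) :: I.players :: I.k ::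
    (((List.finRange I.n).flatMap fun u => (List.finRange I.n).flatMap fun v =>
        costToNats (I.cost u v)) ++
      (List.finRange I.players).flatMap fun i =>
        (I.terminal i : ℕ) :: (I.profile i).verts.length :: (I.profile i).verts.map Fin.val)

theorem costToNats_injective : Function.Injective costToNats := by
  rintro (_ | p) (_ | q) h
  · rfl
  · simp only [costToNats, List.cons.injEq] at h
    exact absurd h.2.1.symm q.den_ne_zero
  · simp only [costToNats, List.cons.injEq] at h
    exact absurd h.2.1 p.den_ne_zero
  · simp only [costToNats, List.cons.injEq] at h
    rw [NNRat.ext_num_den h.1 h.2.1]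

theorem costToNats_length (a : Option ℚ≥0) : (costToNats a).length = 2 := by
  cases a <;> rfl

theorem LSInstance.toNats_injective : Function.Injective LSInstance.toNats := by
  rintro ⟨n, c, r, l, t, s, k⟩ ⟨n', c', r', l', t', s', k'⟩ h
  simp only [LSInstance.toNats, List.cons.injEq] at h
  obtain ⟨rfl, hr, rfl, rfl, h⟩ := h
  obtain rfl := Fin.ext hr
  have row (u : Fin n) (x y : List ℕ) := ParamComplexity.flatMap_block_inj (ι := Fin n)
    (f := fun v => costToNats (c u v)) (g := fun v => costToNats (c' u v))
    (by
      intro i x y hxy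
      exact (List.append_inj hxy (by rw [costToNats_length, costToNats_length])).1)
    (List.finRange n) x y
  obtain ⟨hc, hs⟩ := ParamComplexity.flatMap_block_inj (ι := Fin n)
    (fun u x y hxy => List.flatMap_congr (row u x y hxy).1) (List.finRange n) _ _ h
  obtain rfl : c = c' := by
    funext u v
    exact costToNats_injective
      ((row u [] [] (by simpa using hc u (List.mem_finRange u))).1 v (List.mem_finRange v))
  have hp := (ParamComplexity.flatMap_block_inj (ι := Fin l)
    (f := fun i => (t i : ℕ) :: (s i).verts.length :: (s i).verts.map Fin.val)
    (g := fun i => (t' i : ℕ) :: (s' i).verts.length :: (s' i).verts.map Fin.val) (by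
    intro i x y hxy
    simp only [List.cons_append, List.cons.injEq] at hxy
    obtain ⟨h1, h2, h3⟩ := hxy
    have h4 := (List.append_inj h3 (by simpa using h2)).1
    rw [h1, h2, h4]) (List.finRange l) [] [] (by simpa using hs)).1
  obtain rfl : t = t' := by
    funext i
    exact Fin.ext (List.cons.inj (hp i (List.mem_finRange i))).1
  obtain rfl : s = s' := by
    funext i
    have h1 := (List.cons.inj (List.cons.inj (hp i (List.mem_finRange i))).2).2
    exact DiPath.ext (List.map_injective_iff.mpr Fin.val_injective h1)
  rfl

/-- Local search on the Rosenthal potential, parameterized by `k`: is there a strategy profile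
`s'` with `Φ(s') < Φ(s)` and `D(s, s') ≤ k`? -/
def localSearch : ParamComplexity.ParamProblem where
  Inst := LSInstance
  Alphabet := Option Bool
  encoding := ParamComplexity.encodingOfNats LSInstance.toNats LSInstance.toNats_injective
  param I := I.k
  yes := {I | ∃ s' : Profile (digraphOfCost I.cost) I.root I.terminal,
    I.rosenthal s' < I.rosenthal I.profile ∧ I.profile.dist s' ≤ I.k}

end Multicast

end

/-!
Since reductions compose, it suffices to reduce Independent Set to local search on the Rosenthal
potential; and if local search were in FPT, then so would be every problem that reduces to it,
i.e. FPT and W[1] would coincide (`ParamComplexity.FPTReducible.trans`,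
`ParamComplexity.fpt_eq_w1`).

**The reduction.** Let `G` be a graph and `k` the size of the independent set asked for. After
adding two isolated vertices, the question is whether there is an independent set of size `K = k +
2 ≥ 2`. A candidate `x = (i, u)` is a pair of a color `i < K` and a vertex `u`; two candidates are
compatible if their colors differ, and their vertices differ and are not adjacent. So the question
is whether there is a transversal, i.e. one candidate of each color such that these are pairwise
compatible (`SharingGadget.exists_transversal_iff`).

For every candidate `x` and every color `j` there is a player `(x, j)`. The paths to his terminal
have two arcs and lead through a facility, so that a profile amounts to the choice of a facility
for each player, and only the arcs from the root to the facilities have a cost. Initially the `K`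
players of every candidate `x` use its direct facility, of cost `d`. For compatible candidates `x`
and `y` there is a shared facility, of cost `c`, for the two players `(x, color y)` and `(y, color
x)`. The player `(x, color x)` can never move. At most `K (K - 1)` players may change their
strategies.

Let `H` denote the harmonic numbers. If `m` players stay in a direct facility, then its
contribution to the potential drops by `d (H K - H m)`. Two players in a shared facility pay `3 c
/ 4` on average, and a single one pays `c / 4` more. Hence the potential changes by `∑ₓ ((3 c / 4)
(K - mₓ) - d (H K - H mₓ)) + (c / 4) · #{shared facilities with one user}`, see
`SharingGadget.potential_eq`. The average saving `d (H K - H m) / (K - m)` increases strictly as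
`m` decreases. So `c` can be chosen such that the summand of `x` is slightly negative, say `-ε`,
for `m = 1`, but at least `K ε` for `1 < m < K` (`SharingGadget.mul_gain_le_gap`); costs that are
large compared to rounding errors make this work with integers. Since at most `K (K - 1)` players
move, at most `K` candidates have `m = 1`. Thus the potential decreases only if every candidate
that loses a player loses all `K - 1` movable ones, and no shared facility has a single user. Then
the candidates with `m = 1` are the desired transversal (`SharingGadget.exists_transversal`).
Conversely, a transversal yields a profile whose potential is smaller by `K ε`
(`SharingGadget.exists_assignment`).

**The running time.** Programs for machines with many stacks are composed from sequences, case
distinctions, and loops over the symbols of a stack. They are translated into `FinTM2` machines by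
`StackProg.computableInTime_of_runs`. Numbers are converted to unary notation; a class
`StackProg.Comp` of functions that can be evaluated in polynomial time is closed under arithmetic
operations, bounded sums, and access to the adjacency matrix. The encoding of the constructed
instance is a sequence of numbers whose `i`-th entry belongs to this class, so it can be written
down one entry at a time (`StackProg.exists_program`). The time is polynomial in `|I| + k`.
-/

/-! ### Runs of stack machines -/

namespace TM2Run

section
variable {K : Type} [DecidableEq K] {Γ : K → Type} {Λ σ : Type}

/-- `StepsTo M c n c'`: the machine `M` moves from `c` to `c'` in exactly `n` steps. -/
def StepsTo (M : Λ → TM2.Stmt Γ Λ σ) (c : TM2.Cfg Γ Λ σ) (n : ℕ) (c' : TM2.Cfg Γ Λ σ) : Prop :=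
  (flip bind (TM2.step M))^[n] (some c) = some c'

variable {M : Λ → TM2.Stmt Γ Λ σ} {c c₁ c₂ : TM2.Cfg Γ Λ σ} {m n : ℕ}

theorem StepsTo.refl (c : TM2.Cfg Γ Λ σ) : StepsTo M c 0 c := rfl

theorem StepsTo.trans (h₁ : StepsTo M c m c₁) (h₂ : StepsTo M c₁ n c₂) :
    StepsTo M c (m + n) c₂ := by
  unfold StepsTo at *
  rw [Nat.add_comm, Function.iterate_add_apply, h₁, h₂]

theorem iterate_none (n : ℕ) : (flip bind (TM2.step M))^[n] none = none := by
  induction n with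
  | zero => rfl
  | succ n ih => rw [Function.iterate_succ_apply]; exact ih

theorem stepsTo_succ {l : Λ} {v : σ} {S : ∀ k, List (Γ k)} :
    StepsTo M ⟨some l, v, S⟩ (n + 1) c ↔ StepsTo M (TM2.stepAux (M l) v S) n c := by
  unfold StepsTo
  rw [Function.iterate_succ_apply]
  rfl

theorem not_stepsTo_succ_of_halted {v : σ} {S : ∀ k, List (Γ k)} :
    ¬ StepsTo M ⟨none, v, S⟩ (n + 1) c := by
  unfold StepsTo
  rw [Function.iterate_succ_apply]
  change (flip bind (TM2.step M))^[n] none ≠ _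
  rw [iterate_none]
  simp

end

theorem initList_eq (tm : FinTM2) (s : List (tm.Γ tm.k₀)) :
    initList tm s = ⟨some tm.main, tm.initialState, Function.update (fun _ => []) tm.k₀ s⟩ := by
  unfold initList
  congr 1
  funext k
  by_cases h : k = tm.k₀
  · subst h; simp
  · simp [h]

theorem haltList_eq (tm : FinTM2) (s : List (tm.Γ tm.k₁)) :
    haltList tm s = ⟨none, tm.initialState, Function.update (fun _ => []) tm.k₁ s⟩ := by
  unfold haltList
  congr 1
  funext k
  by_cases h : k = tm.k₁
  · subst h; simp
  · simp [h]

theorem outputsInTime_iff (tm : FinTM2) (l : List (tm.Γ tm.k₀)) (l' : List (tm.Γ tm.k₁)) (T : ℕ) :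
    Nonempty (TM2OutputsInTime tm l (some l') T) ↔ ∃ n ≤ T,
      StepsTo tm.m ⟨some tm.main, tm.initialState, Function.update (fun _ => []) tm.k₀ l⟩ n
        ⟨none, tm.initialState, Function.update (fun _ => []) tm.k₁ l'⟩ := by
  rw [← initList_eq, ← haltList_eq]
  constructor
  · rintro ⟨⟨⟨n, h⟩, hn⟩⟩
    exact ⟨n, hn, h⟩
  · rintro ⟨n, hn, h⟩
    exact ⟨⟨⟨n, h⟩, hn⟩⟩

/-! ### The length of the output -/

section
variable {K : Type} [DecidableEq K] {Γ : K → Type} {Λ σ : Type}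

/-- An upper bound on the number of symbols that a statement pushes on any stack. -/
def pushes : TM2.Stmt Γ Λ σ → ℕ
  | .push _ _ q => pushes q + 1
  | .peek _ _ q => pushes q
  | .pop _ _ q => pushes q
  | .load _ q => pushes q
  | .branch _ p q => pushes p + pushes q
  | .goto _ => 0
  | .halt => 0

theorem length_stepAux_le (q : TM2.Stmt Γ Λ σ) (v : σ) (S : ∀ k, List (Γ k)) (k : K) :
    ((TM2.stepAux q v S).stk k).length ≤ (S k).length + pushes q := by
  induction q generalizing v S with
  | push k' f q ih =>
    refine (ih _ _).trans ?_
    by_cases h : k = k'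
    · subst h; simp [pushes]; omega
    · simp [pushes, h]
  | peek k' f q ih => exact ih _ _
  | pop k' f q ih =>
    refine (ih _ _).trans ?_
    by_cases h : k = k'
    · subst h; simp [pushes]
    · simp [pushes, h]
  | load a q ih => exact ih _ _
  | branch f p q ihp ihq =>
    simp only [TM2.stepAux, pushes]
    cases f v
    · have := ihq v S; simp only [cond_false]; omega
    · have := ihp v S; simp only [cond_true]; omega
  | goto f => simp [pushes]
  | halt => simp [pushes]

theorem StepsTo.length_le {M : Λ → TM2.Stmt Γ Λ σ} {C : ℕ} (hC : ∀ l, pushes (M l) ≤ C) {n : ℕ} :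
    ∀ {c c' : TM2.Cfg Γ Λ σ}, StepsTo M c n c' → ∀ k,
      (c'.stk k).length ≤ (c.stk k).length + C * n := by
  induction n with
  | zero =>
    intro c c' h k
    obtain rfl : c = c' := Option.some.inj h
    simp
  | succ n ih =>
    rintro ⟨_ | l, v, S⟩ c' h k
    · exact absurd h not_stepsTo_succ_of_halted
    · have h1 := ih (stepsTo_succ.1 h) k
      have h2 := length_stepAux_le (M l) v S k
      have h3 := hC l
      simp only at *
      rw [Nat.mul_succ]
      omega

end

end TM2Run

namespace ParamComplexity
open TM2Run

/-- A machine running for `T` steps writes at most `O(T)` symbols beyond its input. -/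
theorem ComputableInTime.exists_length_le {α β Γ Γ' : Type} {ea : Encoding α Γ} {eb : Encoding β Γ'}
    {r : α → β} {T : α → ℕ} (h : ComputableInTime ea eb r T) :
    ∃ C : ℕ, ∀ a, (eb.encode (r a)).length ≤ (ea.encode a).length + C * T a := by
  obtain ⟨M, hM⟩ := h
  have := M.tm.ΛFin
  obtain ⟨C, hC⟩ := (Set.finite_range fun l => pushes (M.tm.m l)).bddAbove
  refine ⟨C, fun a => ?_⟩
  obtain ⟨n, hn, h⟩ := (outputsInTime_iff _ _ _ _).1 (hM a)
  have h1 := h.length_le (fun l => hC ⟨l, rfl⟩) M.tm.k₁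
  simp only [Function.update_self, List.length_map] at h1
  have h2 : (Function.update (fun _ => [])
      M.tm.k₀ ((ea.encode a).map M.inputAlphabet.symm) M.tm.k₁ : List (M.tm.Γ M.tm.k₁)).length
      ≤ (ea.encode a).length := by
    generalize M.tm.k₁ = k
    by_cases hk : k = M.tm.k₀
    · subst hk; simp
    · simp [hk]
  have h3 : C * n ≤ C * T a := Nat.mul_le_mul_left _ hn
  omega

end ParamComplexity

/-! ### Sequential composition of machines -/

namespace CompMachine
open TM2Run

section
variable (M₁ M₂ : FinTM2)

/-- The stack alphabets of the composed machine: the stacks of both machines and an auxiliary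
stack `inr none`, through which the intermediate result is passed. -/
abbrev Alph : M₁.K ⊕ Option M₂.K → Type
  | .inl k => M₁.Γ k
  | .inr none => M₂.Γ M₂.k₀
  | .inr (some k) => M₂.Γ k

/-- The labels of the composed machine: those of both machines, and two labels for the two loops
that move the intermediate result to the auxiliary stack and from there to the second machine. -/
abbrev Label : Type := M₁.Λ ⊕ M₂.Λ ⊕ Bool

/-- The internal states of the composed machine; the last component holds a symbol that is being
moved. -/
abbrev State : Type := M₁.σ × M₂.σ × Option (M₂.Γ M₂.k₀)

variable {M₁ M₂}

/-- The contents of all stacks of the composed machine. -/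
def joinStk (S₁ : ∀ k, List (M₁.Γ k)) (A : List (M₂.Γ M₂.k₀)) (S₂ : ∀ k, List (M₂.Γ k)) :
    ∀ k, List (Alph M₁ M₂ k)
  | .inl k => S₁ k
  | .inr none => A
  | .inr (some k) => S₂ k

variable {S₁ : ∀ k, List (M₁.Γ k)} {A : List (M₂.Γ M₂.k₀)} {S₂ : ∀ k, List (M₂.Γ k)}

theorem update_joinStk_left (k : M₁.K) (x : List (M₁.Γ k)) :
    Function.update (joinStk S₁ A S₂) (.inl k) x = joinStk (Function.update S₁ k x) A S₂ := by
  funext k'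
  rcases k' with k' | _ | k'
  · by_cases h : k' = k
    · subst h; simp [joinStk]
    · simp [joinStk, h]
  · simp [joinStk]
  · simp [joinStk]

theorem update_joinStk_aux (x : List (M₂.Γ M₂.k₀)) :
    Function.update (joinStk S₁ A S₂) (.inr none) x = joinStk S₁ x S₂ := by
  funext k'
  rcases k' with k' | _ | k' <;> simp [joinStk]

theorem update_joinStk_right (k : M₂.K) (x : List (M₂.Γ k)) :
    Function.update (joinStk S₁ A S₂) (.inr (some k)) x =
      joinStk S₁ A (Function.update S₂ k x) := by
  funext k'
  rcases k' with k' | _ | k'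
  · simp [joinStk]
  · simp [joinStk]
  · by_cases h : k' = k
    · subst h; simp [joinStk]
    · simp [joinStk, h]

variable (M₁ M₂)

/-- A statement of the first machine as a statement of the composed machine; instead of halting,
it starts the transfer of the intermediate result. -/
def liftLeft : TM2.Stmt M₁.Γ M₁.Λ M₁.σ → TM2.Stmt (Alph M₁ M₂) (Label M₁ M₂) (State M₁ M₂)
  | .push k f q => .push (.inl k) (fun v => f v.1) (liftLeft q)
  | .peek k f q => .peek (.inl k) (fun v o => (f v.1 o, v.2)) (liftLeft q)
  | .pop k f q => .pop (.inl k) (fun v o => (f v.1 o, v.2)) (liftLeft q)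
  | .load f q => .load (fun v => (f v.1, v.2)) (liftLeft q)
  | .branch f p q => .branch (fun v => f v.1) (liftLeft p) (liftLeft q)
  | .goto f => .goto fun v => .inl (f v.1)
  | .halt => .goto fun _ => .inr (.inr false)

/-- A statement of the second machine as a statement of the composed machine. -/
def liftRight : TM2.Stmt M₂.Γ M₂.Λ M₂.σ → TM2.Stmt (Alph M₁ M₂) (Label M₁ M₂) (State M₁ M₂)
  | .push k f q => .push (.inr (some k)) (fun v => f v.2.1) (liftRight q)
  | .peek k f q => .peek (.inr (some k)) (fun v o => (v.1, f v.2.1 o, v.2.2)) (liftRight q)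
  | .pop k f q => .pop (.inr (some k)) (fun v o => (v.1, f v.2.1 o, v.2.2)) (liftRight q)
  | .load f q => .load (fun v => (v.1, f v.2.1, v.2.2)) (liftRight q)
  | .branch f p q => .branch (fun v => f v.2.1) (liftRight p) (liftRight q)
  | .goto f => .goto fun v => .inr (.inl (f v.2.1))
  | .halt => .halt

/-- A configuration of the first machine inside the composed machine. -/
def embedLeft (v₂ : M₂.σ) (o : Option (M₂.Γ M₂.k₀)) (A : List (M₂.Γ M₂.k₀))
    (S₂ : ∀ k, List (M₂.Γ k)) (c : TM2.Cfg M₁.Γ M₁.Λ M₁.σ) :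
    TM2.Cfg (Alph M₁ M₂) (Label M₁ M₂) (State M₁ M₂) :=
  ⟨some (c.l.elim (.inr (.inr false)) .inl), (c.var, v₂, o), joinStk c.stk A S₂⟩

/-- A configuration of the second machine inside the composed machine. -/
def embedRight (v₁ : M₁.σ) (o : Option (M₂.Γ M₂.k₀)) (S₁ : ∀ k, List (M₁.Γ k))
    (A : List (M₂.Γ M₂.k₀)) (c : TM2.Cfg M₂.Γ M₂.Λ M₂.σ) :
    TM2.Cfg (Alph M₁ M₂) (Label M₁ M₂) (State M₁ M₂) :=
  ⟨c.l.map fun l => .inr (.inl l), (v₁, c.var, o), joinStk S₁ A c.stk⟩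

theorem stepAux_liftLeft (q : TM2.Stmt M₁.Γ M₁.Λ M₁.σ) (v : M₁.σ) (S : ∀ k, List (M₁.Γ k))
    (v₂ : M₂.σ) (o : Option (M₂.Γ M₂.k₀)) (A : List (M₂.Γ M₂.k₀)) (S₂ : ∀ k, List (M₂.Γ k)) :
    TM2.stepAux (liftLeft M₁ M₂ q) (v, v₂, o) (joinStk S A S₂) =
      embedLeft M₁ M₂ v₂ o A S₂ (TM2.stepAux q v S) := by
  induction q generalizing v S with
  | push k f q ih =>
    simp only [liftLeft, TM2.stepAux]
    rw [update_joinStk_left, ← ih]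
    rfl
  | peek k f q ih => exact ih _ _
  | pop k f q ih =>
    simp only [liftLeft, TM2.stepAux]
    rw [update_joinStk_left, ← ih]
    rfl
  | load f q ih => exact ih _ _
  | branch f p q ihp ihq =>
    simp only [liftLeft, TM2.stepAux]
    cases f v
    · exact ihq _ _
    · exact ihp _ _
  | goto f => rfl
  | halt => rfl

theorem stepAux_liftRight (q : TM2.Stmt M₂.Γ M₂.Λ M₂.σ) (v : M₂.σ) (S : ∀ k, List (M₂.Γ k))
    (v₁ : M₁.σ) (o : Option (M₂.Γ M₂.k₀)) (S₁ : ∀ k, List (M₁.Γ k)) (A : List (M₂.Γ M₂.k₀)) :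
    TM2.stepAux (liftRight M₁ M₂ q) (v₁, v, o) (joinStk S₁ A S) =
      embedRight M₁ M₂ v₁ o S₁ A (TM2.stepAux q v S) := by
  induction q generalizing v S with
  | push k f q ih =>
    simp only [liftRight, TM2.stepAux]
    rw [update_joinStk_right, ← ih]
    rfl
  | peek k f q ih => exact ih _ _
  | pop k f q ih =>
    simp only [liftRight, TM2.stepAux]
    rw [update_joinStk_right, ← ih]
    rfl
  | load f q ih => exact ih _ _
  | branch f p q ihp ihq =>
    simp only [liftRight, TM2.stepAux]
    cases f v
    · exact ihq _ _
    · exact ihp _ _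
  | goto f => rfl
  | halt => rfl

variable (e : M₁.Γ M₁.k₁ ≃ M₂.Γ M₂.k₀)

open Classical in
/-- Push the symbol held by the internal state on the input stack of the second machine. The case
distinction is needed since the alphabet might be empty. -/
noncomputable def pushInput (q : TM2.Stmt (Alph M₁ M₂) (Label M₁ M₂) (State M₁ M₂)) :
    TM2.Stmt (Alph M₁ M₂) (Label M₁ M₂) (State M₁ M₂) :=
  if h : Nonempty (M₂.Γ M₂.k₀) then
    .push (.inr (some M₂.k₀)) (fun v => v.2.2.getD h.some) q
  else q

open Classical in
/-- Push the symbol held by the internal state on the auxiliary stack. -/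
noncomputable def pushAux (q : TM2.Stmt (Alph M₁ M₂) (Label M₁ M₂) (State M₁ M₂)) :
    TM2.Stmt (Alph M₁ M₂) (Label M₁ M₂) (State M₁ M₂) :=
  if h : Nonempty (M₂.Γ M₂.k₀) then
    .push (.inr none) (fun v => v.2.2.getD h.some) q
  else q

/-- The program of the composed machine. -/
noncomputable def prog : Label M₁ M₂ → TM2.Stmt (Alph M₁ M₂) (Label M₁ M₂) (State M₁ M₂)
  | .inl l => liftLeft M₁ M₂ (M₁.m l)
  | .inr (.inl l) => liftRight M₁ M₂ (M₂.m l)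
  | .inr (.inr false) => .pop (.inl M₁.k₁) (fun v o => (v.1, v.2.1, o.map e))
      (.branch (fun v => v.2.2.isSome) (pushAux M₁ M₂ (.goto fun _ => .inr (.inr false)))
        (.goto fun _ => .inr (.inr true)))
  | .inr (.inr true) => .pop (.inr none) (fun v o => (v.1, v.2.1, o))
      (.branch (fun v => v.2.2.isSome) (pushInput M₁ M₂ (.goto fun _ => .inr (.inr true)))
        (.goto fun _ => .inr (.inl M₂.main)))

theorem stepsTo_left {n : ℕ} (v₂ : M₂.σ) (o : Option (M₂.Γ M₂.k₀)) (A : List (M₂.Γ M₂.k₀))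
    (S₂ : ∀ k, List (M₂.Γ k)) : ∀ {c c' : TM2.Cfg M₁.Γ M₁.Λ M₁.σ}, StepsTo M₁.m c n c' →
    StepsTo (prog M₁ M₂ e) (embedLeft M₁ M₂ v₂ o A S₂ c) n (embedLeft M₁ M₂ v₂ o A S₂ c') := by
  induction n with
  | zero =>
    intro c c' h
    obtain rfl : c = c' := Option.some.inj h
    exact .refl _
  | succ n ih =>
    rintro ⟨_ | l, v, S⟩ c' h
    · exact absurd h not_stepsTo_succ_of_halted
    · have h1 := ih (stepsTo_succ.1 h)
      refine stepsTo_succ.2 ?_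
      rw [← stepAux_liftLeft] at h1
      exact h1

theorem stepsTo_right {n : ℕ} (v₁ : M₁.σ) (o : Option (M₂.Γ M₂.k₀)) (S₁ : ∀ k, List (M₁.Γ k))
    (A : List (M₂.Γ M₂.k₀)) : ∀ {c c' : TM2.Cfg M₂.Γ M₂.Λ M₂.σ}, StepsTo M₂.m c n c' →
    StepsTo (prog M₁ M₂ e) (embedRight M₁ M₂ v₁ o S₁ A c) n
      (embedRight M₁ M₂ v₁ o S₁ A c') := by
  induction n with
  | zero =>
    intro c c' h
    obtain rfl : c = c' := Option.some.inj h
    exact .refl _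
  | succ n ih =>
    rintro ⟨_ | l, v, S⟩ c' h
    · exact absurd h not_stepsTo_succ_of_halted
    · have h1 := ih (stepsTo_succ.1 h)
      refine stepsTo_succ.2 ?_
      rw [← stepAux_liftRight] at h1
      exact h1

theorem stepsTo_collect (v₁ : M₁.σ) (v₂ : M₂.σ) (S₂ : ∀ k, List (M₂.Γ k))
    (l : List (M₁.Γ M₁.k₁)) : ∀ (o : Option (M₂.Γ M₂.k₀)) (A : List (M₂.Γ M₂.k₀)),
    StepsTo (prog M₁ M₂ e)
      ⟨some (.inr (.inr false)), (v₁, v₂, o), joinStk (Function.update (fun _ => []) M₁.k₁ l) A S₂⟩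
      (l.length + 1)
      ⟨some (.inr (.inr true)), (v₁, v₂, none),
        joinStk (fun _ => []) ((l.map e).reverse ++ A) S₂⟩ := by
  induction l with
  | nil =>
    intro o A
    refine stepsTo_succ.2 ?_
    simp only [prog, TM2.stepAux]
    rw [update_joinStk_left]
    simp [joinStk, StepsTo]
  | cons a l ih =>
    intro o A
    refine stepsTo_succ.2 ?_
    have hne : Nonempty (M₂.Γ M₂.k₀) := ⟨e a⟩
    have h1 := ih (some (e a)) (e a :: A)
    simp only [prog, TM2.stepAux]
    rw [update_joinStk_left]
    simp only [pushAux, dif_pos hne, joinStk, Function.update_self, List.head?_cons,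
      Option.map_some, Option.isSome_some, cond_true, TM2.stepAux, Option.getD_some, List.tail_cons]
    erw [update_joinStk_aux]
    simpa using h1

theorem stepsTo_deliver (v₁ : M₁.σ) (v₂ : M₂.σ) (S₁ : ∀ k, List (M₁.Γ k))
    (A : List (M₂.Γ M₂.k₀)) : ∀ (o : Option (M₂.Γ M₂.k₀)) (l : List (M₂.Γ M₂.k₀)),
    StepsTo (prog M₁ M₂ e)
      ⟨some (.inr (.inr true)), (v₁, v₂, o), joinStk S₁ A (Function.update (fun _ => []) M₂.k₀ l)⟩
      (A.length + 1)
      ⟨some (.inr (.inl M₂.main)), (v₁, v₂, none),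
        joinStk S₁ [] (Function.update (fun _ => []) M₂.k₀ (A.reverse ++ l))⟩ := by
  induction A with
  | nil =>
    intro o A
    refine stepsTo_succ.2 ?_
    simp only [prog, TM2.stepAux]
    rw [update_joinStk_aux]
    simp [joinStk, StepsTo]
  | cons a A ih =>
    intro o l
    refine stepsTo_succ.2 ?_
    have hne : Nonempty (M₂.Γ M₂.k₀) := ⟨a⟩
    have h1 := ih (some a) (a :: l)
    simp only [prog, TM2.stepAux]
    rw [update_joinStk_aux]
    simp only [pushInput, dif_pos hne, joinStk, Function.update_self, List.head?_cons,
      Option.isSome_some, cond_true, TM2.stepAux, Option.getD_some, List.tail_cons]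
    erw [update_joinStk_right]
    simpa using h1

variable [Fintype (M₂.Γ M₂.k₀)]

/-- The composition of two machines. -/
noncomputable def machine : FinTM2 :=
  letI := M₁.kDecidableEq
  letI := M₂.kDecidableEq
  letI := M₁.kFin
  letI := M₂.kFin
  letI := M₁.ΛFin
  letI := M₂.ΛFin
  letI := M₁.σFin
  letI := M₂.σFin
  letI : Fintype (Alph M₁ M₂ (.inl M₁.k₀)) := M₁.Γk₀Fin
  { K := M₁.K ⊕ Option M₂.K
    k₀ := .inl M₁.k₀
    k₁ := .inr (some M₂.k₁)
    Γ := Alph M₁ M₂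
    Λ := Label M₁ M₂
    main := .inl M₁.main
    σ := State M₁ M₂
    initialState := (M₁.initialState, M₂.initialState, none)
    m := prog M₁ M₂ e }

end

end CompMachine

namespace ParamComplexity
open TM2Run CompMachine

/-- Machines can be run one after the other; the additional time is linear in the length of the
intermediate result. -/
theorem ComputableInTime.comp {α β γ Γ Γ' Γ'' : Type} {ea : Encoding α Γ}
    {eb : Encoding β Γ'} {ec : Encoding γ Γ''} {r : α → β} {r' : β → γ} {T : α → ℕ} {T' : β → ℕ}
    (h : ComputableInTime ea eb r T) (h' : ComputableInTime eb ec r' T') :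
    ComputableInTime ea ec (fun a => r' (r a))
      (fun a => T a + 2 * ((eb.encode (r a)).length + 1) + T' (r a)) := by
  obtain ⟨⟨M₁, i₁, o₁⟩, h₁⟩ := h
  obtain ⟨⟨M₂, i₂, o₂⟩, h₂⟩ := h'
  have := M₂.Γk₀Fin
  refine ⟨⟨machine M₁ M₂ (o₁.trans i₂.symm), i₁, o₂⟩, fun a => ?_⟩
  obtain ⟨n₁, hn₁, s₁⟩ := (outputsInTime_iff _ _ _ _).1 (h₁ a)
  obtain ⟨n₂, hn₂, s₂⟩ := (outputsInTime_iff _ _ _ _).1 (h₂ (r a))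
  refine (outputsInTime_iff _ _ _ _).2 ?_
  have t₁ := stepsTo_left M₁ M₂ (o₁.trans i₂.symm) M₂.initialState none [] (fun _ => []) s₁
  have t₂ := stepsTo_right M₁ M₂ (o₁.trans i₂.symm) M₁.initialState none (fun _ => []) [] s₂
  have u₁ := stepsTo_collect M₁ M₂ (o₁.trans i₂.symm) M₁.initialState M₂.initialState
    (fun _ => []) ((eb.encode (r a)).map o₁.symm) none []
  have u₂ := stepsTo_deliver M₁ M₂ (o₁.trans i₂.symm) M₁.initialState M₂.initialState
    (fun _ => []) (((eb.encode (r a)).map i₂.symm).reverse) none []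
  have e₁ : ((eb.encode (r a)).map o₁.symm).map (o₁.trans i₂.symm) =
      (eb.encode (r a)).map i₂.symm := by
    simp [Function.comp_def]
  rw [e₁, List.append_nil] at u₁
  rw [List.reverse_reverse, List.append_nil] at u₂
  have e₂ : (Function.update (fun _ => []) M₂.k₀ [] : ∀ k, List (M₂.Γ k)) = fun _ => [] := by simp
  rw [e₂] at u₂
  have t := ((t₁.trans u₁).trans u₂).trans t₂
  have e₃ (l : List (M₁.Γ M₁.k₀)) : (Function.update (fun _ => []) (Sum.inl M₁.k₀) l :
      ∀ k, List (Alph M₁ M₂ k)) =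
        joinStk (Function.update (fun _ => []) M₁.k₀ l) [] (fun _ => []) := by
    rw [← update_joinStk_left]
    congr 1
    funext k
    rcases k with k | _ | k <;> rfl
  have e₄ (l : List (M₂.Γ M₂.k₁)) : (Function.update (fun _ => []) (Sum.inr (some M₂.k₁)) l :
      ∀ k, List (Alph M₁ M₂ k)) =
        joinStk (fun _ => []) [] (Function.update (fun _ => []) M₂.k₁ l) := by
    rw [← update_joinStk_right]
    congr 1
    funext k
    rcases k with k | _ | k <;> rfl
  simp only [List.length_map, List.length_reverse] at t
  refine ⟨n₁ + ((eb.encode (r a)).length + 1) + ((eb.encode (r a)).length + 1) + n₂, ?_, ?_⟩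
  · dsimp only
    omega
  · have e₅ := e₃ ((ea.encode a).map i₁.symm)
    have e₆ := e₄ ((ec.encode (r' (r a))).map o₂.symm)
    unfold machine
    dsimp only
    erw [e₅, e₆]
    exact t

/-- The stack alphabets of a machine that reads a truth value and writes a string over `Γ`. -/
abbrev BoolIO (Γ : Type) : Bool → Type
  | false => Bool
  | true => Γ

/-- Write a string on the output stack and halt. -/
def pushAll {Γ : Type} : List Γ → TM2.Stmt (BoolIO Γ) Unit (Option Bool)
  | [] => .load (fun _ => none) .halt
  | a :: L => .push true (fun _ => a) (pushAll L)

theorem stepAux_pushAll {Γ : Type} (L : List Γ) (v : Option Bool) (S : ∀ k, List (BoolIO Γ k)) :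
    TM2.stepAux (pushAll L) v S =
      ⟨none, none, Function.update S true (L.reverse ++ S true)⟩ := by
  induction L generalizing S with
  | nil => simp [pushAll]
  | cons a L ih =>
    simp only [pushAll, TM2.stepAux]
    rw [ih]
    simp

/-- The machine that reads a truth value `b` and writes the string `w b`. -/
def boolMachine {Γ : Type} (w : Bool → List Γ) : FinTM2 where
  K := Bool
  k₀ := false
  k₁ := true
  Γ := BoolIO Γ
  Λ := Unit
  main := ()
  σ := Option Bool
  initialState := none
  Γk₀Fin := inferInstanceAs (Fintype Bool)
  m _ := .pop false (fun _ o => o) (.branch (fun v => v == some true)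
    (pushAll (w true).reverse) (pushAll (w false).reverse))

/-- A function on truth values can be computed in a single step. -/
theorem computableInTime_bool {β Γ : Type} (eb : Encoding β Γ) (g : Bool → β) :
    ComputableInTime encodingBoolBool eb g fun _ => 1 := by
  refine ⟨⟨boolMachine fun b => eb.encode (g b), Equiv.refl _, Equiv.refl _⟩, fun b => ?_⟩
  refine (outputsInTime_iff _ _ _ _).2 ⟨1, le_rfl, ?_⟩
  refine stepsTo_succ.2 ?_
  unfold boolMachine
  cases b <;>
  · simp only [TM2.stepAux, stepAux_pushAll, encodingBoolBool, encodeBool]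
    simp [StepsTo]

end ParamComplexity

/-! ### Fixed-parameter tractable computations -/

namespace ParamComplexity

section
variable {𝓕 : Set (ℕ → ℕ)}

theorem mem_of_computable (h𝓕 : 𝓕 = Set.univ ∨ 𝓕 = {f | Computable f}) {f : ℕ → ℕ}
    (hf : Computable f) : f ∈ 𝓕 := by
  rcases h𝓕 with rfl | rfl
  · trivial
  · exact hf

theorem mem_comp (h𝓕 : 𝓕 = Set.univ ∨ 𝓕 = {f | Computable f}) {f h : ℕ → ℕ}
    (hf : f ∈ 𝓕) (hh : Computable h) : (fun k => f (h k)) ∈ 𝓕 := by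
  rcases h𝓕 with rfl | rfl
  · trivial
  · exact Computable.comp hf hh

theorem mem_comp₂ (h𝓕 : 𝓕 = Set.univ ∨ 𝓕 = {f | Computable f}) {f f' : ℕ → ℕ} {g : ℕ → ℕ → ℕ}
    (hg : Computable₂ g) (hf : f ∈ 𝓕) (hf' : f' ∈ 𝓕) : (fun k => g (f k) (f' k)) ∈ 𝓕 := by
  rcases h𝓕 with rfl | rfl
  · trivial
  · exact Computable₂.comp hg hf hf'

theorem computable₂_pow : Computable₂ fun a c : ℕ => a ^ c := by
  have h : Primrec₂ fun a c : ℕ => Nat.rec (motive := fun _ => ℕ) 1 (fun _ y => y * a) c := by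
    refine Primrec.nat_rec (f := fun _ : ℕ => 1) (g := fun (a : ℕ) (p : ℕ × ℕ) => p.2 * a)
      (Primrec.const 1) ?_
    exact Primrec.nat_mul.comp₂ (Primrec.snd.comp₂ Primrec₂.right) Primrec₂.left
  refine (h.of_eq fun a c => ?_).to_comp
  induction c with
  | zero => rfl
  | succ c ih => simp only [pow_succ, ← ih]

/-- The map `r` can be computed in time `f(p x) · (|x| + 1) ^ c` for some `f ∈ 𝓕` and some `c`. -/
def FPTComputable (𝓕 : Set (ℕ → ℕ)) {α β Γ Γ' : Type} (ea : Encoding α Γ) (eb : Encoding β Γ')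
    (p : α → ℕ) (r : α → β) : Prop :=
  ∃ f ∈ 𝓕, ∃ c : ℕ, ComputableInTime ea eb r fun x => f (p x) * ((ea.encode x).length + 1) ^ c

theorem ComputableInTime.mono {α β Γ Γ' : Type} {ea : Encoding α Γ} {eb : Encoding β Γ'}
    {r : α → β} {T T' : α → ℕ} (h : ComputableInTime ea eb r T) (hT : ∀ a, T a ≤ T' a) :
    ComputableInTime ea eb r T' := by
  obtain ⟨M, hM⟩ := h
  refine ⟨M, fun a => ?_⟩
  obtain ⟨h⟩ := hM a
  exact ⟨⟨h.toEvalsTo, h.steps_le_m.trans (hT a)⟩⟩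

/-- Computations in time `f(k) · n ^ O(1)` can be composed if the parameter of the intermediate
result is a computable function of the parameter of the input. -/
theorem FPTComputable.comp (h𝓕 : 𝓕 = Set.univ ∨ 𝓕 = {f | Computable f}) {α β γ Γ Γ' Γ'' : Type}
    {ea : Encoding α Γ} {eb : Encoding β Γ'} {ec : Encoding γ Γ''} {r : α → β} {r' : β → γ}
    {p : α → ℕ} {q : β → ℕ} {h : ℕ → ℕ} (hh : Computable h) (hq : ∀ x, q (r x) = h (p x))
    (hr : FPTComputable 𝓕 ea eb p r) (hr' : FPTComputable 𝓕 eb ec q r') :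
    FPTComputable 𝓕 ea ec p fun x => r' (r x) := by
  obtain ⟨f, hf, c, h1⟩ := hr
  obtain ⟨f', hf', c', h2⟩ := hr'
  obtain ⟨C, hC⟩ := h1.exists_length_le
  have hadd : Computable₂ fun a b : ℕ => a + b := Primrec.nat_add.to_comp
  have hmul : Computable₂ fun a b : ℕ => a * b := Primrec.nat_mul.to_comp
  have hconst (m : ℕ) : (fun _ => m) ∈ 𝓕 := mem_of_computable h𝓕 (Computable.const m)
  -- the factor by which the size of the intermediate result may exceed a power of the input size
  have hB : (fun k => 1 + C * f k) ∈ 𝓕 :=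
    mem_comp₂ h𝓕 hadd (hconst 1) (mem_comp₂ h𝓕 hmul (hconst C) hf)
  have hF : (fun k => f k + 2 * (1 + C * f k) + f' (h k) * (1 + C * f k) ^ c') ∈ 𝓕 :=
    mem_comp₂ h𝓕 hadd (mem_comp₂ h𝓕 hadd hf (mem_comp₂ h𝓕 hmul (hconst 2) hB))
      (mem_comp₂ h𝓕 hmul (mem_comp h𝓕 hf' hh) (mem_comp₂ h𝓕 computable₂_pow hB (hconst c')))
  refine ⟨_, hF, (c + 1) * c' + (c + 1), (h1.comp h2).mono fun a => ?_⟩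
  have hlen := hC a
  rw [hq]
  set s := (ea.encode a).length + 1 with hs
  set m := (eb.encode (r a)).length with hm
  set A := f (p a) with hA
  have hs1 : 1 ≤ s := by omega
  have hmid : m + 1 ≤ (1 + C * A) * s ^ (c + 1) := by
    have e1 : s ≤ s ^ (c + 1) := Nat.le_self_pow (by omega) s
    have e2 : A * s ^ c ≤ A * s ^ (c + 1) :=
      Nat.mul_le_mul_left _ (Nat.pow_le_pow_right hs1 (by omega))
    have e3 := Nat.mul_le_mul_left C e2
    calc m + 1 ≤ s + C * (A * s ^ c) := by omega
      _ ≤ s ^ (c + 1) + C * (A * s ^ (c + 1)) := by omega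
      _ = _ := by ring
  have hpow {i j : ℕ} (hij : i ≤ j) : s ^ i ≤ s ^ j := Nat.pow_le_pow_right hs1 hij
  have g1 : A * s ^ c ≤ A * s ^ ((c + 1) * c' + (c + 1)) :=
    Nat.mul_le_mul_left _ (hpow (by omega))
  have g2 : m + 1 ≤ (1 + C * A) * s ^ ((c + 1) * c' + (c + 1)) :=
    hmid.trans (Nat.mul_le_mul_left _ (hpow (by omega)))
  have g3 : f' (h (p a)) * (m + 1) ^ c' ≤
      f' (h (p a)) * ((1 + C * A) ^ c' * s ^ ((c + 1) * c' + (c + 1))) := by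
    refine Nat.mul_le_mul_left _ ((Nat.pow_le_pow_left hmid c').trans ?_)
    rw [mul_pow, ← pow_mul]
    exact Nat.mul_le_mul_left _ (hpow (by omega))
  calc A * s ^ c + 2 * (m + 1) + f' (h (p a)) * (m + 1) ^ c'
      ≤ A * s ^ ((c + 1) * c' + (c + 1)) + 2 * ((1 + C * A) * s ^ ((c + 1) * c' + (c + 1))) +
        f' (h (p a)) * ((1 + C * A) ^ c' * s ^ ((c + 1) * c' + (c + 1))) := by omega
    _ = _ := by ring

theorem FPTReducible.trans (h𝓕 : 𝓕 = Set.univ ∨ 𝓕 = {f | Computable f}) {P Q R : ParamProblem}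
    (h₁ : FPTReducible 𝓕 P Q) (h₂ : FPTReducible 𝓕 Q R) : FPTReducible 𝓕 P R := by
  obtain ⟨r₁, ⟨k₁, hk₁, e₁⟩, y₁, t₁⟩ := h₁
  obtain ⟨r₂, ⟨k₂, hk₂, e₂⟩, y₂, t₂⟩ := h₂
  refine ⟨fun x => r₂ (r₁ x), ⟨fun k => k₂ (k₁ k), hk₂.comp hk₁, fun x => by rw [e₂, e₁]⟩,
    fun x => (y₁ x).trans (y₂ _), ?_⟩
  exact FPTComputable.comp h𝓕 hk₁ e₁ t₁ t₂

theorem FPTReducible.mem_fpt (h𝓕 : 𝓕 = Set.univ ∨ 𝓕 = {f | Computable f}) {P Q : ParamProblem}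
    (h₁ : FPTReducible 𝓕 P Q) (h₂ : Q ∈ FPT 𝓕) : P ∈ FPT 𝓕 := by
  classical
  obtain ⟨r₁, ⟨k₁, hk₁, e₁⟩, y₁, t₁⟩ := h₁
  have e : (fun x => decide (r₁ x ∈ Q.yes)) = fun x => decide (x ∈ P.yes) := by
    funext x
    simp only [y₁]
  have h : FPTComputable 𝓕 P.encoding encodingBoolBool P.param
      fun x => decide (r₁ x ∈ Q.yes) := FPTComputable.comp h𝓕 hk₁ e₁ t₁ h₂
  rw [e] at h
  exact h

/-- A problem in FPT can be reduced to Independent Set, with two fixed instances as targets. -/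
theorem fpt_subset_w1 (h𝓕 : 𝓕 = Set.univ ∨ 𝓕 = {f | Computable f}) : FPT 𝓕 ⊆ W1 𝓕 := by
  classical
  rintro P hP
  -- the edgeless graph with one vertex or no vertex, and `k = 1`
  let g : Bool → ISInstance := fun b => ⟨cond b 1 0, ⊥, 1⟩
  refine ⟨fun x => g (decide (x ∈ P.yes)), ⟨fun _ => 1, Computable.const 1, fun x => rfl⟩,
    fun x => ?_, ?_⟩
  · by_cases hx : x ∈ P.yes
    · simp only [hx, decide_true, true_iff]
      exact ⟨{(0 : Fin 1)}, rfl, by simp [g, SimpleGraph.isIndepSet_iff]⟩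
    · simp only [hx, decide_false, false_iff]
      rintro ⟨S, hS, -⟩
      have := S.card_le_univ
      rw [hS] at this
      simp [g] at this
  · refine FPTComputable.comp h𝓕 (q := fun _ => 0) (Computable.const 0) (fun _ => rfl) hP
      ⟨fun _ => 1, mem_of_computable h𝓕 (Computable.const 1), 0, ?_⟩
    exact (computableInTime_bool _ g).mono fun a => by simp

/-- If Independent Set can be reduced to a problem in FPT, then FPT and W[1] coincide. -/
theorem fpt_eq_w1 (h𝓕 : 𝓕 = Set.univ ∨ 𝓕 = {f | Computable f}) {Q : ParamProblem}
    (h : FPTReducible 𝓕 independentSet Q) (hQ : Q ∈ FPT 𝓕) : FPT 𝓕 = W1 𝓕 :=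
  (fpt_subset_w1 h𝓕).antisymm fun _ hP => FPTReducible.mem_fpt h𝓕 (hP.trans h𝓕 h) hQ

end

end ParamComplexity

/-! ### Structured stack programs -/

namespace StackProg

/-- The stack alphabet of all programs. -/
abbrev Sym := Option Bool

/-- The contents of the stacks. Programs address stacks by natural numbers; every program uses
only finitely many of them. -/
abbrev Stk := ℕ → List Sym

/-- An instruction acts on the stack `reg`: it pushes a fixed symbol and moves on to a fixed label,
or pops a symbol (if there is one) and chooses the next label accordingly. -/
structure Instr (L : Type) where
  /-- the stack on which the instruction acts -/
  reg : ℕ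
  /-- push a symbol and move to a label, or pop and branch -/
  op : (Sym × L) ⊕ (Option Sym → L)

/-- Relabelling. -/
def Instr.map {L L' : Type} (f : L → L') (i : Instr L) : Instr L' :=
  ⟨i.reg, i.op.map (Prod.map id f) fun g o => f (g o)⟩

/-- The next label and the new stacks. -/
def Instr.exec {L : Type} (i : Instr L) (s : Stk) : L × Stk :=
  match i.op with
  | .inl (a, l) => (l, Function.update s i.reg (a :: s i.reg))
  | .inr g => (g (s i.reg).head?, Function.update s i.reg (s i.reg).tail)

theorem Instr.exec_map {L L' : Type} (f : L → L') (i : Instr L) (s : Stk) :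
    (i.map f).exec s = (f (i.exec s).1, (i.exec s).2) := by
  rcases i with ⟨k, ⟨a, l⟩ | g⟩ <;> rfl

/-- A program; the label `none` is its exit. -/
structure Program where
  /-- the labels -/
  Label : Type
  [labelFintype : Fintype Label]
  /-- where to begin -/
  start : Option Label
  /-- the instruction at each label -/
  code : Label → Instr (Option Label)

attribute [instance] Program.labelFintype

/-- `Run code l s t s'`: from label `l` with stacks `s`, the exit is reached within `t` steps, with
stacks `s'`. -/
inductive Run {L : Type} (code : L → Instr (Option L)) : Option L → Stk → ℕ → Stk → Prop
  | exit (s : Stk) (t : ℕ) : Run code none s t s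
  | step {l : L} {s : Stk} {t : ℕ} {s' : Stk}
    (h : Run code ((code l).exec s).1 ((code l).exec s).2 t s') : Run code (some l) s (t + 1) s'

theorem Run.mono {L : Type} {code : L → Instr (Option L)} {l : Option L} {s s' : Stk} {t t' : ℕ}
    (h : Run code l s t s') (ht : t ≤ t') : Run code l s t' s' := by
  induction h generalizing t' with
  | exit s t => exact .exit s t'
  | step h ih =>
    obtain ⟨t', rfl⟩ := Nat.exists_eq_add_of_le' (Nat.one_le_of_lt ht)
    exact .step (ih (by omega))

/-- If a program is part of a larger program in which its exit is the label `e`, then runs can be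
continued from there. -/
theorem Run.embed {L L' : Type} {code : L → Instr (Option L)} {code' : L' → Instr (Option L')}
    (f : L → L') (e : Option L')
    (hf : ∀ l, code' (f l) = (code l).map fun o => o.elim e fun l => some (f l))
    {l : Option L} {s s₁ s₂ : Stk} {t t' : ℕ} (h : Run code l s t s₁) (h' : Run code' e s₁ t' s₂) :
    Run code' (l.elim e fun l => some (f l)) s (t + t') s₂ := by
  induction h with
  | exit s t => exact h'.mono (by omega)
  | step h ih =>
    have := ih h'
    rw [Option.elim_some, show ∀ a b : ℕ, a + 1 + b = a + b + 1 by omega]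
    refine .step ?_
    rw [hf, Instr.exec_map]
    exact this

namespace Program

/-- `P.Runs s t s'`: started with stacks `s`, the program ends within `t` steps, with
stacks `s'`. -/
def Runs (P : Program) (s : Stk) (t : ℕ) (s' : Stk) : Prop := Run P.code P.start s t s'

theorem Runs.mono {P : Program} {s s' : Stk} {t t' : ℕ} (h : P.Runs s t s') (ht : t ≤ t') :
    P.Runs s t' s' :=
  Run.mono h ht

/-- The empty program. -/
def skip : Program where
  Label := Empty
  start := none
  code := Empty.elim

theorem skip_runs (s : Stk) (t : ℕ) : skip.Runs s t s := .exit s t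

/-- Push the symbol `a` on stack `k`. -/
def push (k : ℕ) (a : Sym) : Program where
  Label := Unit
  start := some ()
  code _ := ⟨k, .inl (a, none)⟩

theorem push_runs (k : ℕ) (a : Sym) (s : Stk) :
    (push k a).Runs s 1 (Function.update s k (a :: s k)) :=
  .step (.exit _ _)

/-- One program after the other. -/
def seq (P Q : Program) : Program where
  Label := P.Label ⊕ Q.Label
  start := P.start.elim (Q.start.elim none fun l => some (.inr l)) fun l => some (.inl l)
  code
    | .inl l => (P.code l).map fun o =>
        o.elim (Q.start.elim none fun l => some (.inr l)) fun l => some (.inl l)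
    | .inr l => (Q.code l).map fun o => o.elim none fun l => some (.inr l)

theorem seq_runs {P Q : Program} {s s₁ s₂ : Stk} {t t' : ℕ} (h : P.Runs s t s₁)
    (h' : Q.Runs s₁ t' s₂) : (P.seq Q).Runs s (t + t') s₂ :=
  Run.embed (code' := (P.seq Q).code) Sum.inl _ (fun _ => rfl) h
    (Run.embed (code' := (P.seq Q).code) (t' := 0) Sum.inr none (fun _ => rfl) h' (.exit _ _))

/-- Pop a symbol from stack `k` and continue according to the result. -/
def case (k : ℕ) (p : Option Sym → Program) : Program where
  Label := Unit ⊕ Σ o, (p o).Label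
  start := some (.inl ())
  code
    | .inl _ => ⟨k, .inr fun o => (p o).start.elim none fun l => some (.inr ⟨o, l⟩)⟩
    | .inr ⟨o, l⟩ => ((p o).code l).map fun o' => o'.elim none fun l => some (.inr ⟨o, l⟩)

theorem case_runs {k : ℕ} {p : Option Sym → Program} {s s' : Stk} {t : ℕ}
    (h : (p (s k).head?).Runs (Function.update s k (s k).tail) t s') :
    (case k p).Runs s (t + 1) s' :=
  .step (Run.embed (code' := (case k p).code) (t' := 0) (fun l => .inr ⟨_, l⟩) none
    (fun _ => rfl) h (.exit _ _))

/-- Repeatedly pop a symbol from stack `k`; end if `quit` holds for the result, and run the program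
`p` for this result otherwise. -/
def loop (k : ℕ) (quit : Option Sym → Bool) (p : Option Sym → Program) : Program where
  Label := Unit ⊕ Σ o, (p o).Label
  start := some (.inl ())
  code
    | .inl _ => ⟨k, .inr fun o => bif quit o then none else
        (p o).start.elim (some (.inl ())) fun l => some (.inr ⟨o, l⟩)⟩
    | .inr ⟨o, l⟩ => ((p o).code l).map fun o' =>
        o'.elim (some (.inl ())) fun l => some (.inr ⟨o, l⟩)

theorem loop_runs_quit {k : ℕ} {quit : Option Sym → Bool} {p : Option Sym → Program} {s : Stk}
    (h : quit (s k).head? = true) :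
    (loop k quit p).Runs s 1 (Function.update s k (s k).tail) := by
  refine .step ?_
  have : ((loop k quit p).code (.inl ())).exec s =
    (none, Function.update s k (s k).tail) := by simp [loop, Instr.exec, h]
  rw [this]
  exact .exit _ _

theorem loop_runs_next {k : ℕ} {quit : Option Sym → Bool} {p : Option Sym → Program}
    {s s₁ s₂ : Stk} {t t' : ℕ} (h : quit (s k).head? = false)
    (h₁ : (p (s k).head?).Runs (Function.update s k (s k).tail) t s₁)
    (h₂ : (loop k quit p).Runs s₁ t' s₂) :
    (loop k quit p).Runs s (t + t' + 1) s₂ := by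
  refine .step ?_
  have : ((loop k quit p).code (.inl ())).exec s =
    ((p (s k).head?).start.elim (some (.inl ())) fun l => some (.inr ⟨_, l⟩),
      Function.update s k (s k).tail) := by simp [loop, Instr.exec, h]
  rw [this]
  exact Run.embed (code' := (loop k quit p).code) (fun l => .inr ⟨_, l⟩) (some (.inl ()))
    (fun _ => rfl) h₁ h₂

/-- Run the program `p a` for every symbol `a` on stack `k`, from the top to the bottom. -/
def each (k : ℕ) (p : Sym → Program) : Program :=
  loop k Option.isNone fun o => o.elim skip p

theorem each_runs_nil {k : ℕ} {p : Sym → Program} {s : Stk} (h : s k = []) :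
    (each k p).Runs s 1 s := by
  have := loop_runs_quit (k := k) (quit := Option.isNone) (p := fun o => o.elim skip p) (s := s)
    (by simp [h])
  rwa [h, List.tail_nil, ← h, Function.update_eq_self] at this

theorem each_runs_cons {k : ℕ} {p : Sym → Program} {s s₁ s₂ : Stk} {t t' : ℕ} {a : Sym}
    {l : List Sym} (h : s k = a :: l) (h₁ : (p a).Runs (Function.update s k l) t s₁)
    (h₂ : (each k p).Runs s₁ t' s₂) : (each k p).Runs s (t + t' + 1) s₂ := by
  refine loop_runs_next (by simp [h]) ?_ h₂
  rw [h]
  exact h₁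

/-! ### Stack programs as machines -/

open Classical in
/-- The stacks used by a program, together with the input stack `0` and the output stack `1`. -/
noncomputable def regs (P : Program) : Finset ℕ :=
  insert 0 (insert 1 (Finset.univ.image fun l => (P.code l).reg))

theorem reg_mem_regs (P : Program) (l : P.Label) : (P.code l).reg ∈ P.regs := by
  simp [regs]

/-- The statement at a label; at the exit, the internal state is reset. -/
noncomputable def stmt (P : Program) :
    Option P.Label → TM2.Stmt (fun _ : P.regs => Sym) (Option P.Label) (Option Sym)
  | none => .load (fun _ => none) .halt
  | some l =>
    match (P.code l).op with
    | .inl (a, l') => .push ⟨(P.code l).reg, P.reg_mem_regs l⟩ (fun _ => a) (.goto fun _ => l')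
    | .inr g => .pop ⟨(P.code l).reg, P.reg_mem_regs l⟩ (fun _ o => o) (.goto fun o => g o)

/-- A program as a Turing machine. -/
noncomputable def toMachine (P : Program) : FinTM2 where
  K := P.regs
  k₀ := ⟨0, by simp [regs]⟩
  k₁ := ⟨1, by simp [regs]⟩
  Γ _ := Sym
  Λ := Option P.Label
  main := P.start
  σ := Option Sym
  initialState := none
  m := P.stmt

open TM2Run

theorem stepsTo_of_run {P : Program} {l : Option P.Label} {s s' : Stk} {t : ℕ}
    (h : Run P.code l s t s') (v : Option Sym) : ∃ n ≤ t + 1,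
      StepsTo P.stmt ⟨some l, v, fun k => s k⟩ n ⟨none, none, fun k => s' k⟩ := by
  induction h generalizing v with
  | exit s t => exact ⟨1, by omega, stepsTo_succ.2 rfl⟩
  | @step l s t s' h ih =>
    have hupd (x : List Sym) : (Function.update (fun k : P.regs => s k)
        ⟨(P.code l).reg, P.reg_mem_regs l⟩ x) =
          fun k : P.regs => Function.update s (P.code l).reg x k := by
      funext k
      simp [Function.update_apply, Subtype.ext_iff]
    simp only [Instr.exec] at ih
    rcases hop : (P.code l).op with ⟨a, l'⟩ | g
    · rw [hop] at ih
      obtain ⟨n, hn, hs⟩ := ih v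
      refine ⟨n + 1, by omega, stepsTo_succ.2 ?_⟩
      simp only [stmt, hop, TM2.stepAux, hupd]
      exact hs
    · rw [hop] at ih
      obtain ⟨n, hn, hs⟩ := ih (s (P.code l).reg).head?
      refine ⟨n + 1, by omega, stepsTo_succ.2 ?_⟩
      simp only [stmt, hop, TM2.stepAux, hupd]
      exact hs

end Program

/-- Functions computed by stack programs are computed by Turing machines. -/
theorem computableInTime_of_runs {α β : Type} {ea : Encoding α Sym} {eb : Encoding β Sym}
    {r : α → β} {T : α → ℕ} (P : Program)
    (h : ∀ a, P.Runs (Function.update (fun _ => []) 0 (ea.encode a)) (T a)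
      (Function.update (fun _ => []) 1 (eb.encode (r a)))) :
    ParamComplexity.ComputableInTime ea eb r fun a => T a + 1 := by
  refine ⟨⟨P.toMachine, Equiv.refl _, Equiv.refl _⟩, fun a => ?_⟩
  obtain ⟨n, hn, hs⟩ := Program.stepsTo_of_run (h a) none
  refine (TM2Run.outputsInTime_iff _ _ _ _).2 ⟨n, hn, ?_⟩
  have hupd (j : P.regs) (x : List Sym) :
      (fun k : P.regs => Function.update (fun _ => []) (j : ℕ) x (k : ℕ)) =
        Function.update (fun _ => []) j x := by
    funext k
    by_cases hk : k = j
    · rw [hk, Function.update_self, Function.update_self]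
    · rw [Function.update_of_ne hk, Function.update_of_ne fun h => hk (Subtype.ext h)]
  have e₀ := hupd ⟨0, by simp [Program.regs]⟩ (ea.encode a)
  have e₁ := hupd ⟨1, by simp [Program.regs]⟩ (eb.encode (r a))
  dsimp only at e₀ e₁
  rw [e₀, e₁] at hs
  unfold Program.toMachine
  simp only [Equiv.refl_symm, Equiv.coe_refl, List.map_id]
  exact hs

end StackProg

/-! ### Polynomially bounded functions -/

namespace StackProg

/-- `t` is bounded by a polynomial. -/
def PolyBdd (t : ℕ → ℕ) : Prop := ∃ c, ∀ M, t M ≤ (M + 2) ^ c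

namespace PolyBdd
variable {t u : ℕ → ℕ}

theorem const (n : ℕ) : PolyBdd fun _ => n :=
  ⟨n, fun M => Nat.lt_two_pow_self.le.trans (Nat.pow_le_pow_left (by omega) n)⟩

theorem id : PolyBdd fun M => M := ⟨1, fun M => by simp⟩

theorem add (ht : PolyBdd t) (hu : PolyBdd u) : PolyBdd fun M => t M + u M := by
  obtain ⟨a, ha⟩ := ht
  obtain ⟨b, hb⟩ := hu
  refine ⟨max a b + 1, fun M => ?_⟩
  have h1 := (ha M).trans (Nat.pow_le_pow_right (by omega) (le_max_left a b))
  have h2 := (hb M).trans (Nat.pow_le_pow_right (by omega) (le_max_right a b))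
  calc t M + u M ≤ (M + 2) ^ max a b * 2 := by omega
    _ ≤ (M + 2) ^ max a b * (M + 2) := Nat.mul_le_mul_left _ (by omega)
    _ = _ := (pow_succ _ _).symm

theorem mul (ht : PolyBdd t) (hu : PolyBdd u) : PolyBdd fun M => t M * u M := by
  obtain ⟨a, ha⟩ := ht
  obtain ⟨b, hb⟩ := hu
  exact ⟨a + b, fun M => (Nat.mul_le_mul (ha M) (hb M)).trans_eq (pow_add _ _ _).symm⟩

theorem comp (ht : PolyBdd t) (hu : PolyBdd u) : PolyBdd fun M => t (u M) := by
  obtain ⟨a, ha⟩ := ht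
  obtain ⟨b, hb⟩ := hu
  refine ⟨(b + 2) * a, fun M => (ha _).trans ?_⟩
  rw [pow_mul]
  refine Nat.pow_le_pow_left ?_ a
  have h1 : 1 ≤ (M + 2) ^ b := Nat.one_le_pow _ _ (by omega)
  have h2 : (M + 2) ^ b * (2 * 2) ≤ (M + 2) ^ b * ((M + 2) * (M + 2)) :=
    Nat.mul_le_mul_left _ (Nat.mul_le_mul (by omega) (by omega))
  have h3 := hb M
  calc u M + 2 ≤ (M + 2) ^ b * (2 * 2) := by omega
    _ ≤ (M + 2) ^ b * ((M + 2) * (M + 2)) := h2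
    _ = _ := by ring

end PolyBdd

/-! ### Arithmetic in unary notation -/

/-- A number in unary notation. -/
def tally (n : ℕ) : List Sym := List.replicate n none

@[simp] theorem tally_zero : tally 0 = [] := rfl

theorem tally_succ (n : ℕ) : tally (n + 1) = none :: tally n := rfl

@[simp] theorem tally_length (n : ℕ) : (tally n).length = n := by simp [tally]

@[simp] theorem tally_reverse (n : ℕ) : (tally n).reverse = tally n := by simp [tally]

theorem tally_append (m n : ℕ) : tally m ++ tally n = tally (m + n) := by
  simp [tally, List.replicate_append_replicate]

theorem tally_append' (m n : ℕ) (l : List Sym) :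
    tally m ++ (tally n ++ l) = tally (m + n) ++ l := by
  rw [← List.append_assoc, tally_append]

namespace Program

/-- A loop over a stack that holds a number `n`. The states `S 0, …, S n` describe the stacks after
each iteration. -/
theorem each_runs_tally {k : ℕ} {p : Sym → Program} (S : ℕ → Stk) {t : ℕ} (n : ℕ)
    (hk : ∀ i ≤ n, S i k = tally (n - i))
    (h : ∀ i < n, (p none).Runs (Function.update (S i) k (tally (n - (i + 1)))) t (S (i + 1))) :
    (each k p).Runs (S 0) (n * (t + 1) + 1) (S n) := by
  induction n generalizing S with
  | zero => exact (each_runs_nil (by simpa using hk 0 le_rfl)).mono (by omega)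
  | succ n ih =>
    have h1 := ih (fun i => S (i + 1))
      (fun i hi => by rw [hk (i + 1) (by omega)]; congr 1; omega)
      (fun i hi => by
        have := h (i + 1) (by omega)
        rwa [show n + 1 - (i + 1 + 1) = n - (i + 1) by omega] at this)
    refine (each_runs_cons (l := tally n) (hk 0 (by omega)) ?_ h1).mono
      (t := t + (n * (t + 1) + 1) + 1) ?_
    · have := h 0 (by omega)
      rwa [show n + 1 - (0 + 1) = n by omega] at this
    · rw [Nat.succ_mul]
      omega

/-- Move the contents of stack `k` to stack `d`, reversing the order. -/
def move (k d : ℕ) : Program := each k (push d)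

theorem move_runs {k d : ℕ} (hkd : k ≠ d) {s : Stk} {l : List Sym} (h : s k = l) :
    (move k d).Runs s (2 * l.length + 1)
      (Function.update (Function.update s k []) d (l.reverse ++ s d)) := by
  induction l generalizing s with
  | nil =>
    have e : Function.update (Function.update s k []) d ([].reverse ++ s d) = s := by
      funext j
      by_cases hj : j = d
      · subst hj; simp
      · by_cases hj' : j = k
        · subst hj'; simp [hj, h]
        · simp [hj, hj']
    rw [e]
    exact (each_runs_nil h).mono (by omega)
  | cons a l ih =>
    have h1 := ih (s := Function.update (Function.update s k l) d (a :: s d))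
      (by rw [Function.update_of_ne hkd, Function.update_self])
    have h2 := push_runs d a (Function.update s k l)
    rw [Function.update_of_ne hkd.symm] at h2
    have h3 := (each_runs_cons h h2 h1).mono (t' := 2 * (a :: l).length + 1)
      (by simp only [List.length_cons]; omega)
    have e : Function.update (Function.update (Function.update (Function.update s k l) d (a :: s d))
        k []) d (l.reverse ++ Function.update (Function.update s k l) d (a :: s d) d) =
        Function.update (Function.update s k []) d ((a :: l).reverse ++ s d) := by
      funext j
      by_cases hj : j = d
      · subst hj; simp
      · by_cases hj' : j = k
        · subst hj'; simp [hj]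
        · simp [hj, hj']
    rwa [e] at h3

/-- Empty stack `k`. -/
def clear (k : ℕ) : Program := each k fun _ => skip

theorem clear_runs {k : ℕ} {s : Stk} {l : List Sym} (h : s k = l) :
    (clear k).Runs s (l.length + 1) (Function.update s k []) := by
  induction l generalizing s with
  | nil =>
    have e : Function.update s k [] = s := by rw [← h]; simp
    rw [e]
    exact (each_runs_nil h).mono (by omega)
  | cons a l ih =>
    have h1 := ih (s := Function.update s k l) (by simp)
    rw [Function.update_idem] at h1
    exact (each_runs_cons h (skip_runs _ 0) h1).mono (by simp only [List.length_cons]; omega)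

end Program

open Program

/-- The stacks `s` are ready for the evaluation of an expression: stack `2` holds the list `B`, the
value of each variable `x` is on stack `R x` in unary, and the stacks from `fr` on are empty. -/
structure Ready (R : ℕ → ℕ) (fr : ℕ) (B : List Bool) (ρ : ℕ → ℕ) (s : Stk) : Prop where
  bits : s 2 = B.map some
  vars : ∀ x, s (R x) = tally (ρ x)
  clean : ∀ j, fr ≤ j → s j = []

/-- An admissible assignment of stacks: the variables are on stacks `R x`, and the result is to be
added to the stack `dst`, which is none of them. -/
structure Admissible (R : ℕ → ℕ) (fr dst : ℕ) : Prop where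
  two_lt : 2 < fr
  vars_lt : ∀ x, R x < fr
  dst_lt : dst < fr
  dst_ne_two : dst ≠ 2
  vars_ne : ∀ x, R x ≠ dst

/-- The program `P` adds the value of `f` to the stack `dst` and changes nothing else, within time
`T M` if all variables and the length of the bit list are at most `M`. -/
def Evaluates (f : List Bool → (ℕ → ℕ) → ℕ) (T : ℕ → ℕ) (R : ℕ → ℕ) (fr dst : ℕ) (P : Program) :
    Prop :=
  ∀ B ρ s M, B.length ≤ M → (∀ x, ρ x ≤ M) → Ready R fr B ρ s →
    P.Runs s (T M) (Function.update s dst (tally (f B ρ) ++ s dst))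

/-- Functions of a bit list and finitely many natural numbers (the values of variables, which are
indexed by natural numbers) that can be evaluated by stack programs in unary arithmetic in
polynomial time. -/
def Comp (f : List Bool → (ℕ → ℕ) → ℕ) : Prop :=
  ∃ V T : ℕ → ℕ, PolyBdd V ∧ PolyBdd T ∧
    (∀ B ρ M, B.length ≤ M → (∀ x, ρ x ≤ M) → f B ρ ≤ V M) ∧
    ∀ R fr dst, Admissible R fr dst → ∃ P, Evaluates f T R fr dst P

section
variable {R : ℕ → ℕ} {fr dst : ℕ} {B : List Bool} {ρ : ℕ → ℕ} {s : Stk}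

theorem Ready.update_dst (h : Ready R fr B ρ s) (ha : Admissible R fr dst) (l : List Sym) :
    Ready R fr B ρ (Function.update s dst l) where
  bits := by rw [Function.update_of_ne ha.dst_ne_two.symm]; exact h.bits
  vars x := by rw [Function.update_of_ne (ha.vars_ne x)]; exact h.vars x
  clean j hj := by
    rw [Function.update_of_ne (by have := ha.dst_lt; omega)]; exact h.clean j hj

theorem Ready.update_fresh (h : Ready R fr B ρ s) (ha : Admissible R fr dst) (l : List Sym) :
    Ready R (fr + 1) B ρ (Function.update s fr l) where
  bits := by rw [Function.update_of_ne (by have := ha.two_lt; omega)]; exact h.bits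
  vars x := by rw [Function.update_of_ne (by have := ha.vars_lt x; omega)]; exact h.vars x
  clean j hj := by rw [Function.update_of_ne (by omega)]; exact h.clean j (by omega)

theorem Admissible.succ (ha : Admissible R fr dst) : Admissible R (fr + 1) dst where
  two_lt := by have := ha.two_lt; omega
  vars_lt x := by have := ha.vars_lt x; omega
  dst_lt := by have := ha.dst_lt; omega
  dst_ne_two := ha.dst_ne_two
  vars_ne := ha.vars_ne

theorem Admissible.fresh (ha : Admissible R fr dst) : Admissible R (fr + 1) fr where
  two_lt := by have := ha.two_lt; omega
  vars_lt x := by have := ha.vars_lt x; omega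
  dst_lt := by omega
  dst_ne_two := by have := ha.two_lt; omega
  vars_ne x := by have := ha.vars_lt x; omega

/-- Evaluation into the first fresh stack. -/
theorem Evaluates.runs_fresh {f : List Bool → (ℕ → ℕ) → ℕ} {T : ℕ → ℕ} {P : Program} {M : ℕ}
    (hP : Evaluates f T R (fr + 1) fr P) (hB : B.length ≤ M) (hρ : ∀ x, ρ x ≤ M)
    (h : Ready R fr B ρ s) : P.Runs s (T M) (Function.update s fr (tally (f B ρ))) := by
  have := hP B ρ s M hB hρ ⟨h.bits, h.vars, fun j hj => h.clean j (by omega)⟩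
  rwa [h.clean fr le_rfl, List.append_nil] at this

end

namespace Comp
variable {f g : List Bool → (ℕ → ℕ) → ℕ}

theorem zero : Comp fun _ _ => 0 := by
  refine ⟨fun _ => 0, fun _ => 0, .const 0, .const 0, fun _ _ _ _ _ => le_rfl,
    fun R fr dst ha => ⟨skip, fun B ρ s M _ _ _ => ?_⟩⟩
  simpa using skip_runs s 0

theorem one : Comp fun _ _ => 1 := by
  refine ⟨fun _ => 1, fun _ => 1, .const 1, .const 1, fun _ _ _ _ _ => le_rfl,
    fun R fr dst ha => ⟨push dst none, fun B ρ s M _ _ _ => ?_⟩⟩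
  exact push_runs dst none s

theorem add (hf : Comp f) (hg : Comp g) : Comp fun B ρ => f B ρ + g B ρ := by
  obtain ⟨V, T, hV, hT, hv, hp⟩ := hf
  obtain ⟨V', T', hV', hT', hv', hp'⟩ := hg
  refine ⟨fun M => V M + V' M, fun M => T M + T' M, hV.add hV', hT.add hT',
    fun B ρ M hB hρ => Nat.add_le_add (hv B ρ M hB hρ) (hv' B ρ M hB hρ), fun R fr dst ha => ?_⟩
  obtain ⟨P, hP⟩ := hp R fr dst ha
  obtain ⟨P', hP'⟩ := hp' R fr dst ha
  refine ⟨P.seq P', fun B ρ s M hB hρ hs => ?_⟩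
  have h := seq_runs (hP B ρ s M hB hρ hs) (hP' B ρ _ M hB hρ (hs.update_dst ha _))
  rw [Function.update_self, Function.update_idem, tally_append', Nat.add_comm (g B ρ)] at h
  exact h

theorem const (n : ℕ) : Comp fun _ _ => n := by
  induction n with
  | zero => exact zero
  | succ n ih => exact ih.add one

theorem var (x : ℕ) : Comp fun _ ρ => ρ x := by
  refine ⟨fun M => M, fun M => (M * (2 + 1) + 1) + (2 * M + 1), .id,
    ((PolyBdd.id.mul (.const _)).add (.const _)).add (((PolyBdd.const 2).mul .id).add (.const _)),
    fun B ρ M _ hρ => hρ x, fun R fr dst ha => ?_⟩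
  refine ⟨(each (R x) fun _ => (push dst none).seq (push fr none)).seq (move fr (R x)),
    fun B ρ s M hB hρ hs => ?_⟩
  have h1 := ha.vars_lt x
  have h2 := ha.dst_lt
  have h3 := ha.vars_ne x
  have hx := hs.vars x
  have hfr := hs.clean fr le_rfl
  have l1 := each_runs_tally (k := R x) (p := fun _ => (push dst none).seq (push fr none))
    (t := 2) (fun i => Function.update (Function.update (Function.update s (R x)
      (tally (ρ x - i))) dst (tally i ++ s dst)) fr (tally i)) (ρ x)
    (fun i hi => by
      rw [Function.update_of_ne (by omega), Function.update_of_ne h3, Function.update_self])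
    (fun i hi => by
      have a1 := seq_runs (push_runs dst none _) (push_runs fr none _)
        (s := Function.update (Function.update (Function.update (Function.update s (R x)
          (tally (ρ x - i))) dst (tally i ++ s dst)) fr (tally i)) (R x) (tally (ρ x - (i + 1))))
      convert a1 using 1
      funext j
      by_cases e1 : j = fr
      · subst e1; simp [tally_succ, h2.ne', h1.ne']
      by_cases e2 : j = dst
      · subst e2; simp [tally_succ, e1, Ne.symm h3]
      by_cases e3 : j = R x
      · subst e3; simp [e1, e2]
      · simp [e1, e2, e3])
  have l2 := move_runs (k := fr) (d := R x) (by omega) (s := Function.update (Function.update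
    (Function.update s (R x) (tally (ρ x - ρ x))) dst (tally (ρ x) ++ s dst)) fr (tally (ρ x)))
    (Function.update_self ..)
  have l3 := (seq_runs l1 l2).mono (t' := (M * (2 + 1) + 1) + (2 * M + 1))
    (by have := hρ x; simp only [tally_length]; omega)
  convert l3 using 1
  · funext j
    by_cases e1 : j = fr
    · subst e1; simp [hfr]
    by_cases e2 : j = dst
    · subst e2; simp [e1]
    by_cases e3 : j = R x
    · subst e3; simp [e1, e2, hx]
    · simp [e1, e2, e3]
  · funext j
    by_cases e1 : j = fr
    · subst e1; simp [hfr, h2.ne', h1.ne']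
    by_cases e2 : j = dst
    · subst e2; simp [e1, Ne.symm h3]
    by_cases e3 : j = R x
    · subst e3; simp [e1, e2, hx]
    · simp [e1, e2, e3]

theorem mul (hf : Comp f) (hg : Comp g) : Comp fun B ρ => f B ρ * g B ρ := by
  obtain ⟨V, T, hV, hT, hv, hp⟩ := hf
  obtain ⟨V', T', hV', hT', hv', hp'⟩ := hg
  refine ⟨fun M => V M * V' M, fun M => T M + (V M * (T' M + 1) + 1), hV.mul hV',
    hT.add ((hV.mul (hT'.add (.const 1))).add (.const 1)),
    fun B ρ M hB hρ => Nat.mul_le_mul (hv B ρ M hB hρ) (hv' B ρ M hB hρ), fun R fr dst ha => ?_⟩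
  obtain ⟨P, hP⟩ := hp R (fr + 1) fr ha.fresh
  obtain ⟨P', hP'⟩ := hp' R (fr + 1) dst ha.succ
  refine ⟨P.seq (each fr fun _ => P'), fun B ρ s M hB hρ hs => ?_⟩
  have h2 := ha.dst_lt
  have hfr := hs.clean fr le_rfl
  have l1 := each_runs_tally (k := fr) (p := fun _ => P') (t := T' M)
    (fun i => Function.update (Function.update s fr (tally (f B ρ - i))) dst
      (tally (i * g B ρ) ++ s dst)) (f B ρ)
    (fun i hi => by rw [Function.update_of_ne (by omega), Function.update_self])
    (fun i hi => by
      have hr : Ready R (fr + 1) B ρ (Function.update (Function.update (Function.update s fr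
          (tally (f B ρ - i))) dst (tally (i * g B ρ) ++ s dst)) fr
          (tally (f B ρ - (i + 1)))) := by
        rw [Function.update_comm (by omega), Function.update_idem]
        exact (hs.update_fresh ha _).update_dst ha.succ _
      convert hP' B ρ _ M hB hρ hr using 1
      funext j
      by_cases e1 : j = dst
      · subst e1; simp [tally_append', h2.ne, Nat.succ_mul, Nat.add_comm]
      by_cases e2 : j = fr
      · subst e2; simp [e1]
      · simp [e1, e2])
  have l2 := (seq_runs (hP.runs_fresh hB hρ hs) (Q := each fr fun _ => P')
    (t' := f B ρ * (T' M + 1) + 1) (by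
      convert l1 using 1
      funext j
      by_cases e1 : j = dst
      · subst e1; simp [h2.ne]
      · simp [e1])).mono (t' := T M + (V M * (T' M + 1) + 1))
      (by have := Nat.mul_le_mul_right (T' M + 1) (hv B ρ M hB hρ); omega)
  convert l2 using 1
  funext j
  by_cases e1 : j = dst
  · subst e1; simp
  by_cases e2 : j = fr
  · subst e2; simp [e1, hfr]
  · simp [e1, e2]

theorem sub (hf : Comp f) (hg : Comp g) : Comp fun B ρ => f B ρ - g B ρ := by
  obtain ⟨V, T, hV, hT, hv, hp⟩ := hf
  obtain ⟨V', T', hV', hT', hv', hp'⟩ := hg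
  refine ⟨V, fun M => (T M + T' M) + ((V' M * (1 + 1) + 1) + (2 * V M + 1)), hV,
    (hT.add hT').add (((hV'.mul (.const 2)).add (.const 1)).add
      (((PolyBdd.const 2).mul hV).add (.const 1))),
    fun B ρ M hB hρ => (Nat.sub_le _ _).trans (hv B ρ M hB hρ), fun R fr dst ha => ?_⟩
  obtain ⟨P, hP⟩ := hp R (fr + 1) fr ha.fresh
  obtain ⟨P', hP'⟩ := hp' R (fr + 1 + 1) (fr + 1) ha.succ.fresh
  refine ⟨(P.seq P').seq ((each (fr + 1) fun _ => case fr fun _ => skip).seq (move fr dst)),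
    fun B ρ s M hB hρ hs => ?_⟩
  have h2 := ha.dst_lt
  have hfr := hs.clean fr le_rfl
  have hfr' := hs.clean (fr + 1) (by omega)
  have l0 := seq_runs (hP.runs_fresh hB hρ hs)
    (hP'.runs_fresh hB hρ (hs.update_fresh ha (tally (f B ρ))))
  have l1 := each_runs_tally (k := fr + 1) (p := fun _ => case fr fun _ => skip) (t := 1)
    (fun i => Function.update (Function.update s fr (tally (f B ρ - i))) (fr + 1)
      (tally (g B ρ - i))) (g B ρ)
    (fun i hi => by rw [Function.update_self])
    (fun i hi => by
      refine case_runs ?_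
      convert skip_runs _ 0 using 1
      funext j
      by_cases e1 : j = fr
      · subst e1
        simp [tally]
        omega
      by_cases e2 : j = fr + 1
      · subst e2; simp
      · simp [e1, e2])
  have l2 := move_runs (k := fr) (d := dst) (by omega) (s := Function.update
    (Function.update s fr (tally (f B ρ - g B ρ))) (fr + 1) (tally (g B ρ - g B ρ)))
    (l := tally (f B ρ - g B ρ)) (by simp)
  have l3 := (seq_runs l0 (seq_runs l1 l2)).mono
    (t' := (T M + T' M) + ((V' M * (1 + 1) + 1) + (2 * V M + 1)))
    (by
      have := hv B ρ M hB hρ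
      have := hv' B ρ M hB hρ
      simp only [tally_length]; omega)
  convert l3 using 1
  funext j
  by_cases e1 : j = dst
  · subst e1; simp [h2.ne, show j ≠ fr + 1 by omega]
  by_cases e2 : j = fr
  · subst e2; simp [e1, hfr]
  by_cases e3 : j = fr + 1
  · subst e3; simp [e1, hfr']
  · simp [e1, e2, e3]

theorem sum (v : ℕ) (hf : Comp f) (hg : Comp g) :
    Comp fun B ρ => ∑ t ∈ Finset.range (f B ρ), g B (Function.update ρ v t) := by
  obtain ⟨V, T, hV, hT, hv, hp⟩ := hf
  obtain ⟨V', T', hV', hT', hv', hp'⟩ := hg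
  have hM : PolyBdd fun M => M + V M := PolyBdd.id.add hV
  have hρ' {B : List Bool} {ρ : ℕ → ℕ} {M t : ℕ} (hB : B.length ≤ M) (hρ : ∀ x, ρ x ≤ M)
      (ht : t < f B ρ) (x : ℕ) : Function.update ρ v t x ≤ M + V M := by
    have h1 := hv B ρ M hB hρ
    have h2 := hρ x
    rw [Function.update_apply]
    split_ifs <;> omega
  refine ⟨fun M => V M * V' (M + V M), fun M => T M + (V M * (T' (M + V M) + 1) + 1),
    hV.mul (hV'.comp hM), hT.add ((hV.mul ((hT'.comp hM).add (.const 1))).add (.const 1)),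
    fun B ρ M hB hρ => ?_, fun R fr dst ha => ?_⟩
  · refine (Finset.sum_le_card_nsmul _ _ (V' (M + V M)) fun t ht => ?_).trans ?_
    · exact hv' B _ _ (by omega) (hρ' hB hρ (Finset.mem_range.1 ht))
    · rw [Finset.card_range, smul_eq_mul]
      exact Nat.mul_le_mul_right _ (hv B ρ M hB hρ)
  have ha' : Admissible (Function.update R v fr) (fr + 1) dst := by
    have := ha.dst_lt
    refine ⟨ha.succ.two_lt, fun x => ?_, ha.succ.dst_lt, ha.dst_ne_two, fun x => ?_⟩
    · rw [Function.update_apply]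
      have := ha.vars_lt x
      split_ifs <;> omega
    · rw [Function.update_apply]
      have := ha.vars_ne x
      split_ifs <;> omega
  obtain ⟨P, hP⟩ := hp R (fr + 1) fr ha.fresh
  obtain ⟨P', hP'⟩ := hp' (Function.update R v fr) (fr + 1) dst ha'
  refine ⟨P.seq (each fr fun _ => P'), fun B ρ s M hB hρ hs => ?_⟩
  have h2 := ha.dst_lt
  have hfr := hs.clean fr le_rfl
  -- the loop counter runs downwards, and its stack is the variable `v` of the body
  have l1 := each_runs_tally (k := fr) (p := fun _ => P') (t := T' (M + V M))
    (fun i => Function.update (Function.update s fr (tally (f B ρ - i))) dst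
      (tally (∑ j ∈ Finset.range i, g B (Function.update ρ v (f B ρ - 1 - j))) ++ s dst)) (f B ρ)
    (fun i hi => by rw [Function.update_of_ne (by omega), Function.update_self])
    (fun i hi => by
      have hr : Ready (Function.update R v fr) (fr + 1) B
          (Function.update ρ v (f B ρ - 1 - i)) (Function.update (Function.update
            (Function.update s fr (tally (f B ρ - i))) dst (tally (∑ j ∈ Finset.range i,
            g B (Function.update ρ v (f B ρ - 1 - j))) ++ s dst)) fr
            (tally (f B ρ - (i + 1)))) := by
        rw [Function.update_comm (by omega), Function.update_idem]
        have hr' := (hs.update_fresh ha (tally (f B ρ - (i + 1)))).update_dst ha.succ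
          (tally (∑ j ∈ Finset.range i, g B (Function.update ρ v (f B ρ - 1 - j))) ++ s dst)
        refine ⟨hr'.bits, fun x => ?_, hr'.clean⟩
        by_cases hx : x = v
        · subst hx
          rw [Function.update_self, Function.update_self, Function.update_of_ne (by omega),
            Function.update_self]
          congr 1
          omega
        · rw [Function.update_of_ne hx, Function.update_of_ne hx]
          exact hr'.vars x
      convert hP' B _ _ (M + V M) (by omega) (hρ' hB hρ (by omega)) hr using 1
      funext j
      by_cases e1 : j = dst
      · subst e1
        simp [tally_append', h2.ne, Finset.sum_range_succ, Nat.add_comm]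
      by_cases e2 : j = fr
      · subst e2; simp [e1]
      · simp [e1, e2])
  have l2 := (seq_runs (hP.runs_fresh hB hρ hs) (Q := each fr fun _ => P')
    (t' := f B ρ * (T' (M + V M) + 1) + 1) (by
      convert l1 using 1
      funext j
      by_cases e1 : j = dst
      · subst e1; simp [h2.ne]
      · simp [e1])).mono (t' := T M + (V M * (T' (M + V M) + 1) + 1))
      (by have := Nat.mul_le_mul_right (T' (M + V M) + 1) (hv B ρ M hB hρ); omega)
  rw [Finset.sum_range_reflect (fun t => g B (Function.update ρ v t))] at l2
  convert l2 using 1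
  funext j
  by_cases e1 : j = dst
  · subst e1; simp
  by_cases e2 : j = fr
  · subst e2; simp [e1, hfr]
  · simp [e1, e2]

/-- Access to the bit list. -/
theorem bit (hf : Comp f) : Comp fun B ρ => if B.getD (f B ρ) false then 1 else 0 := by
  obtain ⟨V, T, hV, hT, hv, hp⟩ := hf
  refine ⟨fun _ => 1, fun M => T M + ((V M * (2 + 1) + 1) + (3 + (2 * M + 1))), .const 1,
    hT.add (((hV.mul (.const _)).add (.const _)).add ((PolyBdd.const 3).add
      (((PolyBdd.const 2).mul .id).add (.const _)))),
    fun B ρ M hB hρ => by dsimp only; split_ifs <;> omega, fun R fr dst ha => ?_⟩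
  obtain ⟨P, hP⟩ := hp R (fr + 1) fr ha.fresh
  refine ⟨P.seq ((each fr fun _ => case 2 fun o => o.elim skip (push (fr + 1))).seq
    ((case 2 fun o => o.elim skip fun a => (push 2 a).seq
      (if a = some true then push dst none else skip)).seq (move (fr + 1) 2))),
    fun B ρ s M hB hρ hs => ?_⟩
  have h1 := ha.two_lt
  have h2 := ha.dst_lt
  have h3 := ha.dst_ne_two
  have hfr := hs.clean fr le_rfl
  have hfr' := hs.clean (fr + 1) (by omega)
  have hb := hs.bits
  set n := f B ρ with hn
  -- the first `i` bits have been moved to the stack `fr + 1`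
  set S : ℕ → Stk := fun i => Function.update (Function.update (Function.update s fr
    (tally (n - i))) 2 ((B.drop i).map some)) (fr + 1) ((B.take i).reverse.map some) with hS
  have l1 := each_runs_tally (k := fr) (p := fun _ => case 2 fun o => o.elim skip (push (fr + 1)))
    (t := 2) S n
    (fun i hi => by
      simp only [hS]
      rw [Function.update_of_ne (by omega), Function.update_of_ne (by omega),
        Function.update_self])
    (fun i hi => by
      refine case_runs ?_
      have e2 : Function.update (S i) fr (tally (n - (i + 1))) 2 = (B.drop i).map some := by
        simp only [hS]
        rw [Function.update_of_ne (by omega), Function.update_of_ne (by omega),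
          Function.update_self]
      rw [e2]
      by_cases hi' : i < B.length
      · rw [List.drop_eq_getElem_cons hi']
        simp only [List.map_cons, List.head?_cons, Option.elim_some, List.tail_cons]
        convert push_runs (fr + 1) _ _ using 1
        funext j
        by_cases e1 : j = fr
        · subst e1; simp [hS, show j ≠ 2 by omega]
        by_cases e2 : j = fr + 1
        · subst e2; simp [hS, List.take_add_one, hi', show fr + 1 ≠ 2 by omega]
        by_cases e3 : j = 2
        · subst e3; simp [hS, e2]
        · simp [hS, e1, e2, e3]
      · rw [List.drop_of_length_le (by omega)]
        simp only [List.map_nil, List.head?_nil, Option.elim_none, List.tail_nil]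
        convert skip_runs _ 1 using 1
        funext j
        by_cases e1 : j = fr
        · subst e1; simp [hS, show j ≠ 2 by omega]
        by_cases e2 : j = fr + 1
        · subst e2
          simp [hS, show fr + 1 ≠ 2 by omega]
          omega
        by_cases e3 : j = 2
        · subst e3; simp [hS, e2]; omega
        · simp [hS, e1, e2, e3])
  have l2 : (case 2 fun o => o.elim skip fun a => (push 2 a).seq
      (if a = some true then push dst none else skip)).Runs (S n) 3
      (Function.update (S n) dst (tally (if B.getD n false then 1 else 0) ++ s dst)) := by
    refine case_runs ?_
    have e2 : S n 2 = (B.drop n).map some := by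
      simp only [hS]
      rw [Function.update_of_ne (by omega), Function.update_self]
    have e3 : S n dst = s dst := by
      simp only [hS]
      rw [Function.update_of_ne (by omega), Function.update_of_ne (by omega),
        Function.update_of_ne (by omega)]
    rw [e2]
    by_cases hn' : n < B.length
    · rw [List.drop_eq_getElem_cons hn', List.getD_eq_getElem _ _ hn']
      simp only [List.map_cons, List.head?_cons, Option.elim_some, List.tail_cons]
      have p1 := push_runs 2 (some B[n]) (Function.update (S n) 2 ((B.drop (n + 1)).map some))
      rw [Function.update_self, Function.update_idem, ← List.map_cons,
        ← List.drop_eq_getElem_cons hn', ← e2, Function.update_eq_self] at p1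
      refine seq_runs (t := 1) (t' := 1) p1 ?_
      by_cases hb' : B[n] = true
      · simp only [hb', if_true]
        convert push_runs dst none _ using 1
        rw [e3]
        rfl
      · have hb'' : B[n] = false := by simpa using hb'
        simp only [hb'', Option.some.injEq, Bool.false_eq_true, if_false, tally_zero,
          List.nil_append, ← e3, Function.update_eq_self]
        exact skip_runs _ 1
    · rw [List.drop_of_length_le (by omega)]
      simp only [List.map_nil, List.head?_nil, Option.elim_none, List.tail_nil]
      convert skip_runs _ 2 using 1
      rw [List.getD_eq_default _ _ (by omega)]
      have e4 : S n 2 = [] := by rw [e2, List.drop_of_length_le (by omega)]; rfl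
      rw [← e4, Function.update_eq_self]
      simp [← e3]
  have l3 := move_runs (k := fr + 1) (d := 2) (by omega) (s := Function.update (S n) dst
    (tally (if B.getD n false then 1 else 0) ++ s dst)) (l := (B.take n).reverse.map some)
    (by
      simp only [hS]
      rw [Function.update_of_ne (by omega), Function.update_self])
  have l4 := seq_runs (hP.runs_fresh hB hρ hs) (seq_runs (by
    convert l1 using 1
    funext j
    by_cases e1 : j = fr
    · subst e1; simp [hS, hn, show j ≠ 2 by omega]
    by_cases e2 : j = fr + 1
    · subst e2; simp [hS, hfr']
    by_cases e3 : j = 2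
    · subst e3; simp [hS, e1, e2, hb]
    · simp [hS, e1, e2, e3]) (seq_runs l2 l3))
  have l5 := l4.mono (t' := T M + ((V M * (2 + 1) + 1) + (3 + (2 * M + 1))))
    (by
      have := hv B ρ M hB hρ
      have := List.length_take_le' n B
      simp only [List.length_map, List.length_reverse] at *
      omega)
  convert l5 using 1
  funext j
  by_cases e1 : j = dst
  · subst e1; simp [h3, ← hn, show j ≠ fr + 1 by omega]
  by_cases e2 : j = fr
  · subst e2; simp [hS, e1, hfr, show j ≠ 2 by omega]
  by_cases e3 : j = fr + 1
  · subst e3; simp [e1, hfr', show fr + 1 ≠ 2 by omega]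
  by_cases e4 : j = 2
  · subst e4
    simp only [hS]
    rw [Function.update_of_ne e1, Function.update_self, Function.update_of_ne e1,
      Function.update_of_ne e3, Function.update_self, List.map_reverse, List.reverse_reverse,
      ← List.map_append, List.take_append_drop, hb]
  · simp [hS, e1, e2, e3, e4]

/-- The values of the variables for a function of two arguments. -/
def env₂ (a b : ℕ) : ℕ → ℕ := fun x => if x = 0 then a else if x = 1 then b else 0

/-- Substitution into a function of the variables `0` and `1`. -/
theorem call {h : List Bool → (ℕ → ℕ) → ℕ} (hh : Comp h) (hf : Comp f) (hg : Comp g) :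
    Comp fun B ρ => h B (env₂ (f B ρ) (g B ρ)) := by
  obtain ⟨V, T, hV, hT, hv, hp⟩ := hf
  obtain ⟨V', T', hV', hT', hv', hp'⟩ := hg
  obtain ⟨W, U, hW, hU, hw, hq⟩ := hh
  have hM : PolyBdd fun M => M + V M + V' M := (PolyBdd.id.add hV).add hV'
  have hρ' {B : List Bool} {ρ : ℕ → ℕ} {M : ℕ} (hB : B.length ≤ M) (hρ : ∀ x, ρ x ≤ M)
      (x : ℕ) : env₂ (f B ρ) (g B ρ) x ≤ M + V M + V' M := by
    have h1 := hv B ρ M hB hρ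
    have h2 := hv' B ρ M hB hρ
    unfold env₂
    split_ifs <;> omega
  refine ⟨fun M => W (M + V M + V' M),
    fun M => (T M + T' M) + (U (M + V M + V' M) + ((V M + 1) + (V' M + 1))), hW.comp hM,
    (hT.add hT').add ((hU.comp hM).add ((hV.add (.const 1)).add (hV'.add (.const 1)))),
    fun B ρ M hB hρ => hw B _ _ (by omega) (hρ' hB hρ), fun R fr dst ha => ?_⟩
  obtain ⟨P, hP⟩ := hp R (fr + 1) fr ha.fresh
  obtain ⟨P', hP'⟩ := hp' R (fr + 1 + 1) (fr + 1) ha.succ.fresh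
  have h1 := ha.two_lt
  have h2 := ha.dst_lt
  have h3 := ha.dst_ne_two
  obtain ⟨Q, hQ⟩ := hq (fun x => if x = 0 then fr else if x = 1 then fr + 1 else fr + 2)
    (fr + 3) dst ⟨by omega, fun x => by split_ifs <;> omega, by omega, by omega,
      fun x => by split_ifs <;> omega⟩
  refine ⟨(P.seq P').seq (Q.seq ((clear fr).seq (clear (fr + 1)))), fun B ρ s M hB hρ hs => ?_⟩
  have hfr := hs.clean fr le_rfl
  have hfr' := hs.clean (fr + 1) (by omega)
  have l0 := seq_runs (hP.runs_fresh hB hρ hs)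
    (hP'.runs_fresh hB hρ (hs.update_fresh ha (tally (f B ρ))))
  set s₁ := Function.update (Function.update s fr (tally (f B ρ))) (fr + 1) (tally (g B ρ)) with hs₁
  have hc (j : ℕ) (hj : fr + 2 ≤ j) : s₁ j = [] := by
    rw [hs₁, Function.update_of_ne (by omega), Function.update_of_ne (by omega),
      hs.clean j (by omega)]
  have hr : Ready (fun x => if x = 0 then fr else if x = 1 then fr + 1 else fr + 2) (fr + 3) B
      (env₂ (f B ρ) (g B ρ)) s₁ := by
    refine ⟨?_, fun x => ?_, fun j hj => hc j (by omega)⟩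
    · rw [hs₁, Function.update_of_ne (by omega), Function.update_of_ne (by omega), hs.bits]
    · unfold env₂
      split_ifs
      · rw [hs₁, Function.update_of_ne (by omega), Function.update_self]
      · rw [hs₁, Function.update_self]
      · rw [hc _ (by omega), tally_zero]
  have l1 := hQ B _ s₁ (M + V M + V' M) (by omega) (hρ' hB hρ) hr
  have l2 := clear_runs (k := fr) (l := tally (f B ρ)) (s := Function.update s₁ dst
    (tally (h B (env₂ (f B ρ) (g B ρ))) ++ s₁ dst))
    (by rw [Function.update_of_ne (by omega), hs₁, Function.update_of_ne (by omega),
      Function.update_self])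
  have l3 := clear_runs (k := fr + 1) (l := tally (g B ρ)) (s := Function.update
    (Function.update s₁ dst (tally (h B (env₂ (f B ρ) (g B ρ))) ++ s₁ dst)) fr [])
    (by rw [Function.update_of_ne (by omega), Function.update_of_ne (by omega), hs₁,
      Function.update_self])
  have l4 := (seq_runs l0 (seq_runs l1 (seq_runs l2 l3))).mono
    (t' := (T M + T' M) + (U (M + V M + V' M) + ((V M + 1) + (V' M + 1))))
    (by
      have := hv B ρ M hB hρ
      have := hv' B ρ M hB hρ
      simp only [tally_length]; omega)
  convert l4 using 1
  funext j
  by_cases e1 : j = dst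
  · subst e1; simp [hs₁, h2.ne, show j ≠ fr + 1 by omega]
  by_cases e2 : j = fr
  · subst e2; simp [e1, hfr]
  by_cases e3 : j = fr + 1
  · subst e3; simp [e1, hfr']
  · simp [hs₁, e1, e2, e3]

theorem congr (hf : Comp f) (h : ∀ B ρ, f B ρ = g B ρ) : Comp g := by
  obtain rfl : f = g := by
    funext B ρ
    exact h B ρ
  exact hf

end Comp
end StackProg

namespace StackProg

/-! ### Predicates and derived arithmetic operations -/

open Classical in
/-- Predicates whose characteristic function can be evaluated. -/
def CompPred (p : List Bool → (ℕ → ℕ) → Prop) : Prop := Comp fun B ρ => if p B ρ then 1 else 0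

section
variable {f g : List Bool → (ℕ → ℕ) → ℕ} {p q : List Bool → (ℕ → ℕ) → Prop}

theorem CompPred.lt (hf : Comp f) (hg : Comp g) : CompPred fun B ρ => f B ρ < g B ρ :=
  ((Comp.const 1).sub ((Comp.const 1).sub (hg.sub hf))).congr fun B ρ => by split_ifs <;> omega

theorem CompPred.not (hp : CompPred p) : CompPred fun B ρ => ¬ p B ρ :=
  ((Comp.const 1).sub hp).congr fun B ρ => by by_cases h : p B ρ <;> simp [h]

theorem CompPred.and (hp : CompPred p) (hq : CompPred q) : CompPred fun B ρ => p B ρ ∧ q B ρ :=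
  (hp.mul hq).congr fun B ρ => by by_cases h : p B ρ <;> by_cases h' : q B ρ <;> simp [h, h']

theorem CompPred.or (hp : CompPred p) (hq : CompPred q) : CompPred fun B ρ => p B ρ ∨ q B ρ :=
  ((hp.not.and hq.not).not).congr fun B ρ => by
    by_cases h : p B ρ <;> by_cases h' : q B ρ <;> simp [h, h']

theorem CompPred.le (hf : Comp f) (hg : Comp g) : CompPred fun B ρ => f B ρ ≤ g B ρ :=
  (CompPred.lt hg hf).not.congr fun B ρ => by split_ifs <;> first | rfl | omega

theorem CompPred.eq (hf : Comp f) (hg : Comp g) : CompPred fun B ρ => f B ρ = g B ρ :=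
  ((CompPred.le hf hg).and (CompPred.le hg hf)).congr fun B ρ => by
    split_ifs <;> first | rfl | omega

theorem CompPred.bit (hf : Comp f) : CompPred fun B ρ => B.getD (f B ρ) false = true :=
  hf.bit.congr fun B ρ => by split_ifs <;> rfl

theorem Comp.ite [∀ B ρ, Decidable (p B ρ)] (hp : CompPred p) (hf : Comp f) (hg : Comp g) :
    Comp fun B ρ => if p B ρ then f B ρ else g B ρ :=
  ((hp.mul hf).add (hp.not.mul hg)).congr fun B ρ => by by_cases h : p B ρ <;> simp [h]

theorem Comp.div (hf : Comp f) (hg : Comp g) : Comp fun B ρ => f B ρ / g B ρ := by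
  -- `a / b` is the number of `t < a` with `(t + 1) * b ≤ a`
  have h := Comp.call (Comp.ite (p := fun _ ρ => 0 < ρ 1) (CompPred.lt .zero (.var 1))
    (Comp.sum 2 (.var 0) (CompPred.le (((Comp.var 2).add .one).mul (.var 1)) (.var 0))) .zero) hf hg
  refine h.congr fun B ρ => ?_
  simp only [Comp.env₂, Function.update_apply]
  norm_num
  generalize f B ρ = a
  generalize g B ρ = b
  split_ifs with hb
  · rw [← Finset.card_range (a / b)]
    congr 1
    ext t
    simp only [Finset.mem_filter, Finset.mem_range, Nat.lt_div_iff_mul_lt hb]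
    have h1 : (t + 1) * b ≤ a ↔ t * b < a - (b - 1) := by
      rw [Nat.succ_mul]
      omega
    rw [← h1]
    refine ⟨fun h => h.2, fun h => ⟨?_, h⟩⟩
    have : t + 1 ≤ (t + 1) * b := Nat.le_mul_of_pos_right _ hb
    omega
  · obtain rfl : b = 0 := by omega
    simp

theorem Comp.mod (hf : Comp f) (hg : Comp g) : Comp fun B ρ => f B ρ % g B ρ :=
  (hf.sub (hg.mul (hf.div hg))).congr fun B ρ => by
    have := Nat.div_add_mod (f B ρ) (g B ρ)
    omega

end

/-! ### Reading a graph and writing a sequence of numbers -/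

namespace Program

/-- The stacks with the contents given by a list, followed by empty stacks. -/
def stk (l : List (List Sym)) : Stk := fun j => l.getD j []

theorem update_stk {l : List (List Sym)} {j : ℕ} (hj : j < l.length) (x : List Sym) :
    Function.update (stk l) j x = stk (l.set j x) := by
  funext i
  unfold stk
  by_cases h : i = j
  · subst h
    rw [Function.update_self, List.getD_eq_getElem _ _ (by simpa using hj), List.getElem_set_self]
  · rw [Function.update_of_ne h]
    simp [Ne.symm h]

theorem Runs.congr {P : Program} {s s' r r' : Stk} {t t' : ℕ} (h : P.Runs s t s') (hs : s = r)
    (hs' : s' = r') (ht : t ≤ t') : P.Runs r t' r' := by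
  subst hs hs'
  exact h.mono ht

end Program

open Program ParamComplexity

theorem encodeNats_cons (m : ℕ) (l : List ℕ) :
    encodeNats (m :: l) = m.bits.map some ++ none :: encodeNats l := by
  simp [encodeNats]

/-- The number with the given binary digits, starting with the least significant digit. -/
def ofBits : List Bool → ℕ
  | [] => 0
  | b :: l => b.toNat + 2 * ofBits l

theorem ofBits_bits (m : ℕ) : ofBits m.bits = m := by
  induction m using Nat.binaryRec' with
  | zero => simp [ofBits]
  | bit b m h ih =>
    rw [Nat.bits_append_bit _ _ h, ofBits, ih, Nat.bit_val]
    omega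

theorem two_pow_length_bits_le (m : ℕ) : 2 ^ m.bits.length ≤ 2 * m + 1 := by
  induction m using Nat.binaryRec' with
  | zero => simp
  | bit b m h ih =>
    rw [Nat.bits_append_bit _ _ h, List.length_cons, pow_succ, Nat.bit_val]
    by_cases hm : m = 0
    · subst hm
      simp [h rfl]
    · have : 2 ^ m.bits.length ≤ 2 * m := by
        rcases Nat.lt_or_ge (2 * m) (2 ^ m.bits.length) with h1 | h1
        · have h2 : 2 ^ m.bits.length = 2 * m + 1 := by omega
          rcases Nat.eq_zero_or_pos m.bits.length with h3 | h3
          · rw [h3] at h2; omega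
          · obtain ⟨c, hc⟩ := Nat.exists_eq_add_of_le' h3
            rw [hc, pow_succ] at h2
            omega
        · exact h1
      omega

/-- Add the weight on stack `5` to stack `d` if `b` holds, and double the weight. -/
def addBit (d : ℕ) (b : Bool) : Program :=
  (each 5 fun _ => (push 6 none).seq ((push 6 none).seq (if b then push d none else skip))).seq
    (move 6 5)

/-- Read a number in binary notation from the input and add its product with the weight on stack
`5` to stack `d`. -/
def readBits (d : ℕ) : Program :=
  loop 0 (fun o => o.elim true fun a => a.isNone) fun o => addBit d (o == some (some true))

/-- Read a number in binary notation from the input and write it in unary on stack `d`. -/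
def readNat (d : ℕ) : Program := (push 5 none).seq ((readBits d).seq (clear 5))

theorem addBit_runs (d : ℕ) (hd : 6 < d) (b : Bool) (s : Stk) (w : ℕ) (h5 : s 5 = tally w)
    (h6 : s 6 = []) : (addBit d b).Runs s (8 * w + 2)
      (Function.update (Function.update s 5 (tally (2 * w))) d (tally (b.toNat * w) ++ s d)) := by
  have l1 := each_runs_tally (k := 5) (t := 3)
    (p := fun _ => (push 6 none).seq ((push 6 none).seq (if b then push d none else skip)))
    (fun i => Function.update (Function.update (Function.update s 5 (tally (w - i))) 6
      (tally (2 * i))) d (tally (b.toNat * i) ++ s d)) w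
    (fun i hi => by
      rw [Function.update_of_ne (by omega), Function.update_of_ne (by omega),
        Function.update_self])
    (fun i hi => by
      refine seq_runs (t := 1) (t' := 2) (push_runs 6 none _)
        (seq_runs (t := 1) (t' := 1) (push_runs 6 none _) ?_)
      cases b
      · simp only [Bool.false_eq_true, if_false]
        refine (skip_runs _ 1).congr rfl ?_ le_rfl
        funext j
        by_cases e1 : j = d
        · subst e1; simp [hd.ne', show j ≠ 5 by omega]
        by_cases e2 : j = 6
        · subst e2; simp [e1, Nat.mul_succ, tally_succ]
        by_cases e3 : j = 5
        · subst e3; simp [e1]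
        · simp [e1, e2, e3]
      · simp only [if_true]
        refine (push_runs d none _).congr rfl ?_ le_rfl
        funext j
        by_cases e1 : j = d
        · subst e1; simp [hd.ne', show j ≠ 5 by omega, tally_succ]
        by_cases e2 : j = 6
        · subst e2; simp [e1, Nat.mul_succ, tally_succ]
        by_cases e3 : j = 5
        · subst e3; simp [e1]
        · simp [e1, e2, e3])
  have l2 := move_runs (k := 6) (d := 5) (by omega) (s := Function.update (Function.update
    (Function.update s 5 (tally (w - w))) 6 (tally (2 * w))) d (tally (b.toNat * w) ++ s d))
    (l := tally (2 * w)) (by rw [Function.update_of_ne (by omega), Function.update_self])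
  refine (seq_runs l1 l2).congr ?_ ?_ (by simp only [tally_length]; omega)
  · funext j
    by_cases e1 : j = d
    · subst e1; simp
    by_cases e2 : j = 6
    · subst e2; simp [e1, h6]
    by_cases e3 : j = 5
    · subst e3; simp [e1, h5]
    · simp [e1, e2, e3]
  · funext j
    by_cases e1 : j = d
    · subst e1; simp [show j ≠ 5 by omega, show j ≠ 6 by omega]
    by_cases e2 : j = 6
    · subst e2; simp [e1, h6]
    by_cases e3 : j = 5
    · subst e3; simp [e1]
    · simp [e1, e2, e3]

theorem readBits_runs (d : ℕ) (hd : 6 < d) (l : List Bool) (rest : List Sym) (w : ℕ) (s : Stk)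
    (h0 : s 0 = l.map some ++ none :: rest) (h5 : s 5 = tally w) (h6 : s 6 = []) :
    (readBits d).Runs s (8 * w * l.length * 2 ^ l.length + 3 * l.length + 1)
      (Function.update (Function.update (Function.update s 0 rest) 5 (tally (2 ^ l.length * w))) d
        (tally (ofBits l * w) ++ s d)) := by
  induction l generalizing w s with
  | nil =>
    have h := loop_runs_quit (k := 0) (quit := fun o => o.elim true fun a => a.isNone)
      (p := fun o => addBit d (o == some (some true))) (s := s) (by simp [h0])
    refine h.congr rfl ?_ (by omega)
    funext j
    by_cases e1 : j = d
    · subst e1; simp [ofBits, show j ≠ 0 by omega]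
    by_cases e3 : j = 5
    · subst e3; simp [e1, h5]
    by_cases e4 : j = 0
    · subst e4; simp [e1, h0]
    · simp [e1, e3, e4]
  | cons b l ih =>
    have l1 := addBit_runs d hd b (Function.update s 0 (l.map some ++ none :: rest)) w
      (by rw [Function.update_of_ne (by omega), h5])
      (by rw [Function.update_of_ne (by omega), h6])
    have l2 := ih (2 * w) (Function.update (Function.update (Function.update s 0
      (l.map some ++ none :: rest)) 5 (tally (2 * w))) d (tally (b.toNat * w) ++
      Function.update s 0 (l.map some ++ none :: rest) d))
      (by
        rw [Function.update_of_ne (by omega), Function.update_of_ne (by omega),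
          Function.update_self])
      (by rw [Function.update_of_ne (by omega), Function.update_self])
      (by
        rw [Function.update_of_ne (by omega), Function.update_of_ne (by omega),
          Function.update_of_ne (by omega), h6])
    have h := loop_runs_next (k := 0) (quit := fun o => o.elim true fun a => a.isNone)
      (p := fun o => addBit d (o == some (some true))) (s := s) (by simp [h0])
      (s₁ := Function.update (Function.update (Function.update s 0
      (l.map some ++ none :: rest)) 5 (tally (2 * w))) d (tally (b.toNat * w) ++
      Function.update s 0 (l.map some ++ none :: rest) d)) (t := 8 * w + 2) (by
        simp only [h0, List.map_cons, List.cons_append, List.head?_cons, List.tail_cons]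
        convert l1 using 2
        cases b <;> rfl) l2
    refine h.congr rfl ?_ ?_
    · funext j
      by_cases e1 : j = d
      · subst e1
        simp only [show j ≠ 0 by omega, Function.update_self, ne_eq, not_false_eq_true,
          Function.update_of_ne]
        rw [tally_append', ofBits]
        congr 2
        ring
      by_cases e3 : j = 5
      · subst e3
        simp only [ne_eq, e1, not_false_eq_true, Function.update_of_ne, Function.update_self,
          List.length_cons]
        congr 1
        ring
      by_cases e4 : j = 0
      · subst e4; simp [e1]
      · simp [e1, e3, e4]
    · have : 1 ≤ 2 ^ l.length := Nat.one_le_two_pow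
      have h1 := Nat.mul_le_mul_left (16 * w) this
      rw [List.length_cons, pow_succ]
      calc 8 * w + 2 + (8 * (2 * w) * l.length * 2 ^ l.length + 3 * l.length + 1) + 1
          ≤ 8 * (2 * w) * l.length * 2 ^ l.length + 16 * w * 2 ^ l.length + 3 * l.length + 4 := by
            omega
        _ = _ := by ring

end StackProg

namespace StackProg

open Program ParamComplexity

theorem readNat_runs (d : ℕ) (hd : 6 < d) (m : ℕ) (rest : List Sym) (s : Stk)
    (h0 : s 0 = m.bits.map some ++ none :: rest) (h5 : s 5 = []) (h6 : s 6 = []) (h7 : s d = []) :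
    (readNat d).Runs s (8 * (2 * m + 1) * (2 * m + 1) + 4 * (2 * m + 1) + 3)
      (Function.update (Function.update s 0 rest) d (tally m)) := by
  have l1 := push_runs 5 none s
  rw [h5] at l1
  have l2 := readBits_runs d hd m.bits rest 1 (Function.update s 5 [none])
    (by rw [Function.update_of_ne (by omega), h0]) (by rw [Function.update_self]; rfl)
    (by rw [Function.update_of_ne (by omega), h6])
  rw [ofBits_bits, mul_one, mul_one, mul_one, Function.update_of_ne (by omega : d ≠ 5), h7,
    List.append_nil] at l2
  have l3 := clear_runs (k := 5) (l := tally (2 ^ m.bits.length)) (s := Function.update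
    (Function.update (Function.update (Function.update s 5 [none]) 0 rest) 5
      (tally (2 ^ m.bits.length))) d (tally m))
    (by rw [Function.update_of_ne (by omega), Function.update_self])
  refine (seq_runs l1 (seq_runs l2 l3)).congr rfl ?_ ?_
  · funext j
    by_cases e1 : j = d
    · subst e1; simp [show j ≠ 5 by omega]
    by_cases e3 : j = 5
    · subst e3; simp [e1, h5]
    by_cases e4 : j = 0
    · subst e4; simp [e1]
    · simp [e1, e3, e4]
  · have h1 := two_pow_length_bits_le m
    have h2 : m.bits.length ≤ 2 * m + 1 := Nat.lt_two_pow_self.le.trans h1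
    have h3 := Nat.mul_le_mul (Nat.mul_le_mul_left 8 h2) h1
    simp only [tally_length]
    omega

/-- Read the entries of a 0-1 matrix from the input, and write them on stack `2`. -/
def readBoolList : Program :=
  (each 0 fun a => a.elim (push 6 (some false)) fun _ => case 0 fun _ => push 6 (some true)).seq
    (move 6 2)

theorem encodeNats_zero_cons (l : List ℕ) : encodeNats (0 :: l) = none :: encodeNats l := by
  simp [encodeNats_cons]

theorem encodeNats_one_cons (l : List ℕ) :
    encodeNats (1 :: l) = some true :: none :: encodeNats l := by
  simp [encodeNats_cons]

theorem readBoolList_runs (B : List Bool) (s : Stk) (h0 : s 0 = encodeNats (B.map Bool.toNat))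
    (h2 : s 2 = []) (h6 : s 6 = []) :
    readBoolList.Runs s (5 * B.length + 2)
      (Function.update (Function.update s 0 []) 2 (B.map some)) := by
  have l1 : ∀ (B : List Bool) (s : Stk), s 0 = encodeNats (B.map Bool.toNat) →
      (each 0 fun a => a.elim (push 6 (some false)) fun _ => case 0 fun _ =>
        push 6 (some true)).Runs s (3 * B.length + 1)
      (Function.update (Function.update s 0 []) 6 ((B.map some).reverse ++ s 6)) := by
    intro B
    induction B with
    | nil =>
      intro s h0
      refine (each_runs_nil h0).congr rfl ?_ (by omega)
      funext j
      by_cases e1 : j = 6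
      · subst e1; simp
      by_cases e2 : j = 0
      · subst e2; simpa [encodeNats] using h0
      · simp [e1, e2]
    | cons b B ih =>
      intro s h0
      have l2 := ih (Function.update (Function.update s 0 (encodeNats (B.map Bool.toNat))) 6
        (some b :: s 6)) (by rw [Function.update_of_ne (by omega), Function.update_self])
      cases b
      · simp only [List.map_cons, Bool.toNat_false, encodeNats_zero_cons] at h0
        have l3 := push_runs 6 (some false) (Function.update s 0 (encodeNats (B.map Bool.toNat)))
        rw [Function.update_of_ne (by omega)] at l3
        refine (each_runs_cons h0 l3 l2).congr rfl ?_ (by rw [List.length_cons]; omega)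
        funext j
        by_cases e1 : j = 6
        · subst e1; simp
        by_cases e2 : j = 0
        · subst e2; simp
        · simp [e1, e2]
      · simp only [List.map_cons, Bool.toNat_true, encodeNats_one_cons] at h0
        have l3 : (case 0 fun _ => push 6 (some true)).Runs
            (Function.update s 0 (none :: encodeNats (B.map Bool.toNat))) 2
            (Function.update (Function.update s 0 (encodeNats (B.map Bool.toNat))) 6
              (some true :: s 6)) := by
          refine case_runs ((push_runs 6 (some true) _).congr rfl ?_ le_rfl)
          funext j
          by_cases e1 : j = 6
          · subst e1; simp
          by_cases e2 : j = 0
          · subst e2; simp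
          · simp [e1, e2]
        refine (each_runs_cons h0 l3 l2).congr rfl ?_ (by rw [List.length_cons]; omega)
        funext j
        by_cases e1 : j = 6
        · subst e1; simp
        by_cases e2 : j = 0
        · subst e2; simp
        · simp [e1, e2]
  have l2 := move_runs (k := 6) (d := 2) (by omega) (s := Function.update (Function.update s 0 []) 6
    ((B.map some).reverse ++ s 6)) (l := (B.map some).reverse) (by simp [h6])
  refine (seq_runs (l1 B s h0) l2).congr rfl ?_ (by simp; omega)
  funext j
  by_cases e1 : j = 2
  · subst e1; simp [h2]
  by_cases e2 : j = 6
  · subst e2; simp [h6]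
  · simp [e1, e2]

variable {a₀ a₁ a₂ a₃ a₄ a₅ a₆ a₇ a₈ a₉ : List Sym}

/-- Divide the number on stack `4` by two; the quotient is added to stack `5`, and the remainder is
written on stack `6`. -/
def halve : Program :=
  each 4 fun _ => case 4 fun o => o.elim (push 6 none) fun _ => push 5 none

theorem halve_runs : ∀ m y : ℕ,
    halve.Runs (stk [a₀, a₁, a₂, a₃, tally m, tally y, [], a₇, a₈, a₉]) (3 * m + 1)
      (stk [a₀, a₁, a₂, a₃, [], tally (y + m / 2), tally (m % 2), a₇, a₈, a₉])
  | 0, y => (each_runs_nil rfl).mono (by omega)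
  | 1, y => by
    refine (each_runs_cons (l := []) rfl (case_runs (t := 1) (s' := stk
      [a₀, a₁, a₂, a₃, [], tally y, [none], a₇, a₈, a₉]) ?_) (each_runs_nil rfl)).congr rfl rfl
      (by omega)
    rw [update_stk (by simp)]
    simp only [List.set_cons_succ, List.set_cons_zero]
    rw [update_stk (by simp)]
    simp only [List.set_cons_succ, List.set_cons_zero]
    refine (push_runs 6 none _).congr rfl ?_ le_rfl
    rw [update_stk (by simp)]
    rfl
  | m + 2, y => by
    have ih := halve_runs m (y + 1)
    refine (each_runs_cons (l := tally (m + 1)) rfl (case_runs (t := 1) ?_) ih).congr rfl ?_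
      (by omega)
    · rw [update_stk (by simp)]
      simp only [List.set_cons_succ, List.set_cons_zero]
      rw [update_stk (by simp)]
      simp only [List.set_cons_succ, List.set_cons_zero]
      refine (push_runs 5 none _).congr rfl ?_ le_rfl
      rw [update_stk (by simp)]
      rfl
    · rw [show y + 1 + m / 2 = y + (m + 2) / 2 by omega, show (m + 2) % 2 = m % 2 by omega]

/-- Push the binary digits of the number on stack `4` on stack `9`, starting with the least
significant one. -/
def toBits : Program :=
  each 4 fun _ => (push 4 none).seq (halve.seq
    ((case 6 fun o => push 9 (some o.isSome)).seq (move 5 4)))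

theorem toBits_runs (m : ℕ) (a₉ : List Sym) :
    toBits.Runs (stk [a₀, a₁, a₂, a₃, tally m, [], [], a₇, a₈, a₉]) ((m + 1) * (10 * m + 10))
      (stk [a₀, a₁, a₂, a₃, [], [], [], a₇, a₈, (m.bits.map some).reverse ++ a₉]) := by
  induction m using Nat.binaryRec' generalizing a₉ with
  | zero =>
    rw [Nat.zero_bits]
    exact (each_runs_nil (k := 4) rfl).mono (by omega)
  | bit b q hq ih =>
    obtain ⟨m, hm⟩ : ∃ m, Nat.bit b q = m + 1 := by
      refine Nat.exists_eq_succ_of_ne_zero fun h => ?_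
      rw [Nat.bit_eq_zero_iff] at h
      simp [hq h.1] at h
    have hmod : (m + 1) % 2 = b.toNat := by rw [← hm, Nat.bit_mod_two]
    have hdiv : (m + 1) / 2 = q := by rw [← hm, Nat.bit_div_two]
    have l1 : (push 4 none).Runs
        (Function.update (stk [a₀, a₁, a₂, a₃, tally (m + 1), [], [], a₇, a₈, a₉]) 4 (tally m)) 1
        (stk [a₀, a₁, a₂, a₃, tally (m + 1), [], [], a₇, a₈, a₉]) := by
      refine (push_runs 4 none _).congr rfl ?_ le_rfl
      rw [update_stk (by simp)]
      simp only [List.set_cons_succ, List.set_cons_zero]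
      rw [update_stk (by simp)]
      rfl
    have l2 := halve_runs (a₀ := a₀) (a₁ := a₁) (a₂ := a₂) (a₃ := a₃) (a₇ := a₇) (a₈ := a₈)
      (a₉ := a₉) (m + 1) 0
    rw [hmod, hdiv, Nat.zero_add] at l2
    have l3 : (case 6 fun o => push 9 (some o.isSome)).Runs
        (stk [a₀, a₁, a₂, a₃, [], tally q, tally b.toNat, a₇, a₈, a₉]) 2
        (stk [a₀, a₁, a₂, a₃, [], tally q, [], a₇, a₈, some b :: a₉]) := by
      refine case_runs ?_
      have : (stk [a₀, a₁, a₂, a₃, [], tally q, tally b.toNat, a₇, a₈, a₉] 6) =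
        tally b.toNat := rfl
      rw [this]
      cases b <;>
      · refine (push_runs 9 _ _).congr rfl ?_ le_rfl
        rw [update_stk (by simp)]
        simp only [List.set_cons_succ, List.set_cons_zero]
        rw [update_stk (by simp)]
        rfl
    have l4 : (move 5 4).Runs
        (stk [a₀, a₁, a₂, a₃, [], tally q, [], a₇, a₈, some b :: a₉]) (2 * q + 1)
        (stk [a₀, a₁, a₂, a₃, tally q, [], [], a₇, a₈, some b :: a₉]) := by
      refine (move_runs (k := 5) (d := 4) (l := tally q) (by omega) rfl).congr rfl ?_ (by simp)
      rw [update_stk (by simp)]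
      simp only [List.set_cons_succ, List.set_cons_zero]
      rw [update_stk (by simp)]
      simp [stk]
    have h := each_runs_cons (k := 4) (l := tally m)
      (s := stk [a₀, a₁, a₂, a₃, tally (m + 1), [], [], a₇, a₈, a₉]) rfl
      (seq_runs l1 (seq_runs l2 (seq_runs l3 l4))) (ih (some b :: a₉))
    refine h.congr (by rw [hm]) ?_ ?_
    · rw [Nat.bits_append_bit _ _ hq]
      simp
    · rw [hm]
      have h1 : q ≤ m := by omega
      have h2 : (q + 1) * (10 * q + 10) ≤ (m + 1) * (10 * (m + 1) + 10) :=
        Nat.mul_le_mul (by omega) (by omega)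
      rw [Nat.succ_mul (m + 1)]
      omega

/-- Prepend the encoding of the number on stack `4` to the output. -/
def emit : Program := (push 1 none).seq (toBits.seq (move 9 1))

theorem emit_runs (m : ℕ) (l : List ℕ) :
    emit.Runs (stk [a₀, encodeNats l, a₂, a₃, tally m, [], [], a₇, a₈, []])
      ((m + 1) * (10 * m + 10) + 4 * m + 4)
      (stk [a₀, encodeNats (m :: l), a₂, a₃, [], [], [], a₇, a₈, []]) := by
  have l1 : (push 1 none).Runs (stk [a₀, encodeNats l, a₂, a₃, tally m, [], [], a₇, a₈, []]) 1
      (stk [a₀, none :: encodeNats l, a₂, a₃, tally m, [], [], a₇, a₈, []]) := by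
    refine (push_runs 1 none _).congr rfl ?_ le_rfl
    rw [update_stk (by simp)]
    rfl
  have l2 := toBits_runs (a₀ := a₀) (a₁ := none :: encodeNats l) (a₂ := a₂) (a₃ := a₃) (a₇ := a₇)
    (a₈ := a₈) m []
  rw [List.append_nil] at l2
  have l3 := move_runs (k := 9) (d := 1) (by omega) (l := (m.bits.map some).reverse)
    (s := stk [a₀, none :: encodeNats l, a₂, a₃, [], [], [], a₇, a₈, (m.bits.map some).reverse])
    rfl
  refine (seq_runs l1 (seq_runs l2 l3)).congr rfl ?_ ?_
  · rw [update_stk (by simp)]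
    simp only [List.set_cons_succ, List.set_cons_zero]
    rw [update_stk (by simp), encodeNats_cons]
    simp [stk]
  · have h1 := two_pow_length_bits_le m
    have h2 : m.bits.length < 2 ^ m.bits.length := Nat.lt_two_pow_self
    simp only [List.length_reverse, List.length_map]
    omega

/-- The values of the variables for a function of three arguments. -/
def env₃ (a b c : ℕ) : ℕ → ℕ :=
  fun x => if x = 0 then a else if x = 1 then b else if x = 2 then c else 0

/-- The stacks of the variables: `7` and `8` hold the two numbers of the input, `3` holds the loop
counter, and `10` is empty. -/
def inputRegs (x : ℕ) : ℕ := if x = 0 then 7 else if x = 1 then 8 else if x = 2 then 3 else 10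

/-- A map from sequences of the form `n, k, b₁, b₂, …` with `bᵢ ∈ {0, 1}` to sequences of numbers is
computed by a program in polynomial time if the length and the entries of the resulting sequence are
given by functions that can be evaluated. -/
theorem exists_program {e L : List Bool → (ℕ → ℕ) → ℕ} (he : Comp e) (hL : Comp L) :
    ∃ (P : Program) (U : ℕ → ℕ), PolyBdd U ∧ ∀ n k (B : List Bool) M, n ≤ M → k ≤ M →
      B.length ≤ M → P.Runs
        (Function.update (fun _ => []) 0 (encodeNats (n :: k :: B.map Bool.toNat))) (U M)
        (Function.update (fun _ => []) 1 (encodeNats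
          ((List.range (L B (env₃ n k 0))).map fun i => e B (env₃ n k i)))) := by
  obtain ⟨V, T, hV, hT, hv, hp⟩ := hL
  obtain ⟨V', T', hV', hT', hv', hp'⟩ := he
  obtain ⟨P, hP⟩ := hp (fun x => if x = 0 then 7 else if x = 1 then 8 else 10) 11 3
    ⟨by omega, fun x => by split_ifs <;> omega, by omega, by omega,
      fun x => by split_ifs <;> omega⟩
  obtain ⟨P', hP'⟩ := hp' inputRegs 11 4
    ⟨by omega, fun x => by unfold inputRegs; split_ifs <;> omega, by omega, by omega,
      fun x => by unfold inputRegs; split_ifs <;> omega⟩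
  -- the number of steps for reading a number, and for computing and writing an entry
  set N : ℕ → ℕ := fun m => 8 * (2 * m + 1) * (2 * m + 1) + 4 * (2 * m + 1) + 3 with hN
  set W : ℕ → ℕ := fun m => (m + 1) * (10 * m + 10) + 4 * m + 4 with hW
  have hM : PolyBdd fun M => M + V M := PolyBdd.id.add hV
  have h2m : PolyBdd fun m => 2 * m + 1 := ((PolyBdd.const 2).mul .id).add (.const 1)
  have hN' : PolyBdd N :=
    ((((PolyBdd.const 8).mul h2m).mul h2m).add ((PolyBdd.const 4).mul h2m)).add (.const 3)
  have hW' : PolyBdd W := (((PolyBdd.id.add (.const 1)).mul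
    (((PolyBdd.const 10).mul .id).add (.const 10))).add ((PolyBdd.const 4).mul .id)).add (.const 4)
  have hNmono {a b : ℕ} (h : a ≤ b) : N a ≤ N b := by
    have := Nat.mul_le_mul (Nat.mul_le_mul_left 8 (show 2 * a + 1 ≤ 2 * b + 1 by omega))
      (show 2 * a + 1 ≤ 2 * b + 1 by omega)
    simp only [hN]
    omega
  have hWmono {a b : ℕ} (h : a ≤ b) : W a ≤ W b := by
    have := Nat.mul_le_mul (show a + 1 ≤ b + 1 by omega)
      (show 10 * a + 10 ≤ 10 * b + 10 by omega)
    simp only [hW]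
    omega
  refine ⟨(readNat 7).seq ((readNat 8).seq (readBoolList.seq (P.seq ((each 3 fun _ =>
    P'.seq emit).seq ((clear 2).seq ((clear 7).seq (clear 8))))))),
    fun M => N M + (N M + ((5 * M + 2) + (T M + ((V M * (T' (M + V M) + W (V' (M + V M)) + 1) + 1) +
      ((M + 1) + ((M + 1) + (M + 1))))))), ?_, ?_⟩
  · exact hN'.add (hN'.add ((((PolyBdd.const 5).mul .id).add (.const 2)).add (hT.add
      (((hV.mul (((hT'.comp hM).add (hW'.comp (hV'.comp hM))).add (.const 1))).add (.const 1)).add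
        ((PolyBdd.id.add (.const 1)).add ((PolyBdd.id.add (.const 1)).add
          (PolyBdd.id.add (.const 1))))))))
  intro n k B M hn hk hB
  set l := L B (env₃ n k 0) with hl
  have henv : ∀ x, env₃ n k 0 x ≤ M := fun x => by unfold env₃; split_ifs <;> omega
  have hlV : l ≤ V M := hv B _ M hB henv
  have e0 : (Function.update (fun _ => []) 0 (encodeNats (n :: k :: B.map Bool.toNat)) : Stk) =
      stk [encodeNats (n :: k :: B.map Bool.toNat), [], [], [], [], [], [], [], [], []] := by
    funext j
    rcases j with _ | _ | _ | _ | _ | _ | _ | _ | _ | _ | j <;> rfl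
  have e1 (x : List Sym) : (Function.update (fun _ => []) 1 x : Stk) =
      stk [[], x, [], [], [], [], [], [], [], []] := by
    funext j
    rcases j with _ | _ | _ | _ | _ | _ | _ | _ | _ | _ | j <;> rfl
  rw [e0, e1]
  have l1 := readNat_runs 7 (by omega) n (encodeNats (k :: B.map Bool.toNat))
    (stk [encodeNats (n :: k :: B.map Bool.toNat), [], [], [], [], [], [], [], [], []])
    (encodeNats_cons _ _) rfl rfl rfl
  rw [update_stk (by simp)] at l1
  simp only [List.set_cons_zero] at l1
  rw [update_stk (by simp)] at l1
  simp only [List.set_cons_succ, List.set_cons_zero] at l1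
  have l2 := readNat_runs 8 (by omega) k (encodeNats (B.map Bool.toNat))
    (stk [encodeNats (k :: B.map Bool.toNat), [], [], [], [], [], [], tally n, [], []])
    (encodeNats_cons _ _) rfl rfl rfl
  rw [update_stk (by simp)] at l2
  simp only [List.set_cons_zero] at l2
  rw [update_stk (by simp)] at l2
  simp only [List.set_cons_succ, List.set_cons_zero] at l2
  have l3 := readBoolList_runs B
    (stk [encodeNats (B.map Bool.toNat), [], [], [], [], [], [], tally n, tally k, []]) rfl rfl rfl
  rw [update_stk (by simp)] at l3
  simp only [List.set_cons_zero] at l3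
  rw [update_stk (by simp)] at l3
  simp only [List.set_cons_succ, List.set_cons_zero] at l3
  have hclean {c : List (List Sym)} (hc : c.length = 10) (j : ℕ) (hj : 10 ≤ j) : stk c j = [] := by
    unfold stk
    rw [List.getD_eq_default _ _ (by omega)]
  have l4 := hP B (env₃ n k 0) (stk [[], [], B.map some, [], [], [], [], tally n, tally k, []]) M hB
    henv ⟨rfl, fun x => by
      unfold env₃
      split_ifs
      · rfl
      · rfl
      · exact hclean rfl _ le_rfl
      · exact hclean rfl _ le_rfl, fun j hj => hclean rfl _ (by omega)⟩
  rw [update_stk (by simp)] at l4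
  simp only [List.set_cons_succ, List.set_cons_zero] at l4
  have l5 := each_runs_tally (k := 3) (p := fun _ => P'.seq emit)
    (t := T' (M + V M) + W (V' (M + V M)))
    (fun i => stk [[], encodeNats (((List.range l).drop (l - i)).map fun i => e B (env₃ n k i)),
      B.map some, tally (l - i), [], [], [], tally n, tally k, []]) l (fun i hi => rfl)
    (fun i hi => by
      rw [update_stk (by simp)]
      simp only [List.set_cons_succ, List.set_cons_zero]
      have henv' : ∀ x, env₃ n k (l - (i + 1)) x ≤ M + V M := fun x => by
        unfold env₃; split_ifs <;> omega
      have m1 := hP' B (env₃ n k (l - (i + 1))) (stk [[], encodeNats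
        (((List.range l).drop (l - i)).map fun i => e B (env₃ n k i)),
        B.map some, tally (l - (i + 1)), [], [], [], tally n, tally k, []]) (M + V M) (by omega)
        henv' ⟨rfl, fun x => by
          unfold env₃ inputRegs
          split_ifs
          · rfl
          · rfl
          · rfl
          · exact hclean rfl _ le_rfl, fun j hj => hclean rfl _ (by omega)⟩
      rw [update_stk (by simp)] at m1
      simp only [List.set_cons_succ, List.set_cons_zero] at m1
      have m2 := emit_runs (a₀ := []) (a₂ := B.map some) (a₃ := tally (l - (i + 1)))
        (a₇ := tally n) (a₈ := tally k) (e B (env₃ n k (l - (i + 1))))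
        (((List.range l).drop (l - i)).map fun i => e B (env₃ n k i))
      have hle := hWmono (hv' B _ (M + V M) (by omega) henv')
      refine (seq_runs m1 (m2.congr ?_ rfl hle)).congr rfl ?_ le_rfl
      · simp [stk]
      · rw [List.drop_eq_getElem_cons (show l - (i + 1) < (List.range l).length by simp; omega),
          List.getElem_range, List.map_cons, show l - (i + 1) + 1 = l - i by omega])
  have c2 := clear_runs (k := 2) (l := B.map some) (s := stk [[], encodeNats (((List.range l).drop
    (l - l)).map fun i => e B (env₃ n k i)), B.map some, tally (l - l), [], [], [], tally n,
    tally k, []]) rfl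
  rw [update_stk (by simp)] at c2
  simp only [List.set_cons_succ, List.set_cons_zero] at c2
  have c7 := clear_runs (k := 7) (l := tally n) (s := stk [[], encodeNats (((List.range l).drop
    (l - l)).map fun i => e B (env₃ n k i)), [], tally (l - l), [], [], [], tally n,
    tally k, []]) rfl
  rw [update_stk (by simp)] at c7
  simp only [List.set_cons_succ, List.set_cons_zero] at c7
  have c8 := clear_runs (k := 8) (l := tally k) (s := stk [[], encodeNats (((List.range l).drop
    (l - l)).map fun i => e B (env₃ n k i)), [], tally (l - l), [], [], [], [],
    tally k, []]) rfl
  rw [update_stk (by simp)] at c8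
  simp only [List.set_cons_succ, List.set_cons_zero] at c8
  refine (seq_runs l1 (seq_runs l2 (seq_runs l3 (seq_runs l4 (seq_runs (l5.congr ?_ rfl le_rfl)
    (seq_runs c2 (seq_runs c7 c8))))))).congr rfl ?_ ?_
  · rw [Nat.sub_zero, List.drop_of_length_le (by simp)]
    simp [stk, encodeNats, hl]
  · simp
  · have h1 := hNmono hn
    have h2 := hNmono hk
    have h3 := Nat.mul_le_mul_right (T' (M + V M) + W (V' (M + V M)) + 1) hlV
    simp only [tally_length, List.length_map]
    simp only [hN] at h1 h2 ⊢
    omega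

end StackProg

/-! ### The costs of the network -/

namespace SharingGadget

/-- The scale of the costs. If a direct facility loses some, but not all movable players, then the
potential grows by at least `3 * scale K / K ^ 2`, up to rounding errors. This has to exceed the
rounding errors of `K` complete moves, which are of order `K ^ 3`. -/
def scale (K : ℕ) : ℕ := 2 * K ^ 5

/-- The rounded-down value of `scale K * (1 / 2 + 1 / 3 + ⋯ + 1 / K)`. -/
def roundedSum (K : ℕ) : ℕ := ∑ i ∈ Finset.range (K - 1), scale K / (i + 2)

/-- The cost of opening a direct facility. -/
def directCost (K : ℕ) : ℕ := 3 * (K - 1) * scale K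

/-- The cost of opening a shared facility. If `roundedSum K - 1` was replaced by the exact value of
`scale K * (1 / 2 + ⋯ + 1 / K)`, then a complete move would leave the potential unchanged. -/
def sharedCost (K : ℕ) : ℕ := 4 * (roundedSum K - 1)

/-- The change of the potential caused by a direct facility that keeps `m` of its `K` players, if
all shared facilities were used by two players each. -/
def gap (K m : ℕ) : ℚ :=
  3 / 4 * sharedCost K * (K - m) - directCost K * (harmonic K - harmonic m)

/-- Each of the summands `1 / 2, …, 1 / m` is at least `1 / m`. -/
theorem harmonic_lower {m : ℕ} (hm : 1 ≤ m) : ((m : ℚ) - 1) / m ≤ harmonic m - 1 := by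
  induction m, hm using Nat.le_induction with
  | base => simp [harmonic]
  | succ m hm ih =>
    have h0 : (0 : ℚ) < m := by exact_mod_cast hm
    rw [harmonic_succ]
    push_cast
    have h1 : (1 : ℚ) ≤ m := by exact_mod_cast hm
    have h2 : ((m : ℚ) - 1) / m + (m + 1 : ℚ)⁻¹ - (m + 1 - 1) / (m + 1) =
        (m - 1) / (m * (m + 1)) := by
      field_simp
      ring
    have h3 : (0 : ℚ) ≤ (m - 1) / (m * (m + 1)) := div_nonneg (by linarith) (by positivity)
    linarith

/-- Each of the summands `1 / (m + 1), …, 1 / K` is at most `1 / (m + 1)`. -/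
theorem harmonic_sub_upper {m K : ℕ} (h : m ≤ K) :
    harmonic K - harmonic m ≤ ((K : ℚ) - m) / (m + 1) := by
  induction K, h using Nat.le_induction with
  | base => simp
  | succ K h ih =>
    have h1 : ((K : ℚ) + 1)⁻¹ ≤ ((m : ℚ) + 1)⁻¹ :=
      inv_anti₀ (by positivity) (by exact_mod_cast Nat.succ_le_succ h)
    rw [harmonic_succ]
    push_cast
    rw [show ((K : ℚ) + 1 - m) / (m + 1) = (K - m) / (m + 1) + (m + 1 : ℚ)⁻¹ by
      field_simp; ring]
    linarith

/-- The rounding errors add up to less than `K`. -/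
theorem roundedSum_bounds {K : ℕ} (hK : 1 ≤ K) :
    (roundedSum K : ℚ) ≤ scale K * (harmonic K - 1) ∧
      scale K * (harmonic K - 1) ≤ roundedSum K + (K - 1) := by
  obtain ⟨q, rfl⟩ := Nat.exists_eq_add_of_le' hK
  have h : (scale (q + 1) : ℚ) * (harmonic (q + 1) - 1) =
      ∑ i ∈ Finset.range q, (scale (q + 1) : ℚ) / (i + 2) := by
    rw [harmonic, Finset.sum_range_succ']
    simp only [Nat.cast_add, Nat.cast_one, zero_add, inv_one, add_sub_cancel_right,
      Finset.mul_sum, div_eq_mul_inv]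
    exact Finset.sum_congr rfl fun i _ => by rw [add_assoc, one_add_one_eq_two]
  rw [h, roundedSum, Nat.add_sub_cancel]
  push_cast
  constructor
  · exact Finset.sum_le_sum fun i _ => by exact_mod_cast Nat.cast_div_le
  · rw [add_sub_cancel_right, show (q : ℚ) = ∑ i ∈ Finset.range q, (1 : ℚ) by simp,
      ← Finset.sum_add_distrib]
    refine Finset.sum_le_sum fun i _ => ?_
    rw [div_le_iff₀ (by positivity)]
    have := Nat.lt_mul_div_succ (scale (q + 1)) (show 0 < i + 2 by omega)
    have : (scale (q + 1) : ℚ) < (i + 2) * ((scale (q + 1) / (i + 2) : ℕ) + 1) := by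
      exact_mod_cast this
    linarith

theorem pow_le_roundedSum {K : ℕ} (hK : 2 ≤ K) : K ^ 5 ≤ roundedSum K := by
  refine le_trans ?_ (Finset.single_le_sum (f := fun i => scale K / (i + 2))
    (fun i _ => Nat.zero_le _) (Finset.mem_range.mpr (show 0 < K - 1 by omega)))
  simp [scale]

/-- The amount by which the potential decreases if a direct facility keeps one player only, and all
shared facilities are used by two players each. -/
def gain (K : ℕ) : ℚ := -gap K 1

theorem gain_eq {K : ℕ} (hK : 2 ≤ K) :
    gain K = 3 * (K - 1) * (scale K * (harmonic K - 1) - roundedSum K + 1) := by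
  have h1 : 1 ≤ roundedSum K := (Nat.one_le_pow _ _ (by omega)).trans (pow_le_roundedSum hK)
  have h2 : harmonic 1 = 1 := by simp [harmonic]
  simp only [gain, gap, sharedCost, directCost, h2]
  push_cast [Nat.cast_sub h1, Nat.cast_sub (show 1 ≤ K by omega)]
  ring

theorem gain_pos {K : ℕ} (hK : 2 ≤ K) : 0 < gain K := by
  rw [gain_eq hK]
  have h1 := (roundedSum_bounds (show 1 ≤ K by omega)).1
  have h2 : (2 : ℚ) ≤ K := by exact_mod_cast hK
  exact mul_pos (by linarith) (by linarith)

theorem gain_le {K : ℕ} (hK : 2 ≤ K) : gain K ≤ 3 * (K - 1) * K := by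
  rw [gain_eq hK]
  have h1 := (roundedSum_bounds (show 1 ≤ K by omega)).2
  have h2 : (2 : ℚ) ≤ K := by exact_mod_cast hK
  exact mul_le_mul_of_nonneg_left (by linarith) (by linarith)

/-- A shared facility with a single user costs more than what all complete moves together gain. -/
theorem mul_gain_le_sharedCost {K : ℕ} (hK : 2 ≤ K) : K * gain K ≤ sharedCost K / 4 := by
  have h1 : 1 ≤ roundedSum K := (Nat.one_le_pow _ _ (by omega)).trans (pow_le_roundedSum hK)
  have h2 : (2 : ℚ) ≤ K := by exact_mod_cast hK
  have h3 : (K : ℚ) ^ 5 ≤ roundedSum K := by exact_mod_cast pow_le_roundedSum hK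
  simp only [sharedCost]
  push_cast [Nat.cast_sub h1]
  have h4 : (K : ℚ) * gain K ≤ K * (3 * (K - 1) * K) :=
    mul_le_mul_of_nonneg_left (gain_le hK) (by linarith)
  have h5 : (0 : ℚ) ≤ K ^ 3 * (K ^ 2 - 2 ^ 2) :=
    mul_nonneg (by positivity) (sub_nonneg.mpr (pow_le_pow_left₀ (by norm_num) h2 2))
  have h6 : (2 : ℚ) ^ 3 ≤ K ^ 3 := pow_le_pow_left₀ (by norm_num) h2 3
  nlinarith

/-- Moving some, but not all movable players away from a direct facility loses more than what all
complete moves together gain. -/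
theorem mul_gain_le_gap {K m : ℕ} (hm : 2 ≤ m) (hmK : m < K) : K * gain K ≤ gap K m := by
  have hK : 2 ≤ K := by omega
  have h1 : 1 ≤ roundedSum K := (Nat.one_le_pow _ _ (by omega)).trans (pow_le_roundedSum hK)
  have hX := harmonic_lower (show 1 ≤ m by omega)
  have hY := harmonic_sub_upper hmK.le
  have hA := roundedSum_bounds (show 1 ≤ K by omega)
  rw [gain_eq hK]
  simp only [gap, sharedCost, directCost]
  push_cast [Nat.cast_sub h1, Nat.cast_sub (show 1 ≤ K by omega)]
  have hS : (scale K : ℚ) = 2 * K ^ 5 := by simp [scale]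
  set X := harmonic m - 1 with hXd
  set Y := harmonic K - harmonic m with hYd
  have hXY : harmonic K - 1 = X + Y := by rw [hXd, hYd]; ring
  set t : ℚ := scale K * (harmonic K - 1) - roundedSum K with ht
  have hr : (roundedSum K : ℚ) = scale K * (X + Y) - t := by rw [ht, hXY]; ring
  rw [hr]
  obtain ⟨a, rfl⟩ := Nat.exists_eq_add_of_le' (show 1 ≤ m by omega)
  obtain ⟨b, rfl⟩ := Nat.exists_eq_add_of_lt hmK
  have ha : (1 : ℚ) ≤ a := by exact_mod_cast (show 1 ≤ a by omega)
  have hb : (0 : ℚ) ≤ b := by positivity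
  push_cast at *
  set k : ℚ := (a : ℚ) + 1 + b + 1 with hk
  have ht0 : t + 1 ≤ k := by linarith [hA.2]
  have ht1 : 0 ≤ t + 1 := by linarith [hA.1]
  -- the average saving per player is strictly larger if all players leave
  have hδ : 1 / k ^ 2 ≤ (b + 1) * X - a * Y := by
    have e1 : (b + 1) * (((a : ℚ) + 1 - 1) / (a + 1)) ≤ (b + 1) * X :=
      mul_le_mul_of_nonneg_left hX (by linarith)
    have e2 : (a : ℚ) * Y ≤ a * ((k - (a + 1)) / (a + 1 + 1)) :=
      mul_le_mul_of_nonneg_left hY (by linarith)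
    have e3 : (b + 1) * (((a : ℚ) + 1 - 1) / (a + 1)) - a * ((k - (a + 1)) / (a + 1 + 1)) =
        a * (b + 1) / ((a + 1) * (a + 1 + 1)) := by
      rw [hk]
      field_simp
      ring
    have e4 : 1 / k ^ 2 ≤ a * (b + 1) / ((a + 1) * (a + 1 + 1)) := by
      refine div_le_div₀ (by positivity) (by nlinarith) (by positivity) ?_
      rw [sq]
      exact mul_le_mul (by linarith) (by linarith) (by positivity) (by positivity)
    linarith
  have hk3 : (3 : ℚ) ≤ k := by linarith
  have hscale : 2 * k ^ 3 ≤ scale (a + 1 + b + 1) * ((b + 1) * X - a * Y) := by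
    rw [hS]
    refine le_trans (le_of_eq ?_) (mul_le_mul_of_nonneg_left hδ (by positivity))
    field_simp
  have hfin : (k * (k - 1) + (b + 1)) * (t + 1) ≤ k ^ 3 := by
    calc (k * (k - 1) + (b + 1)) * (t + 1) ≤ (k * k) * k :=
        mul_le_mul (by linarith) ht0 ht1 (by positivity)
      _ = k ^ 3 := by ring
  have hpos : (0 : ℚ) ≤ k ^ 3 := by positivity
  have hk1 : k - 1 = a + (b + 1) := by rw [hk]; ring
  have hk2 : k - (a + 1) = b + 1 := by rw [hk]; ring
  rw [hk2]
  rw [hk1] at hfin ⊢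
  linarith

end SharingGadget

/-! ### The assignment of players to facilities -/

namespace SharingGadget

section Assignment

variable {α : Type} {K : ℕ} {col : α → Fin K} {R : α → α → Prop}
  {φ : α × Fin K → Option (α × α)}

/-- An assignment of the players `(x, j)` to facilities: `none` is the direct facility of `x`, and
`some (x, y)` is the facility that is shared by the players `(x, col y)` and `(y, col x)`. -/
def IsAssignment (col : α → Fin K) (R : α → α → Prop) (φ : α × Fin K → Option (α × α)) : Prop :=
  ∀ p e, φ p = some e → R e.1 e.2 ∧ (p = (e.1, col e.2) ∨ p = (e.2, col e.1))

/-- The number of players in the direct facility of `x`. -/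
def stay (φ : α × Fin K → Option (α × α)) (x : α) : ℕ :=
  (Finset.univ.filter fun j => φ (x, j) = none).card

theorem stay_le (x : α) : stay φ x ≤ K :=
  (Finset.card_filter_le _ _).trans (by simp)

/-- The color of `x` is never the color of a candidate that is compatible with `x`. -/
theorem immobile (hφ : IsAssignment col R φ) (hR : ∀ x y, R x y → col x ≠ col y) (x : α) :
    φ (x, col x) = none := by
  by_contra h
  obtain ⟨e, he⟩ := Option.ne_none_iff_exists'.mp h
  obtain ⟨h1, h2 | h2⟩ := hφ _ _ he
  · simp only [Prod.mk.injEq] at h2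
    exact hR _ _ h1 (h2.1 ▸ h2.2)
  · simp only [Prod.mk.injEq] at h2
    exact hR _ _ h1 (h2.1 ▸ h2.2.symm)

theorem one_le_stay (hφ : IsAssignment col R φ) (hR : ∀ x y, R x y → col x ≠ col y) (x : α) :
    1 ≤ stay φ x :=
  Finset.card_pos.mpr ⟨col x, by simpa using immobile hφ hR x⟩

/-- A set of at most `K` elements that meets each of the `K` fibers meets it only once. -/
theorem eq_of_card_fiber {w : Finset α} {f : α → Fin K} (hw : w.card ≤ K)
    (hf : ∀ i, ∃ x ∈ w, f x = i) {x y : α} (hx : x ∈ w) (hy : y ∈ w) (h : f x = f y) : x = y := by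
  refine Finset.inj_on_of_surj_on_of_card_le (s := w) (t := (Finset.univ : Finset (Fin K)))
    (fun a _ => f a) (fun a _ => Finset.mem_univ _) (fun i _ => ?_) (by simpa using hw) hx hy h
  obtain ⟨x, hx, rfl⟩ := hf i
  exact ⟨x, hx, rfl⟩

variable [Fintype α]

/-- The number of players that are not in a direct facility. -/
def moved (φ : α × Fin K → Option (α × α)) : ℕ :=
  (Finset.univ.filter fun p => φ p ≠ none).card

theorem sum_stay : ∑ x, stay φ x = (Finset.univ.filter fun p => φ p = none).card := by
  simp only [stay, Finset.card_filter]
  rw [Fintype.sum_prod_type]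

theorem sum_stay_add_moved : ∑ x, stay φ x + moved φ = Fintype.card α * K := by
  rw [sum_stay, moved, Finset.card_filter_add_card_filter_not]
  simp

theorem sum_sub_stay : ∑ x, ((K : ℚ) - stay φ x) = moved φ := by
  have h : (∑ x, (stay φ x : ℚ)) + moved φ = Fintype.card α * K := by
    exact_mod_cast sum_stay_add_moved (φ := φ)
  rw [Finset.sum_sub_distrib]
  simp only [Finset.sum_const, Finset.card_univ, nsmul_eq_mul]
  linarith

variable [DecidableEq α]

/-- The number of players in the shared facility `e`. -/
def users (φ : α × Fin K → Option (α × α)) (e : α × α) : ℕ :=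
  (Finset.univ.filter fun p => φ p = some e).card

/-- The potential of an assignment. -/
def potential (φ : α × Fin K → Option (α × α)) : ℚ :=
  directCost K * ∑ x, harmonic (stay φ x) + sharedCost K * ∑ e, harmonic (users φ e)

theorem users_le_two (hφ : IsAssignment col R φ) (e : α × α) : users φ e ≤ 2 := by
  refine (Finset.card_le_card (t := {(e.1, col e.2), (e.2, col e.1)}) fun p hp => ?_).trans
    Finset.card_le_two
  simpa using (hφ p e (by simpa using hp)).2

theorem sum_users : ∑ e, users φ e = moved φ := by
  have h1 : ∑ o : Option (α × α), (Finset.univ.filter fun p => φ p = o).card =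
      Fintype.card (α × Fin K) :=
    (Finset.card_eq_sum_card_fiberwise (f := φ) (s := Finset.univ) (t := Finset.univ)
      (fun p _ => by simp)).symm
  rw [Fintype.sum_option, ← sum_stay] at h1
  have h2 := sum_stay_add_moved (φ := φ)
  simp only [Fintype.card_prod, Fintype.card_fin] at h1
  simp only [users]
  omega

/-- The potential splits into a contribution of every direct facility, and a penalty for every
shared facility with a single user. -/
theorem potential_eq (hφ : IsAssignment col R φ) :
    potential φ = directCost K * ∑ _x : α, harmonic K + ∑ x, gap K (stay φ x) +
      sharedCost K / 4 * (Finset.univ.filter fun e => users φ e = 1).card := by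
  have h1 : ∀ e, harmonic (users φ e) =
      3 / 4 * users φ e + 1 / 4 * if users φ e = 1 then 1 else 0 := by
    intro e
    have h2 := users_le_two hφ e
    interval_cases users φ e <;> norm_num [harmonic, Finset.sum_range_succ]
  have h3 : (∑ e, (users φ e : ℚ)) = ∑ x, ((K : ℚ) - stay φ x) := by
    rw [sum_sub_stay]
    exact_mod_cast sum_users
  simp only [potential, h1, gap, Finset.sum_add_distrib, Finset.sum_sub_distrib, ← Finset.mul_sum]
  rw [← Finset.sum_sub_distrib, ← h3]
  simp only [Finset.card_filter]
  push_cast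
  ring

/-- The direct facilities that keep one player form a transversal of the colors consisting of
pairwise compatible candidates, if the potential has decreased and at most `K * (K - 1)` players
have moved. -/
theorem exists_transversal (hK : 2 ≤ K) (hsymm : ∀ x y, R x y → R y x)
    (hR : ∀ x y, R x y → col x ≠ col y) (hφ : IsAssignment col R φ)
    (hpot : potential φ < directCost K * ∑ _x : α, harmonic K) (hm : moved φ ≤ K * (K - 1)) :
    ∃ w : Fin K → α, (∀ i, col (w i) = i) ∧ ∀ i j, i ≠ j → R (w i) (w j) := by
  rw [potential_eq hφ] at hpot
  have hg := gain_pos hK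
  have hKq : (2 : ℚ) ≤ K := by exact_mod_cast hK
  set W := Finset.univ.filter fun x => stay φ x = 1 with hW
  set L := Finset.univ.filter fun e => users φ e = 1 with hL
  have hpen : 0 ≤ (sharedCost K : ℚ) / 4 := by positivity
  -- the movable players of the candidates in `W` have moved
  have hcard : W.card ≤ K := by
    have h1 : ∑ x ∈ W, ((K : ℚ) - stay φ x) ≤ ∑ x, ((K : ℚ) - stay φ x) :=
      Finset.sum_le_sum_of_subset_of_nonneg (Finset.subset_univ _) fun x _ _ => by
        have : (stay φ x : ℚ) ≤ K := by exact_mod_cast stay_le x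
        linarith
    rw [Finset.sum_congr rfl (g := fun _ => (K : ℚ) - 1) fun x hx => by
      rw [(Finset.mem_filter.mp hx).2, Nat.cast_one], sum_sub_stay] at h1
    have h2 : (moved φ : ℚ) ≤ K * (K - 1) := by
      rw [← Nat.cast_pred (by omega)]
      exact_mod_cast hm
    simp only [Finset.sum_const, nsmul_eq_mul] at h1
    have h3 : (W.card : ℚ) * (K - 1) ≤ K * (K - 1) := h1.trans h2
    exact_mod_cast le_of_mul_le_mul_right h3 (by linarith)
  have hgap : ∀ x, stay φ x ≠ 1 → 0 ≤ gap K (stay φ x) := by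
    intro x hx
    have h1 := one_le_stay hφ hR x
    rcases (stay_le (φ := φ) x).eq_or_lt with h2 | h2
    · rw [h2]; simp [gap]
    · exact (mul_nonneg (by linarith) hg.le).trans (mul_gain_le_gap (by omega) h2)
  have hsplit : ∑ x, gap K (stay φ x) =
      -(W.card * gain K) + ∑ x ∈ Finset.univ.filter fun x => stay φ x ≠ 1, gap K (stay φ x) := by
    rw [← Finset.sum_filter_add_sum_filter_not Finset.univ fun x => stay φ x = 1]
    congr 1
    rw [Finset.sum_congr rfl (g := fun _ => -gain K) fun x hx => by
      rw [(Finset.mem_filter.mp hx).2, gain, neg_neg]]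
    simp [hW]
  have hrest : 0 ≤ ∑ x ∈ Finset.univ.filter fun x => stay φ x ≠ 1, gap K (stay φ x) :=
    Finset.sum_nonneg fun x hx => hgap x (Finset.mem_filter.mp hx).2
  have hWK : (W.card : ℚ) * gain K ≤ K * gain K :=
    mul_le_mul_of_nonneg_right (by exact_mod_cast hcard) hg.le
  have hLempty : ∀ e, users φ e ≠ 1 := by
    intro e he
    have h1 : (1 : ℚ) ≤ L.card := by
      exact_mod_cast Finset.card_pos.mpr ⟨e, by simpa [hL] using he⟩
    have h2 := mul_le_mul_of_nonneg_left h1 hpen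
    have h3 := mul_gain_le_sharedCost hK
    linarith
  have hstay : ∀ x, stay φ x = 1 ∨ stay φ x = K := by
    intro x
    by_contra! h
    have h1 := one_le_stay hφ hR x
    have h2 := mul_gain_le_gap (show 2 ≤ stay φ x by omega) (lt_of_le_of_ne (stay_le x) h.2)
    have h3 := Finset.single_le_sum (f := fun x => gap K (stay φ x))
      (fun x hx => hgap x (Finset.mem_filter.mp hx).2)
      (Finset.mem_filter.mpr ⟨Finset.mem_univ x, h.1⟩)
    have h4 : 0 ≤ (sharedCost K : ℚ) / 4 * L.card := by positivity
    linarith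
  have hne : W.Nonempty := by
    rw [Finset.nonempty_iff_ne_empty]
    intro h
    have h4 : 0 ≤ (sharedCost K : ℚ) / 4 * L.card := by positivity
    rw [hsplit, h] at hpot
    simp only [Finset.card_empty, Nat.cast_zero, zero_mul, neg_zero] at hpot
    linarith
  have hnone : ∀ x j, j ≠ col x → φ (x, j) = none → x ∉ W := by
    intro x j hj h hx
    have h1 : stay φ x = 1 := (Finset.mem_filter.mp hx).2
    obtain ⟨i, hi⟩ := Finset.card_eq_one.mp h1
    have e1 : j ∈ ({i} : Finset (Fin K)) := hi ▸ by simpa using h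
    have e2 : col x ∈ ({i} : Finset (Fin K)) := hi ▸ by simpa using immobile hφ hR x
    rw [Finset.mem_singleton] at e1 e2
    exact hj (e1.trans e2.symm)
  have hmem : ∀ x j e, φ (x, j) = some e → x ∈ W := by
    intro x j e he
    rcases hstay x with h | h
    · simpa [hW] using h
    · exfalso
      have h1 : (Finset.univ.filter fun j => φ (x, j) = none) = Finset.univ :=
        Finset.eq_univ_of_card _ (by rw [Fintype.card_fin]; exact h)
      have h2 : j ∈ Finset.univ.filter fun j => φ (x, j) = none := by
        rw [h1]
        exact Finset.mem_univ j
      rw [(Finset.mem_filter.mp h2).2] at he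
      exact absurd he (by simp)
  -- the second user of a shared facility
  have hpartner : ∀ x ∈ W, ∀ j, j ≠ col x → ∃ y ∈ W, col y = j ∧ R x y := by
    intro x hx j hj
    obtain ⟨e, he⟩ := Option.ne_none_iff_exists'.mp fun h => hnone x j hj h hx
    have h1 : 1 < users φ e := by
      have : 0 < users φ e := Finset.card_pos.mpr ⟨(x, j), by simpa using he⟩
      have := hLempty e
      omega
    obtain ⟨p, hp, hpx⟩ := Finset.exists_mem_ne h1 (x, j)
    have hp' : φ p = some e := by simpa using hp
    obtain ⟨r, h2⟩ := hφ _ _ he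
    obtain ⟨-, h3⟩ := hφ _ _ hp'
    rcases h2 with h2 | h2 <;> rcases h3 with h3 | h3
    · exact absurd (h3.trans h2.symm) hpx
    · simp only [Prod.mk.injEq] at h2
      rw [h3] at hp'
      exact ⟨e.2, hmem _ _ _ hp', h2.2.symm, h2.1 ▸ r⟩
    · simp only [Prod.mk.injEq] at h2
      rw [h3] at hp'
      exact ⟨e.1, hmem _ _ _ hp', h2.2.symm, h2.1 ▸ hsymm _ _ r⟩
    · exact absurd (h3.trans h2.symm) hpx
  obtain ⟨x₀, hx₀⟩ := hne
  have hsurj : ∀ i, ∃ x ∈ W, col x = i := by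
    intro i
    by_cases h : i = col x₀
    · exact ⟨x₀, hx₀, h.symm⟩
    · obtain ⟨y, hy, h1, -⟩ := hpartner x₀ hx₀ i h
      exact ⟨y, hy, h1⟩
  choose w hwW hw using hsurj
  refine ⟨w, hw, fun i j hij => ?_⟩
  obtain ⟨y, hy, h1, h2⟩ := hpartner (w i) (hwW i) j (by rw [hw]; exact hij.symm)
  rwa [eq_of_card_fiber hcard (fun i => ⟨w i, hwW i, hw i⟩) (hwW j) hy ((hw j).trans h1.symm)]

/-- The assignment given by a transversal `w`: the players of every candidate of `w` share the
facilities with the other candidates of `w`. -/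
def ofTransversal (col : α → Fin K) (w : Fin K → α) (p : α × Fin K) : Option (α × α) :=
  if w (col p.1) = p.1 ∧ p.2 ≠ col p.1 then
    some (if col p.1 < p.2 then (p.1, w p.2) else (w p.2, p.1))
  else none

/-- The converse of `exists_transversal`. -/
theorem exists_assignment (hK : 2 ≤ K) {w : Fin K → α} (hw : ∀ i, col (w i) = i)
    (hwR : ∀ i j, i ≠ j → R (w i) (w j)) :
    IsAssignment col R (ofTransversal col w) ∧
      potential (ofTransversal col w) < directCost K * ∑ _x : α, harmonic K ∧
      moved (ofTransversal col w) ≤ K * (K - 1) := by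
  set φ := ofTransversal col w with hφd
  have hφ : IsAssignment col R φ := by
    rintro ⟨x, j⟩ e he
    simp only [hφd, ofTransversal] at he
    split_ifs at he with h1 h2
    · obtain rfl := Option.some.inj he
      refine ⟨?_, Or.inl (by rw [hw])⟩
      have := hwR _ _ h1.2.symm
      rwa [h1.1] at this
    · obtain rfl := Option.some.inj he
      refine ⟨?_, Or.inr (by rw [hw])⟩
      have := hwR _ _ h1.2
      rwa [h1.1] at this
  have hstay : ∀ x, stay φ x = if w (col x) = x then 1 else K := by
    intro x
    split_ifs with h
    · refine Finset.card_eq_one.mpr ⟨col x, ?_⟩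
      ext j
      simp [hφd, ofTransversal, h]
    · simp [stay, hφd, ofTransversal, h]
  have husers : ∀ e, users φ e ≠ 1 := by
    intro e he
    obtain ⟨⟨x, j⟩, hp⟩ := Finset.card_eq_one.mp he
    have hφp : φ (x, j) = some e := by
      have : (x, j) ∈ Finset.univ.filter fun p => φ p = some e := hp ▸ Finset.mem_singleton_self _
      simpa using this
    obtain ⟨h1, h2⟩ : w (col x) = x ∧ j ≠ col x := by
      by_contra h
      simp [hφd, ofTransversal, h] at hφp
    have hφp' : φ (w j, col x) = some e := by
      rw [← hφp]
      rcases lt_or_gt_of_ne h2 with h3 | h3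
      · simp [hφd, ofTransversal, h1, hw, h2, h2.symm, h3, h3.not_gt]
      · simp [hφd, ofTransversal, h1, hw, h2, h2.symm, h3, h3.not_gt]
    have h3 : (w j, col x) ∈ ({(x, j)} : Finset (α × Fin K)) := hp ▸ by simpa using hφp'
    rw [Finset.mem_singleton, Prod.mk.injEq] at h3
    exact h2 h3.2.symm
  refine ⟨hφ, ?_, ?_⟩
  · rw [potential_eq hφ]
    have h1 : (Finset.univ.filter fun e => users φ e = 1) = ∅ := by simp [husers]
    have h2 : ∑ x, gap K (stay φ x) < 0 := by
      have h3 : gap K 1 < 0 := by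
        have := gain_pos hK
        rwa [gain, neg_pos] at this
      refine Finset.sum_neg' (fun x _ => ?_) ⟨w ⟨0, by omega⟩, Finset.mem_univ _, ?_⟩
      · rw [hstay]
        split_ifs
        · exact h3.le
        · simp [gap]
      · rwa [hstay, hw, if_pos rfl]
    rw [h1]
    simpa using h2
  · have h1 : (moved φ : ℚ) = ∑ x, if w (col x) = x then (K : ℚ) - 1 else 0 := by
      rw [← sum_sub_stay]
      refine Finset.sum_congr rfl fun x _ => ?_
      rw [hstay]
      split_ifs <;> simp
    rw [← Finset.sum_filter, Finset.sum_const, nsmul_eq_mul, ← Nat.cast_pred (by omega)] at h1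
    have h2 : (Finset.univ.filter fun x => w (col x) = x).card ≤ K := by
      refine (Finset.card_le_card (t := Finset.univ.image w) fun x hx => ?_).trans
        (Finset.card_image_le.trans (by simp))
      exact Finset.mem_image.mpr ⟨col x, Finset.mem_univ _, (Finset.mem_filter.mp hx).2⟩
    have h3 : moved φ = (Finset.univ.filter fun x => w (col x) = x).card * (K - 1) := by
      exact_mod_cast h1
    rw [h3]
    exact Nat.mul_le_mul_right _ h2

end Assignment

end SharingGadget

/-! ### Two-level networks -/

namespace Multicast

/-- Every arc leads from the root to a facility, or from a facility to a terminal. The arcs from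
facilities to terminals are for free. -/
structure IsTwoLevel {V : Type} (cost : V → V → Option ℚ≥0) (r : V) (Fac Term : V → Prop) :
    Prop where
  arc : ∀ u v, cost u v ≠ none → u = r ∧ Fac v ∨ Fac u ∧ Term v
  root_not_fac : ¬ Fac r
  root_not_term : ¬ Term r
  fac_not_term : ∀ v, Fac v → ¬ Term v
  free : ∀ u v, u ≠ r → (cost u v).getD 0 = 0

namespace IsTwoLevel

variable {V : Type} {cost : V → V → Option ℚ≥0} {r : V} {Fac Term : V → Prop}

/-- All paths from the root to a terminal lead through exactly one facility. -/
theorem exists_verts_eq (h : IsTwoLevel cost r Fac Term) {t : V} (ht : Term t)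
    (p : DiPath (digraphOfCost cost) r t) :
    ∃ f, Fac f ∧ cost f t ≠ none ∧ p.verts = [r, f, t] := by
  obtain ⟨l, hc, -, hh, hl⟩ := p
  match l, hc, hh, hl with
  | [a], hc, hh, hl =>
    simp only [List.head?_cons, Option.some.injEq] at hh
    simp only [List.getLast?_singleton, Option.some.injEq] at hl
    subst hh hl
    exact absurd ht h.root_not_term
  | [a, b], hc, hh, hl =>
    simp only [List.head?_cons, Option.some.injEq] at hh
    simp only [List.getLast?_cons_cons, List.getLast?_singleton, Option.some.injEq] at hl
    subst hh hl
    have h1 : cost a b ≠ none := by simpa [digraphOfCost] using hc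
    rcases h.arc _ _ h1 with h2 | h2
    · exact absurd ht (h.fac_not_term _ h2.2)
    · exact absurd h2.1 h.root_not_fac
  | [a, b, c], hc, hh, hl =>
    simp only [List.head?_cons, Option.some.injEq] at hh
    simp only [List.getLast?_cons_cons, List.getLast?_singleton, Option.some.injEq] at hl
    subst hh hl
    have h1 : cost a b ≠ none ∧ cost b c ≠ none := by simpa [digraphOfCost] using hc
    rcases h.arc _ _ h1.1 with h2 | h2
    · exact ⟨b, h2.2, h1.2, rfl⟩
    · exact absurd h2.1 h.root_not_fac
  | a :: b :: c :: d :: l, hc, hh, hl =>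
    simp only [List.head?_cons, Option.some.injEq] at hh
    subst hh
    have h1 : cost a b ≠ none ∧ cost b c ≠ none ∧ cost c d ≠ none := by
      simp only [List.isChain_cons_cons] at hc
      exact ⟨hc.1, hc.2.1, hc.2.2.1⟩
    rcases h.arc _ _ h1.1 with h2 | h2
    · rcases h.arc _ _ h1.2.1 with h3 | h3
      · exact absurd (h3.1 ▸ h2.2) h.root_not_fac
      · rcases h.arc _ _ h1.2.2 with h4 | h4
        · exact absurd (h4.1 ▸ h3.2) h.root_not_term
        · exact absurd h3.2 (h.fac_not_term _ h4.1)
    · exact absurd h2.1 h.root_not_fac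

/-- The potential of a profile depends on the numbers of players in the facilities only. -/
theorem potential_eq [Fintype V] [DecidableEq V] (h : IsTwoLevel cost r Fac Term) {l : ℕ}
    {t : Fin l → V} (s : Profile (digraphOfCost cost) r t) {F : Fin l → V}
    (hF : ∀ i, Fac (F i)) (hs : ∀ i, (s i).verts = [r, F i, t i]) :
    s.potential (fun e m => (((cost e.1 e.2).getD 0 : ℚ≥0) : ℝ) / (m : ℝ)) =
      ((∑ v, ((cost r v).getD 0 : ℚ) * harmonic (Finset.univ.filter fun i => F i = v).card : ℚ) :
        ℝ) := by
  have hterm : ∀ e : V × V, ∑ m ∈ Finset.Icc 1 (s.usage e),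
      (((cost e.1 e.2).getD 0 : ℚ≥0) : ℝ) / (m : ℝ) =
      ((((cost e.1 e.2).getD 0 : ℚ) * harmonic (s.usage e) : ℚ) : ℝ) := by
    intro e
    rw [harmonic_eq_sum_Icc]
    push_cast
    simp only [div_eq_mul_inv, Finset.mul_sum]
  rw [Profile.potential, Finset.sum_congr rfl fun e _ => hterm e, ← Rat.cast_sum]
  congr 1
  rw [Finset.sum_subset (Finset.subset_univ _) fun e _ he => ?_, Fintype.sum_prod_type,
    Finset.sum_eq_single r]
  · refine Finset.sum_congr rfl fun v _ => ?_
    have h2 : s.usage (r, v) = (Finset.univ.filter fun i => F i = v).card := by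
      refine congrArg Finset.card (Finset.filter_congr fun i _ => ?_)
      have h1 : F i ≠ r := fun h2 => h.root_not_fac (h2 ▸ hF i)
      simp [DiPath.arcs, hs, eq_comm, h1.symm]
    rw [h2]
  · intro u _ hu
    exact Finset.sum_eq_zero fun v _ => by simp [h.free u v hu]
  · simp
  · have h1 : s.usage e = 0 := by
      refine Finset.card_eq_zero.mpr (Finset.filter_eq_empty_iff.mpr fun i _ hi => he ?_)
      exact Finset.mem_biUnion.mpr ⟨i, Finset.mem_univ i, hi⟩
    simp [h1]

end IsTwoLevel

end Multicast

/-! ### The network of a graph -/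

namespace SharingGadget

open Multicast

section Network

variable (n k : ℕ) (adj : ℕ → ℕ → Prop)

/-- The number of candidates: pairs of a color below `k + 2` and a vertex below `n + 2`, where the
vertices `n` and `n + 1` are isolated. -/
abbrev candidates : ℕ := (k + 2) * (n + 2)

/-- The number of players: pairs of a candidate and a color. -/
abbrev players : ℕ := candidates n k * (k + 2)

/-- The number of nodes: the root, the direct facilities, the terminals, and the shared
facilities. -/
abbrev nodes : ℕ := 1 + candidates n k + players n k + candidates n k * candidates n k

/-- Two candidates are compatible if they have different colors, and different nonadjacent
vertices. -/
def Compat (x y : ℕ) : Prop :=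
  x / (n + 2) ≠ y / (n + 2) ∧ x % (n + 2) ≠ y % (n + 2) ∧ ¬ adj (x % (n + 2)) (y % (n + 2))

/-- The arc from the shared facility of the candidates `x` and `y` to the terminal of player `p`. -/
def SharedArc (x y p : ℕ) : Prop :=
  Compat n adj x y ∧ (p = y / (n + 2) + (k + 2) * x ∨ p = x / (n + 2) + (k + 2) * y)

/-- The arcs of the network, with the nodes in the order root, direct facilities, terminals, shared
facilities: from the root to all facilities, from the direct facility of a candidate to the
terminals of its players, and from a shared facility to two terminals. -/
def IsArc (u v : ℕ) : Prop :=
  (u = 0 ∧ 1 ≤ v ∧ (v < 1 + candidates n k ∨ 1 + candidates n k + players n k ≤ v)) ∨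
  ((1 + candidates n k ≤ v ∧ v < 1 + candidates n k + players n k) ∧
    ((1 ≤ u ∧ u < 1 + candidates n k ∧ (v - (1 + candidates n k)) / (k + 2) = u - 1) ∨
      (1 + candidates n k + players n k ≤ u ∧
        SharedArc n k adj ((u - (1 + candidates n k + players n k)) / candidates n k)
          ((u - (1 + candidates n k + players n k)) % candidates n k)
          (v - (1 + candidates n k)))))

/-- The cost of an arc; only the arcs that leave the root, which is the node `0`, have a cost. -/
def arcCost (u v : ℕ) : ℕ :=
  if u = 0 then if v < 1 + candidates n k then directCost (k + 2) else sharedCost (k + 2) else 0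

open Classical in
/-- The matrix of arc costs. -/
noncomputable def costMatrix (u v : Fin (nodes n k)) : Option ℚ≥0 :=
  if IsArc n k adj u v then some (arcCost n k u v : ℚ≥0) else none

variable {n k adj}

/-- The direct facility of a candidate. -/
def direct (x : Fin (candidates n k)) : Fin (nodes n k) :=
  ⟨1 + x, by have := x.2; unfold nodes; omega⟩

/-- The shared facility of two candidates. -/
def shared (e : Fin (candidates n k) × Fin (candidates n k)) : Fin (nodes n k) :=
  ⟨1 + candidates n k + players n k + finProdFinEquiv e, by
    have := (finProdFinEquiv e).2
    unfold nodes
    omega⟩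

/-- The terminal of a player. -/
def terminal (p : Fin (players n k)) : Fin (nodes n k) :=
  ⟨1 + candidates n k + p, by have := p.2; unfold nodes; omega⟩

/-- The root. -/
def root : Fin (nodes n k) := ⟨0, by unfold nodes; omega⟩

/-- The facility of a player with candidate `x`. -/
def facility (x : Fin (candidates n k)) :
    Option (Fin (candidates n k) × Fin (candidates n k)) → Fin (nodes n k)
  | none => direct x
  | some e => shared e

/-- The facilities, direct or shared. -/
def IsFacility (v : Fin (nodes n k)) : Prop :=
  1 ≤ v.val ∧ (v.val < 1 + candidates n k ∨ 1 + candidates n k + players n k ≤ v.val)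

/-- The terminals. -/
def IsTerminal (v : Fin (nodes n k)) : Prop :=
  1 + candidates n k ≤ v.val ∧ v.val < 1 + candidates n k + players n k

theorem isTerminal_terminal (p : Fin (players n k)) : IsTerminal (terminal p) := by
  have := p.2
  constructor <;> simp only [terminal] <;> omega

theorem isFacility_facility (x : Fin (candidates n k)) (o) : IsFacility (facility x o) := by
  cases o with
  | none => exact ⟨Nat.le_add_right _ _, Or.inl (Nat.add_lt_add_left x.2 1)⟩
  | some e => exact ⟨by simp only [facility, shared]; omega, Or.inr (Nat.le_add_right _ _)⟩

theorem costMatrix_ne_none {u v : Fin (nodes n k)} :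
    costMatrix n k adj u v ≠ none ↔ IsArc n k adj u v := by
  unfold costMatrix
  split_ifs with h <;> simp [h]

theorem costMatrix_root_terminal (p : Fin (players n k)) :
    costMatrix n k adj root (terminal p) = none := by
  have := p.2
  by_contra h
  have h1 := costMatrix_ne_none.mp h
  simp only [IsArc, root, terminal] at h1
  omega

theorem isTwoLevel : IsTwoLevel (costMatrix n k adj) root IsFacility IsTerminal where
  arc u v h := by
    rw [costMatrix_ne_none] at h
    rcases h with h | ⟨h1, h2⟩
    · exact Or.inl ⟨Fin.ext h.1, h.2⟩
    · refine Or.inr ⟨?_, h1⟩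
      rcases h2 with h2 | h2
      · exact ⟨h2.1, Or.inl h2.2.1⟩
      · exact ⟨by omega, Or.inr h2.1⟩
  root_not_fac h := absurd h.1 (by simp [root])
  root_not_term h := absurd h.1 (by simp [root])
  fac_not_term v h h' := by
    have h1 := h.2
    have h2 := h'.1
    have h3 := h'.2
    omega
  free u v h := by
    have h1 : u.val ≠ 0 := fun h2 => h (Fin.ext h2)
    unfold costMatrix
    split_ifs
    · simp [arcCost, h1]
    · rfl

/-- The color of a candidate. -/
abbrev color (x : Fin (candidates n k)) : Fin (k + 2) := x.divNat

/-- The compatibility relation on the candidates. -/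
def CompatFin (adj : ℕ → ℕ → Prop) (x y : Fin (candidates n k)) : Prop := Compat n adj x y

/-- The facilities that player `(x, j)` can use. -/
theorem isArc_facility (x : Fin (candidates n k)) (j : Fin (k + 2))
    (o : Option (Fin (candidates n k) × Fin (candidates n k))) :
    IsArc n k adj (facility x o) (terminal (finProdFinEquiv (x, j))) ↔
      ∀ e, o = some e → CompatFin adj e.1 e.2 ∧
        ((x, j) = (e.1, color e.2) ∨ (x, j) = (e.2, color e.1)) := by
  have hp : (finProdFinEquiv (x, j)).val < players n k := (finProdFinEquiv (x, j)).2
  have hcancel : (1 + candidates n k + (finProdFinEquiv (x, j)).val - (1 + candidates n k)) =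
      j.val + (k + 2) * x.val := by
    rw [Nat.add_sub_cancel_left, finProdFinEquiv_apply_val]
  cases o with
  | none =>
    simp only [reduceCtorEq, false_implies, implies_true, iff_true]
    refine Or.inr ⟨⟨by simp only [terminal]; omega, by simp only [terminal]; omega⟩,
      Or.inl ⟨?_, ?_, ?_⟩⟩
    · simp [facility, direct]
    · simp only [facility, direct]; have := x.2; omega
    · simp only [facility, direct, terminal]
      rw [hcancel, Nat.add_mul_div_left _ _ (by omega), Nat.div_eq_of_lt j.2]
      omega
  | some e =>
    obtain ⟨y, z⟩ := e
    have h1 : (1 + candidates n k + players n k + (finProdFinEquiv (y, z)).val -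
        (1 + candidates n k + players n k)) = z.val + candidates n k * y.val := by
      rw [Nat.add_sub_cancel_left, finProdFinEquiv_apply_val]
    have h2 : (z.val + candidates n k * y.val) / candidates n k = y := by
      rw [Nat.add_mul_div_left _ _ (by omega), Nat.div_eq_of_lt z.2, zero_add]
    have h3 : (z.val + candidates n k * y.val) % candidates n k = z := by
      rw [Nat.add_mul_mod_self_left, Nat.mod_eq_of_lt z.2]
    have hinj (a b : Fin (candidates n k)) : j.val + (k + 2) * x.val = a / (n + 2) + (k + 2) * b ↔
        (x, j) = (b, color a) := by
      rw [← finProdFinEquiv.apply_eq_iff_eq, Fin.ext_iff, finProdFinEquiv_apply_val,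
        finProdFinEquiv_apply_val, Fin.coe_divNat]
    simp only [Option.some.injEq, forall_eq', CompatFin, IsArc, facility, shared, terminal]
    rw [hcancel, h1, h2, h3, SharedArc, hinj, hinj]
    constructor
    · rintro (h | ⟨-, h | h⟩)
      · omega
      · omega
      · exact ⟨h.2.1, h.2.2⟩
    · intro h
      exact Or.inr ⟨⟨by omega, by omega⟩, Or.inr ⟨by omega, h⟩⟩

theorem exists_eq_facility (x : Fin (candidates n k)) (j : Fin (k + 2)) {f : Fin (nodes n k)}
    (h : IsArc n k adj f (terminal (finProdFinEquiv (x, j)))) : ∃ o, f = facility x o := by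
  have hp : (finProdFinEquiv (x, j)).val < players n k := (finProdFinEquiv (x, j)).2
  rcases h with h | ⟨-, h | h⟩
  · simp only [terminal] at h
    omega
  · refine ⟨none, Fin.ext ?_⟩
    simp only [terminal] at h
    rw [Nat.add_sub_cancel_left, finProdFinEquiv_apply_val, Nat.add_mul_div_left _ _ (by omega),
      Nat.div_eq_of_lt j.2] at h
    have h1 := h.2.2
    simp only [facility, direct]
    dsimp only at h1
    omega
  · refine ⟨some (finProdFinEquiv.symm ⟨f - (1 + candidates n k + players n k), ?_⟩), Fin.ext ?_⟩
    · have : f.val < 1 + candidates n k + players n k + candidates n k * candidates n k := f.2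
      omega
    · simp only [facility, shared, Equiv.apply_symm_apply]
      omega

theorem facility_injective (x : Fin (candidates n k)) : Function.Injective (facility x) := by
  intro o o' h
  have h' := congrArg Fin.val h
  have hx := x.2
  cases o <;> cases o' <;> simp only [facility, direct, shared] at h'
  · rfl
  · omega
  · omega
  · rw [finProdFinEquiv.injective (Fin.ext (Nat.add_left_cancel h'))]

theorem root_ne_facility (x : Fin (candidates n k)) (o) :
    root ≠ facility x o := by
  intro h
  have := (isFacility_facility x o).1
  rw [← h] at this
  simp [root] at this

theorem facility_ne_terminal (x : Fin (candidates n k)) (o) (p : Fin (players n k)) :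
    facility x o ≠ terminal p :=
  fun h => isTwoLevel (adj := fun _ _ => False).fac_not_term _ (isFacility_facility x o)
    (h ▸ isTerminal_terminal p)

theorem root_ne_terminal (p : Fin (players n k)) : root ≠ terminal p :=
  fun h => isTwoLevel (adj := fun _ _ => False).root_not_term (h ▸ isTerminal_terminal p)

theorem isArc_root_facility (x : Fin (candidates n k)) (o) :
    IsArc n k adj (root : Fin (nodes n k)) (facility x o) :=
  Or.inl ⟨rfl, isFacility_facility x o⟩

theorem finProdFinEquiv_divNat_modNat (p : Fin (players n k)) :
    finProdFinEquiv (p.divNat, p.modNat) = p :=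
  finProdFinEquiv.apply_symm_apply p

/-- The path of a player through a facility. -/
def path (p : Fin (players n k)) (o)
    (h : IsArc n k adj (facility p.divNat o) (terminal p)) :
    DiPath (digraphOfCost (costMatrix n k adj)) root (terminal p) where
  verts := [root, facility p.divNat o, terminal p]
  isChain := by
    have h1 := costMatrix_ne_none.mpr (isArc_root_facility (adj := adj) p.divNat o)
    have h2 := costMatrix_ne_none.mpr h
    simpa [digraphOfCost] using ⟨h1, h2⟩
  nodup := by
    simp [root_ne_facility, root_ne_terminal, facility_ne_terminal]
  head_eq := rfl
  last_eq := rfl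

theorem isArc_of_isAssignment {φ} (hφ : IsAssignment color (CompatFin (n := n) (k := k) adj) φ)
    (p : Fin (players n k)) :
    IsArc n k adj (facility p.divNat (φ (p.divNat, p.modNat))) (terminal p) := by
  have h := (isArc_facility (adj := adj) p.divNat p.modNat (φ (p.divNat, p.modNat))).mpr
    fun e he => hφ _ e he
  rwa [finProdFinEquiv_divNat_modNat] at h

theorem isArc_direct (p : Fin (players n k)) :
    IsArc n k adj (facility p.divNat none) (terminal p) := by
  have h := (isArc_facility (adj := adj) p.divNat p.modNat none).mpr (by simp)
  rwa [finProdFinEquiv_divNat_modNat] at h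

variable (n k adj) in
/-- The profile in which all players use their direct facilities. -/
def initial : Profile (digraphOfCost (costMatrix n k adj)) root terminal :=
  fun p => path p none (isArc_direct p)

variable (n k adj) in
/-- The instance of local search for the given graph; at most `(k + 2) * (k + 1)` players may
move, which is the number of movable players of `k + 2` candidates. -/
noncomputable def lsInstance : LSInstance where
  n := nodes n k
  cost := costMatrix n k adj
  root := root
  players := players n k
  terminal := terminal
  profile := initial n k adj
  k := (k + 2) * (k + 1)

theorem sum_nodes {g : Fin (nodes n k) → ℚ} (h0 : g root = 0) (ht : ∀ p, g (terminal p) = 0) :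
    ∑ v, g v = ∑ x, g (direct x) + ∑ e, g (shared e) := by
  unfold nodes at g ⊢
  rw [Fin.sum_univ_add, Fin.sum_univ_add, Fin.sum_univ_add]
  have e1 : ∑ i : Fin 1, g (Fin.castAdd _ (Fin.castAdd _ (Fin.castAdd _ i))) = 0 := by
    rw [Fin.sum_univ_one]
    exact h0
  have e2 : ∑ i : Fin (players n k), g (Fin.castAdd _ (Fin.natAdd _ i)) = 0 :=
    Finset.sum_eq_zero fun i _ => ht i
  have e3 : ∑ e : Fin (candidates n k * candidates n k), g (Fin.natAdd _ e) =
      ∑ e, g (shared e) :=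
    (finProdFinEquiv.sum_comp _).symm
  rw [e1, e2, e3, zero_add, add_zero]
  rfl

theorem cost_direct (x : Fin (candidates n k)) :
    (costMatrix n k adj root (direct x)).getD 0 = directCost (k + 2) := by
  have h : IsArc n k adj (root : Fin (nodes n k)) (direct x) := isArc_root_facility x none
  rw [costMatrix, if_pos h]
  simp [arcCost, root, direct]

theorem cost_shared (e : Fin (candidates n k) × Fin (candidates n k)) :
    (costMatrix n k adj root (shared e)).getD 0 = sharedCost (k + 2) := by
  have h : IsArc n k adj (root : Fin (nodes n k)) (shared e) := isArc_root_facility e.1 (some e)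
  rw [costMatrix, if_pos h]
  simp [arcCost, root, shared, add_assoc]

theorem cost_root : costMatrix n k adj root root = none := by
  by_contra h
  have h1 := costMatrix_ne_none.mp h
  simp only [IsArc, root] at h1
  omega

theorem facility_eq_direct {x y : Fin (candidates n k)} {o} :
    facility x o = direct y ↔ o = none ∧ x = y := by
  have hx := x.2
  have hy := y.2
  cases o <;> simp only [facility, direct, shared, Fin.ext_iff, reduceCtorEq, true_and, false_and,
    iff_false] <;> omega

theorem facility_eq_shared {x : Fin (candidates n k)} {o e} :
    facility x o = shared e ↔ o = some e := by
  rw [show shared e = facility x (some e) from rfl, (facility_injective x).eq_iff]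

/-- The potential of a profile that is given by an assignment. -/
theorem sum_cost_eq (φ : Fin (candidates n k) × Fin (k + 2) →
    Option (Fin (candidates n k) × Fin (candidates n k))) :
    ∑ v, ((costMatrix n k adj root v).getD 0 : ℚ) * harmonic (Finset.univ.filter
      fun p : Fin (players n k) => facility p.divNat (φ (p.divNat, p.modNat)) = v).card =
      potential φ := by
  have h1 (v : Fin (nodes n k)) : (Finset.univ.filter
      fun p : Fin (players n k) => facility p.divNat (φ (p.divNat, p.modNat)) = v).card =
      (Finset.univ.filter fun p : Fin (candidates n k) × Fin (k + 2) =>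
        facility p.1 (φ p) = v).card := by
    rw [Finset.card_filter, Finset.card_filter, ← finProdFinEquiv.symm.sum_comp]
    rfl
  simp only [h1]
  rw [sum_nodes (by rw [cost_root]; simp) fun p => by rw [costMatrix_root_terminal]; simp]
  simp only [cost_direct, cost_shared, facility_eq_direct, facility_eq_shared, potential,
    Finset.mul_sum]
  congr 1
  refine Finset.sum_congr rfl fun x _ => ?_
  have h2 : (Finset.univ.filter fun p : Fin (candidates n k) × Fin (k + 2) =>
      φ p = none ∧ p.1 = x).card = stay φ x := by
    rw [stay, Finset.card_filter, Finset.card_filter, Fintype.sum_prod_type,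
      Finset.sum_eq_single x (fun y _ hy => by simp [hy]) (by simp)]
    simp
  rw [h2]
  simp

theorem rosenthal_eq {s : Profile (digraphOfCost (costMatrix n k adj)) root terminal} {φ}
    (hs : ∀ p, (s p).verts = [root, facility p.divNat (φ (p.divNat, p.modNat)), terminal p]) :
    (lsInstance n k adj).rosenthal s = (potential φ : ℚ) := by
  rw [← sum_cost_eq (adj := adj)]
  exact isTwoLevel.potential_eq s (fun p => isFacility_facility _ _) hs

theorem dist_eq {s : Profile (digraphOfCost (costMatrix n k adj)) root terminal} {φ}
    (hs : ∀ p, (s p).verts = [root, facility p.divNat (φ (p.divNat, p.modNat)), terminal p]) :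
    (initial n k adj).dist s = moved φ := by
  classical
  have h : ∀ p, initial n k adj p ≠ s p ↔ φ (p.divNat, p.modNat) ≠ none := by
    intro p
    rw [not_iff_not, DiPath.ext_iff, hs]
    simp only [initial, path, List.cons.injEq, true_and, and_true]
    rw [(facility_injective _).eq_iff, eq_comm]
  unfold Profile.dist moved
  simp only [h]
  rw [Finset.card_filter, Finset.card_filter, ← finProdFinEquiv.symm.sum_comp]
  rfl

theorem potential_none : potential (fun _ : Fin (candidates n k) × Fin (k + 2) => none) =
    directCost (k + 2) * ∑ _x : Fin (candidates n k), harmonic (k + 2) := by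
  simp [potential, stay, users]

/-- The profile can be improved iff there is a transversal of pairwise compatible candidates. -/
theorem lsInstance_yes (hadj : ∀ u v, adj u v → adj v u) :
    lsInstance n k adj ∈ localSearch.yes ↔
      ∃ w : Fin (k + 2) → Fin (candidates n k), (∀ i, color (w i) = i) ∧
        ∀ i j, i ≠ j → CompatFin adj (w i) (w j) := by
  have hinit : (lsInstance n k adj).rosenthal (lsInstance n k adj).profile =
      (directCost (k + 2) * ∑ _x : Fin (candidates n k), harmonic (k + 2) : ℚ) := by
    rw [← potential_none]
    exact rosenthal_eq (s := initial n k adj) (φ := fun _ => none) fun p => rfl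
  constructor
  · rintro ⟨(s : Profile (digraphOfCost (costMatrix n k adj)) root terminal), hs, hd⟩
    have h1 : ∀ p : Fin (candidates n k) × Fin (k + 2), ∃ o,
        IsArc n k adj (facility p.1 o) (terminal (finProdFinEquiv p)) ∧
        (s (finProdFinEquiv p)).verts = [root, facility p.1 o, terminal (finProdFinEquiv p)] := by
      intro p
      obtain ⟨f, -, h2, h3⟩ := isTwoLevel.exists_verts_eq (isTerminal_terminal _)
        (s (finProdFinEquiv p))
      have h4 := costMatrix_ne_none.mp h2
      obtain ⟨o, rfl⟩ := exists_eq_facility p.1 p.2 h4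
      exact ⟨o, h4, h3⟩
    choose φ hφ hv using h1
    have hv' : ∀ p, (s p).verts =
        [root, facility p.divNat (φ (p.divNat, p.modNat)), terminal p] := by
      intro (p : Fin (players n k))
      have := hv (p.divNat, p.modNat)
      rwa [finProdFinEquiv_divNat_modNat] at this
    rw [hinit, rosenthal_eq hv', Rat.cast_lt] at hs
    replace hd : (initial n k adj).dist s ≤ (k + 2) * (k + 1) := hd
    rw [dist_eq hv'] at hd
    refine exists_transversal (R := CompatFin adj) (by omega) ?_ ?_
      (fun p e he => (isArc_facility p.1 p.2 _).mp (hφ p) e he) hs hd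
    · exact fun x y h => ⟨h.1.symm, h.2.1.symm, fun h' => h.2.2 (hadj _ _ h')⟩
    · exact fun x y h h' => h.1 (congrArg Fin.val h')
  · rintro ⟨w, hw, hwR⟩
    obtain ⟨hφ, hlt, hm⟩ := exists_assignment (R := CompatFin adj) (by omega) hw hwR
    refine ⟨fun p => path p _ (isArc_of_isAssignment hφ p), ?_, ?_⟩
    · rw [hinit]
      exact (rosenthal_eq fun p => rfl).trans_lt (Rat.cast_lt.mpr hlt)
    · exact (dist_eq fun p => rfl).trans_le hm

end Network

end SharingGadget

/-! ### Independent sets and transversals -/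

namespace SharingGadget

open Multicast ParamComplexity

/-- The adjacency relation of the graph of an instance of Independent Set. -/
def adjOf (I : ISInstance) (u v : ℕ) : Prop :=
  ∃ (hu : u < I.n) (hv : v < I.n), I.graph.Adj ⟨u, hu⟩ ⟨v, hv⟩

theorem adjOf_symm {I : ISInstance} (u v : ℕ) (h : adjOf I u v) : adjOf I v u := by
  obtain ⟨hu, hv, h⟩ := h
  exact ⟨hv, hu, h.symm⟩

/-- Adding two isolated vertices increases the independence number by two. -/
theorem exists_transversal_iff (I : ISInstance) :
    (∃ w : Fin (I.k + 2) → Fin (candidates I.n I.k), (∀ i, color (w i) = i) ∧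
      ∀ i j, i ≠ j → CompatFin (adjOf I) (w i) (w j)) ↔ I ∈ independentSet.yes := by
  constructor
  · rintro ⟨w, -, hw⟩
    set u : Fin (I.k + 2) → ℕ := fun i => w i % (I.n + 2) with hu
    have hinj : Function.Injective u := by
      intro i j h
      by_contra hij
      exact (hw i j hij).2.1 h
    set T := Finset.univ.filter fun v : Fin I.n => ∃ i, u i = v with hT
    have hcard : I.k ≤ T.card := by
      have h1 : Finset.univ.image u ⊆ T.map Fin.valEmbedding ∪ {I.n, I.n + 1} := by
        intro a ha
        obtain ⟨i, -, rfl⟩ := Finset.mem_image.mp ha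
        by_cases h : u i < I.n
        · refine Finset.mem_union_left _ (Finset.mem_map.mpr ⟨⟨u i, h⟩, ?_, rfl⟩)
          exact Finset.mem_filter.mpr ⟨Finset.mem_univ _, i, rfl⟩
        · have h2 : u i < I.n + 2 := Nat.mod_lt _ (by omega)
          refine Finset.mem_union_right _ ?_
          simp only [Finset.mem_insert, Finset.mem_singleton]
          omega
      have h2 := (Finset.card_le_card h1).trans (Finset.card_union_le _ _)
      rw [Finset.card_image_of_injective _ hinj, Finset.card_map, Finset.card_univ,
        Fintype.card_fin] at h2
      have h3 : ({I.n, I.n + 1} : Finset ℕ).card ≤ 2 := Finset.card_le_two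
      omega
    obtain ⟨S, hS, hSk⟩ := Finset.exists_subset_card_eq hcard
    refine ⟨S, hSk, fun a ha b hb hab h => ?_⟩
    obtain ⟨i, hi⟩ := (Finset.mem_filter.mp (hS ha)).2
    obtain ⟨j, hj⟩ := (Finset.mem_filter.mp (hS hb)).2
    have hij : i ≠ j := by
      rintro rfl
      exact hab (Fin.ext (hi.symm.trans hj))
    refine (hw i j hij).2.2 ?_
    change adjOf I (u i) (u j)
    rw [hi, hj]
    exact ⟨a.2, b.2, h⟩
  · rintro ⟨S, hS, hind⟩
    set T : Finset ℕ := insert I.n (insert (I.n + 1) (S.map Fin.valEmbedding)) with hT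
    have hlt : ∀ a ∈ S.map Fin.valEmbedding, a < I.n := by
      intro a ha
      obtain ⟨b, -, rfl⟩ := Finset.mem_map.mp ha
      exact b.2
    have hcard : T.card = I.k + 2 := by
      rw [hT, Finset.card_insert_of_notMem, Finset.card_insert_of_notMem, Finset.card_map, hS]
      · exact fun h => absurd (hlt _ h) (by omega)
      · rw [Finset.mem_insert]
        rintro (h | h)
        · omega
        · exact absurd (hlt _ h) (by omega)
    have hTlt : ∀ a ∈ T, a < I.n + 2 := by
      intro a ha
      rcases Finset.mem_insert.mp ha with rfl | ha
      · omega
      rcases Finset.mem_insert.mp ha with rfl | ha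
      · omega
      · have := hlt a ha
        omega
    have hTS : ∀ a ∈ T, ∀ ha : a < I.n, (⟨a, ha⟩ : Fin I.n) ∈ S := by
      intro a ha ha'
      rcases Finset.mem_insert.mp ha with rfl | ha
      · omega
      rcases Finset.mem_insert.mp ha with rfl | ha
      · omega
      · obtain ⟨b, hb, rfl⟩ := Finset.mem_map.mp ha
        exact hb
    set g := T.orderEmbOfFin hcard with hg
    have hgT : ∀ i, g i ∈ T := fun i => Finset.orderEmbOfFin_mem T hcard i
    have hdiv (i : Fin (I.k + 2)) : (g i + (I.n + 2) * i.val) / (I.n + 2) = i := by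
      rw [Nat.add_mul_div_left _ _ (by omega), Nat.div_eq_of_lt (hTlt _ (hgT i)), zero_add]
    have hmod (i : Fin (I.k + 2)) : (g i + (I.n + 2) * i.val) % (I.n + 2) = g i := by
      rw [Nat.add_mul_mod_self_left, Nat.mod_eq_of_lt (hTlt _ (hgT i))]
    refine ⟨fun i => ⟨g i + (I.n + 2) * i, ?_⟩, fun i => Fin.ext (hdiv i), fun i j hij => ?_⟩
    · have h1 := hTlt _ (hgT i)
      have h2 := Nat.mul_le_mul_left (I.n + 2) (Nat.succ_le_of_lt i.2)
      rw [Nat.mul_succ] at h2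
      rw [candidates, Nat.mul_comm (I.k + 2)]
      omega
    · rw [CompatFin, Compat, hdiv, hdiv, hmod, hmod]
      refine ⟨fun h => hij (Fin.ext h), fun h => hij (g.injective h), ?_⟩
      rintro ⟨hu, hv, h⟩
      refine hind (hTS _ (hgT i) hu) (hTS _ (hgT j) hv) (fun h' => hij (g.injective ?_)) h
      simpa using h'

theorem lsInstance_mem_yes_iff (I : ISInstance) :
    I ∈ independentSet.yes ↔ lsInstance I.n I.k (adjOf I) ∈ localSearch.yes := by
  rw [lsInstance_yes adjOf_symm, exists_transversal_iff]

end SharingGadget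

/-! ### The encodings of the instances -/

theorem List.flatMap_range_map {β : Type} (n m : ℕ) (g : ℕ → ℕ → β) :
    ((List.range n).flatMap fun u => (List.range m).map (g u)) =
      (List.range (n * m)).map fun a => g (a / m) (a % m) := by
  induction n with
  | zero => simp
  | succ n ih =>
    rw [List.range_succ, List.flatMap_append, ih, Nat.succ_mul, List.range_add, List.map_append,
      List.flatMap_singleton, List.map_map]
    congr 1
    refine List.map_congr_left fun v hv => ?_
    have hv' : v < m := List.mem_range.mp hv
    simp only [Function.comp]
    rw [Nat.mul_comm n, Nat.mul_add_div (by omega), Nat.div_eq_of_lt hv', Nat.mul_add_mod,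
      Nat.mod_eq_of_lt hv', add_zero]

theorem List.flatMap_finRange {β : Type} (n : ℕ) (g : ℕ → List β) :
    ((List.finRange n).flatMap fun u : Fin n => g u) = (List.range n).flatMap g := by
  rw [← List.map_coe_finRange_eq_range, List.flatMap_map]

namespace SharingGadget

open Multicast ParamComplexity StackProg

section
open Classical

/-- The numerator (`c = 0`) or the denominator (`c = 1`) of the cost of an arc. -/
noncomputable def matrixEntry (n k : ℕ) (adj : ℕ → ℕ → Prop) (u v c : ℕ) : ℕ :=
  if IsArc n k adj u v then if c = 0 then arcCost n k u v else 1 else 0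

/-- The terminal of player `p`, the number of nodes of his path, and these nodes. -/
def playerEntry (n k p c : ℕ) : ℕ :=
  if c = 1 then 3 else if c = 2 then 0 else if c = 3 then 1 + p / (k + 2) else
    1 + candidates n k + p

/-- The number of nodes, the root, the number of players, and the number of players that may
move. -/
def headerEntry (n k i : ℕ) : ℕ :=
  if i = 0 then nodes n k else if i = 1 then 0 else if i = 2 then players n k else
    (k + 2) * (k + 1)

/-- The number of numbers that describe the matrix of arc costs. -/
def matrixLength (n k : ℕ) : ℕ := nodes n k * (nodes n k * 2)

/-- The number of numbers that describe the instance. -/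
def instLength (n k : ℕ) : ℕ := 4 + (matrixLength n k + players n k * 5)

/-- The numbers that describe the instance. -/
noncomputable def entry (n k : ℕ) (adj : ℕ → ℕ → Prop) (i : ℕ) : ℕ :=
  if i < 4 then headerEntry n k i
  else if i - 4 < matrixLength n k then
    matrixEntry n k adj ((i - 4) / (nodes n k * 2)) ((i - 4) % (nodes n k * 2) / 2)
      ((i - 4) % (nodes n k * 2) % 2)
  else playerEntry n k ((i - 4 - matrixLength n k) / 5) ((i - 4 - matrixLength n k) % 5)

theorem costToNats_costMatrix (n k : ℕ) (adj : ℕ → ℕ → Prop) (u v : Fin (nodes n k)) :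
    costToNats (costMatrix n k adj u v) = (List.range 2).map (matrixEntry n k adj u v) := by
  unfold costMatrix
  split_ifs with h <;> simp [costToNats, matrixEntry, h, List.range_succ]

theorem toNats_lsInstance (n k : ℕ) (adj : ℕ → ℕ → Prop) :
    (lsInstance n k adj).toNats = (List.range (instLength n k)).map (entry n k adj) := by
  have h1 : ((List.finRange (nodes n k)).flatMap fun u => (List.finRange (nodes n k)).flatMap
      fun v => costToNats (costMatrix n k adj u v)) =
      (List.range (matrixLength n k)).map fun i => matrixEntry n k adj (i / (nodes n k * 2))
        (i % (nodes n k * 2) / 2) (i % (nodes n k * 2) % 2) := by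
    simp only [costToNats_costMatrix]
    have (u : ℕ) : ((List.finRange (nodes n k)).flatMap fun v : Fin (nodes n k) =>
        (List.range 2).map (matrixEntry n k adj u v)) =
        (List.range (nodes n k * 2)).map fun a => matrixEntry n k adj u (a / 2) (a % 2) := by
      rw [List.flatMap_finRange (nodes n k) fun v => (List.range 2).map (matrixEntry n k adj u v),
        List.flatMap_range_map]
    simp only [this]
    rw [List.flatMap_finRange (nodes n k) fun u => (List.range (nodes n k * 2)).map fun a =>
      matrixEntry n k adj u (a / 2) (a % 2), List.flatMap_range_map (nodes n k) _
      fun u a => matrixEntry n k adj u (a / 2) (a % 2), matrixLength]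
  have h2 : ((List.finRange (players n k)).flatMap fun p => (terminal p : ℕ) ::
      (initial n k adj p).verts.length :: (initial n k adj p).verts.map Fin.val) =
      (List.range (players n k * 5)).map fun i => playerEntry n k (i / 5) (i % 5) := by
    rw [← List.flatMap_range_map, ← List.flatMap_finRange]
    refine List.flatMap_congr fun p _ => ?_
    simp [initial, path, playerEntry, List.range_succ, terminal, facility, direct, root]
  have h3 : (lsInstance n k adj).toNats = (List.range 4).map (headerEntry n k) ++
      ((List.range (matrixLength n k)).map (fun i => matrixEntry n k adj (i / (nodes n k * 2))
        (i % (nodes n k * 2) / 2) (i % (nodes n k * 2) % 2)) ++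
        (List.range (players n k * 5)).map fun i => playerEntry n k (i / 5) (i % 5)) := by
    rw [← h1, ← h2]
    rfl
  rw [h3, instLength, List.range_add, List.range_add, List.map_append, List.map_append,
    List.map_append, List.map_map, List.map_map, List.map_map]
  refine congrArg₂ _ (List.map_congr_left fun i hi => ?_)
    (congrArg₂ _ (List.map_congr_left fun i hi => ?_) (List.map_congr_left fun i hi => ?_))
  · rw [entry, if_pos (List.mem_range.mp hi)]
  · simp only [Function.comp, entry]
    rw [if_neg (by omega), Nat.add_sub_cancel_left, if_pos (List.mem_range.mp hi)]
  · simp only [Function.comp, entry]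
    rw [if_neg (by omega), Nat.add_sub_cancel_left, if_neg (by omega), Nat.add_sub_cancel_left]

end

open Classical in
/-- The adjacency matrix row by row. -/
noncomputable def adjBits (I : ISInstance) : List Bool :=
  (List.range (I.n * I.n)).map fun a => decide (adjOf I (a / I.n) (a % I.n))

/-- The adjacency relation given by a 0-1 matrix with `n` columns. -/
def bitAdj (B : List Bool) (n u v : ℕ) : Prop := (u < n ∧ v < n) ∧ B.getD (u * n + v) false = true

theorem bitAdj_adjBits (I : ISInstance) : bitAdj (adjBits I) I.n = adjOf I := by
  funext u v
  refine propext ⟨?_, ?_⟩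
  · rintro ⟨⟨hu, hv⟩, h⟩
    have h1 : u * I.n + v < I.n * I.n := by
      have := Nat.mul_le_mul_right I.n (Nat.succ_le_of_lt hu)
      rw [Nat.succ_mul] at this
      omega
    rw [List.getD_eq_getElem _ _ (by simpa [adjBits] using h1)] at h
    simp only [adjBits, List.getElem_map, List.getElem_range, decide_eq_true_eq] at h
    rwa [Nat.mul_comm u, Nat.mul_add_div (by omega), Nat.div_eq_of_lt hv, Nat.mul_add_mod,
      Nat.mod_eq_of_lt hv, add_zero] at h
  · intro h
    obtain ⟨hu, hv, -⟩ := id h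
    refine ⟨⟨hu, hv⟩, ?_⟩
    have h1 : u * I.n + v < I.n * I.n := by
      have := Nat.mul_le_mul_right I.n (Nat.succ_le_of_lt hu)
      rw [Nat.succ_mul] at this
      omega
    rw [List.getD_eq_getElem _ _ (by simpa [adjBits] using h1)]
    simp only [adjBits, List.getElem_map, List.getElem_range, decide_eq_true_eq]
    rwa [Nat.mul_comm u, Nat.mul_add_div (by omega), Nat.div_eq_of_lt hv, Nat.mul_add_mod,
      Nat.mod_eq_of_lt hv, add_zero]

theorem toNats_isInstance (I : ISInstance) :
    I.toNats = I.n :: I.k :: (adjBits I).map Bool.toNat := by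
  classical
  have h1 (u v : Fin I.n) : (if I.graph.Adj u v then 1 else 0) =
      (decide (adjOf I u v)).toNat := by
    have : adjOf I u v ↔ I.graph.Adj u v := ⟨fun ⟨_, _, h⟩ => h, fun h => ⟨u.2, v.2, h⟩⟩
    by_cases h : I.graph.Adj u v <;> simp [this, h]
  have h2 (u : ℕ) : ((List.finRange I.n).flatMap fun v : Fin I.n =>
      [(decide (adjOf I u v)).toNat]) =
      (List.range I.n).map fun v => (decide (adjOf I u v)).toNat := by
    rw [List.flatMap_finRange I.n fun v => [(decide (adjOf I u v)).toNat]]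
    exact List.map_eq_flatMap.symm
  simp only [ISInstance.toNats, adjBits, List.map_map]
  congr 2
  have h3 := List.flatMap_range_map I.n I.n fun u v => (decide (adjOf I u v)).toNat
  rw [← List.flatMap_finRange] at h3
  refine Eq.trans (List.flatMap_congr fun u _ => ?_) h3
  rw [← h2]
  refine List.flatMap_congr fun v _ => ?_
  rw [← h1]

end SharingGadget

/-! ### The reduction from Independent Set -/

namespace SharingGadget

open Multicast ParamComplexity StackProg

section
variable {f g h : List Bool → (ℕ → ℕ) → ℕ}

theorem comp_scale (hf : Comp f) : Comp fun B ρ => scale (f B ρ) :=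
  ((Comp.const 2).mul (hf.mul (hf.mul (hf.mul (hf.mul hf))))).congr fun B ρ => by
    rw [scale]
    ring

theorem comp_roundedSum (hf : Comp f) : Comp fun B ρ => roundedSum (f B ρ) := by
  have h := Comp.call (Comp.sum 1 ((Comp.var 0).sub .one)
    ((comp_scale (.var 0)).div ((Comp.var 1).add (.const 2)))) hf .zero
  refine h.congr fun B ρ => ?_
  simp [roundedSum, Comp.env₂]

theorem comp_directCost (hf : Comp f) : Comp fun B ρ => directCost (f B ρ) :=
  ((Comp.const 3).mul (hf.sub .one)).mul (comp_scale hf)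

theorem comp_sharedCost (hf : Comp f) : Comp fun B ρ => sharedCost (f B ρ) :=
  (Comp.const 4).mul ((comp_roundedSum hf).sub .one)

theorem comp_colors : Comp fun _ ρ => ρ 1 + 2 := (Comp.var 1).add (.const 2)

theorem comp_vertices : Comp fun _ ρ => ρ 0 + 2 := (Comp.var 0).add (.const 2)

theorem comp_candidates : Comp fun _ ρ => candidates (ρ 0) (ρ 1) := comp_colors.mul comp_vertices

theorem comp_players : Comp fun _ ρ => players (ρ 0) (ρ 1) := comp_candidates.mul comp_colors

theorem comp_direct_end : Comp fun _ ρ => 1 + candidates (ρ 0) (ρ 1) :=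
  Comp.one.add comp_candidates

theorem comp_terminal_end : Comp fun _ ρ => 1 + candidates (ρ 0) (ρ 1) + players (ρ 0) (ρ 1) :=
  comp_direct_end.add comp_players

theorem comp_nodes : Comp fun _ ρ => nodes (ρ 0) (ρ 1) :=
  comp_terminal_end.add (comp_candidates.mul comp_candidates)

theorem compPred_bitAdj (hf : Comp f) (hg : Comp g) :
    CompPred fun B ρ => bitAdj B (ρ 0) (f B ρ) (g B ρ) :=
  ((CompPred.lt hf (.var 0)).and (CompPred.lt hg (.var 0))).and
    (CompPred.bit ((hf.mul (.var 0)).add hg))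

theorem compPred_compat (hf : Comp f) (hg : Comp g) :
    CompPred fun B ρ => Compat (ρ 0) (bitAdj B (ρ 0)) (f B ρ) (g B ρ) :=
  (CompPred.eq (hf.div comp_vertices) (hg.div comp_vertices)).not.and
    ((CompPred.eq (hf.mod comp_vertices) (hg.mod comp_vertices)).not.and
      (compPred_bitAdj (hf.mod comp_vertices) (hg.mod comp_vertices)).not)

theorem compPred_sharedArc (hf : Comp f) (hg : Comp g) (hh : Comp h) :
    CompPred fun B ρ => SharedArc (ρ 0) (ρ 1) (bitAdj B (ρ 0)) (f B ρ) (g B ρ) (h B ρ) :=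
  (compPred_compat hf hg).and
    ((CompPred.eq hh ((hg.div comp_vertices).add (comp_colors.mul hf))).or
      (CompPred.eq hh ((hf.div comp_vertices).add (comp_colors.mul hg))))

theorem compPred_isArc (hf : Comp f) (hg : Comp g) :
    CompPred fun B ρ => IsArc (ρ 0) (ρ 1) (bitAdj B (ρ 0)) (f B ρ) (g B ρ) :=
  ((CompPred.eq hf .zero).and ((CompPred.le .one hg).and
    ((CompPred.lt hg comp_direct_end).or (CompPred.le comp_terminal_end hg)))).or
  (((CompPred.le comp_direct_end hg).and (CompPred.lt hg comp_terminal_end)).and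
    (((CompPred.le .one hf).and ((CompPred.lt hf comp_direct_end).and
      (CompPred.eq ((hg.sub comp_direct_end).div comp_colors) (hf.sub .one)))).or
      ((CompPred.le comp_terminal_end hf).and
        (compPred_sharedArc ((hf.sub comp_terminal_end).div comp_candidates)
          ((hf.sub comp_terminal_end).mod comp_candidates) (hg.sub comp_direct_end)))))

theorem comp_arcCost (hf : Comp f) (hg : Comp g) :
    Comp fun B ρ => arcCost (ρ 0) (ρ 1) (f B ρ) (g B ρ) :=
  Comp.ite (CompPred.eq hf .zero) (Comp.ite (CompPred.lt hg comp_direct_end)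
    (comp_directCost comp_colors) (comp_sharedCost comp_colors)) .zero

open Classical in
theorem comp_matrixEntry (hf : Comp f) (hg : Comp g) (hh : Comp h) :
    Comp fun B ρ => matrixEntry (ρ 0) (ρ 1) (bitAdj B (ρ 0)) (f B ρ) (g B ρ) (h B ρ) :=
  Comp.ite (compPred_isArc hf hg) (Comp.ite (CompPred.eq hh .zero) (comp_arcCost hf hg) .one) .zero

theorem comp_playerEntry (hf : Comp f) (hg : Comp g) :
    Comp fun B ρ => playerEntry (ρ 0) (ρ 1) (f B ρ) (g B ρ) :=
  Comp.ite (CompPred.eq hg .one) (.const 3) (Comp.ite (CompPred.eq hg (.const 2)) .zero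
    (Comp.ite (CompPred.eq hg (.const 3)) (Comp.one.add (hf.div comp_colors))
      (comp_direct_end.add hf)))

theorem comp_headerEntry (hf : Comp f) : Comp fun B ρ => headerEntry (ρ 0) (ρ 1) (f B ρ) :=
  Comp.ite (CompPred.eq hf .zero) comp_nodes (Comp.ite (CompPred.eq hf .one) .zero
    (Comp.ite (CompPred.eq hf (.const 2)) comp_players
      (comp_colors.mul ((Comp.var 1).add .one))))

theorem comp_matrixLength : Comp fun _ ρ => matrixLength (ρ 0) (ρ 1) :=
  comp_nodes.mul (comp_nodes.mul (.const 2))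

theorem comp_instLength : Comp fun _ ρ => instLength (ρ 0) (ρ 1) :=
  (Comp.const 4).add (comp_matrixLength.add (comp_players.mul (.const 5)))

theorem comp_entry : Comp fun B ρ => entry (ρ 0) (ρ 1) (bitAdj B (ρ 0)) (ρ 2) := by
  have h1 : Comp fun _ ρ => ρ 2 - 4 := (Comp.var 2).sub (.const 4)
  have h2 : Comp fun _ ρ => nodes (ρ 0) (ρ 1) * 2 := comp_nodes.mul (.const 2)
  have h3 := h1.sub comp_matrixLength
  exact Comp.ite (CompPred.lt (.var 2) (.const 4)) (comp_headerEntry (.var 2))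
    (Comp.ite (CompPred.lt h1 comp_matrixLength)
      (comp_matrixEntry (h1.div h2) ((h1.mod h2).div (.const 2)) ((h1.mod h2).mod (.const 2)))
      (comp_playerEntry (h3.div (.const 5)) (h3.mod (.const 5))))

end

theorem length_le_length_encodeNats (l : List ℕ) : l.length ≤ (encodeNats l).length := by
  induction l with
  | nil => simp
  | cons a l ih =>
    rw [encodeNats_cons, List.length_cons, List.length_append, List.length_cons]
    omega

/-- The numbers of vertices and of entries of the adjacency matrix are bounded in terms of the size
of the instance. -/
theorem size_bound (I : ISInstance) :
    I.n * I.n + I.k + 2 ≤ (I.k + 2) * (independentSet.size I + 1) := by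
  have h1 : I.n * I.n + 2 ≤ independentSet.size I := by
    have := length_le_length_encodeNats I.toNats
    rw [toNats_isInstance] at this
    simp only [List.length_cons, List.length_map, adjBits, List.length_range] at this
    rw [← adjBits, ← toNats_isInstance] at this
    exact this
  have h2 := Nat.mul_le_mul_left (I.k + 2) (show I.n * I.n + 1 ≤ independentSet.size I + 1 by omega)
  have h3 : (I.k + 2) * (I.n * I.n + 1) = I.k * (I.n * I.n) + 2 * (I.n * I.n) + I.k + 2 := by ring
  omega

theorem computable_budget : Computable fun k : ℕ => (k + 2) * (k + 1) :=
  (Primrec.nat_mul.comp (Primrec.nat_add.comp .id (.const 2))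
    (Primrec.nat_add.comp .id (.const 1))).to_comp

/-- Independent Set reduces to local search on the Rosenthal potential. -/
theorem fptReducible_localSearch {𝓕 : Set (ℕ → ℕ)}
    (h𝓕 : 𝓕 = Set.univ ∨ 𝓕 = {f | Computable f}) : FPTReducible 𝓕 independentSet localSearch := by
  refine ⟨fun I => lsInstance I.n I.k (adjOf I), ⟨_, computable_budget, fun I => rfl⟩,
    lsInstance_mem_yes_iff, ?_⟩
  obtain ⟨P, U, hU, hP⟩ := exists_program comp_entry comp_instLength
  obtain ⟨c, hc⟩ := hU.add (.const 1)
  refine ⟨fun k => (k + 2) ^ c, mem_of_computable h𝓕 ?_, c, ?_⟩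
  · exact computable₂_pow.comp (Primrec.nat_add.comp .id (.const 2)).to_comp (.const c)
  · have h := computableInTime_of_runs (ea := independentSet.encoding)
      (eb := localSearch.encoding) (r := fun I : ISInstance => lsInstance I.n I.k (adjOf I))
      (T := fun I => U (I.n * I.n + I.k)) P fun (I : ISInstance) => by
        have h1 := hP I.n I.k (adjBits I) (I.n * I.n + I.k)
          ((Nat.le_mul_self _).trans (Nat.le_add_right _ _)) (Nat.le_add_left _ _)
          (by simp [adjBits])
        have h2 : independentSet.encoding.encode I = encodeNats I.toNats := rfl
        have h3 : localSearch.encoding.encode (lsInstance I.n I.k (adjOf I)) =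
          encodeNats (lsInstance I.n I.k (adjOf I)).toNats := rfl
        rw [h2, h3, toNats_isInstance, toNats_lsInstance, ← bitAdj_adjBits]
        exact h1
    refine h.mono fun I => (hc _).trans ?_
    rw [← mul_pow]
    exact Nat.pow_le_pow_left (size_bound I) c

end SharingGadget

theorem theorem3 (𝓕 : Set (ℕ → ℕ)) (h𝓕 : 𝓕 = Set.univ ∨ 𝓕 = {f | Computable f}) :
    ParamComplexity.IsW1Hard 𝓕 Multicast.localSearch ∧
    (ParamComplexity.FPT 𝓕 ≠ ParamComplexity.W1 𝓕 →
      ∀ f ∈ 𝓕, ∀ c : ℕ, ¬ Multicast.localSearch.SolvableInTime fun I =>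
        f (Multicast.localSearch.param I) * (Multicast.localSearch.size I + 1) ^ c) := by
  have h := SharingGadget.fptReducible_localSearch h𝓕
  exact ⟨fun P hP => ParamComplexity.FPTReducible.trans h𝓕 hP h, fun hne f hf c hs =>
    hne (ParamComplexity.fpt_eq_w1 h𝓕 h ⟨f, hf, c, hs⟩)⟩
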